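/- Let $\mathcal H$ and $\mathcal X_B$ be (real or complex) Hilbert spaces. An evolution operator is a family $Y(t,s)\in\mathcal L(\mathcal H)$, $0\le s\le t$, with $Y(t,t)=I$, $Y(t,r)Y(r,s)=Y(t,s)$ for $s\le r\le t$, and with $t\mapsto Y(t,s)x$ continuous on $[s,\infty)$ and $s\mapsto Y(t,s)x$ continuous on $[0,t]$ for every $x\in\mathcal H$. It is exponentially stable if $\|Y(t,s)\|\le Me^{-\alpha(t-s)}$ for all $0\le s\le t$, with constants $M\ge 0$, $\alpha>0$. Let $A_c(t)$ generate the evolution operator $Y$. Let $B_c:[0,\infty)\to\mathcal L(\mathcal X_B,\mathcal H)$, $W_c:[0,\infty)\to\mathcal L(\mathcal H)$ and $R_c:[0,\infty)\to\mathcal L(\mathcal X_B)$ be norm continuous and uniformly bounded, with $W_c(t)$ self-adjoint and nonnegative, and with $R_c(t)$ self-adjoint and uniformly coercive: $(w,R_c(t)w)\ge\delta_0\|w\|^2$ for all $t\ge0$ and $w\in\mathcal X_B$, for some $\delta_0>0$. Let $W_c^{1/2}(t)$ denote the nonnegative square root of $W_c(t)$. For a family $D(t)\in\mathcal L(\mathcal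 H)$, an evolution operator $V$ with $$V(t,s)w=Y(t,s)w+\int_s^tY(t,r)D(r)V(r,s)w\,dr\qquad(0\le s\le t,\ w\in\mathcal H)$$ is said to be generated by $A_c+D$. Assume that $(A_c,B_c)$ is uniformly stabilizable, i.e. there is a norm continuous, uniformly bounded $K:[0,\infty)\to\mathcal L(\mathcal H,\mathcal X_B)$ such that $A_c+B_cK$ generates an exponentially stable evolution operator, and that $(A_c,W_c^{1/2})$ is uniformly detectable, i.e. there is a norm continuous, uniformly bounded $L:[0,\infty)\to\mathcal L(\mathcal H)$ such that $A_c+LW_c^{1/2}$ generates an exponentially stable evolution operator. For $s\ge0$, $z_0\in\mathcal H$ and a strongly measurable control $u:[s,\infty)\to\mathcal X_B$ put $$z(t)=Y(t,s)z_0+\int_s^tY(t,r)B_c(r)u(r)\,dr,$$ $$J_\infty(u;z_0,s)=\lim_{t_f\to\infty}\int_s^{t_f}\big((z(r),W_c(r)z(r))+(u(r),R_c(r)u(r))\big)\,dr\in[0,\infty].$$ Then the following hold. (1) There is exactly one family $P_\infty(s)$, $s\ge0$, of nonnegative self-adjoint operators on $\mathcal H$ that is strongly measurable, is uniformly bounded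 on $[0,\infty)$, and solves the integral Riccati equation on the infinite interval: for some evolution operator $V$ and all $0\le s\le t$, $z_0\in\mathcal H$, $$P_\infty(s)z_0=V^*(t,s)P_\infty(t)V(t,s)z_0+\int_s^tV^*(r,s)\big(W_c(r)+P_\infty(r)B_c(r)R_c^{-1}(r)B_c^*(r)P_\infty(r)\big)V(r,s)z_0\,dr,$$ $$V(t,s)z_0=Y(t,s)z_0-\int_s^tY(t,r)B_c(r)R_c^{-1}(r)B_c^*(r)P_\infty(r)V(r,s)z_0\,dr.$$ (2) This solution gives the optimal cost: for all $s\ge0$ and $z_0\in\mathcal H$, $\min_uJ_\infty(u;z_0,s)=(P_\infty(s)z_0,z_0)$, the minimum being over strongly measurable controls and attained. (3) For all $s\ge0$, $z_0\in\mathcal H$ and every strongly measurable control $u$ with $J_\infty(u;z_0,s)<\infty$, the trajectory satisfies $\lim_{t\to\infty}\|z(t)\|=0$. -/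

import Mathlib

open Set Filter Topology MeasureTheory

noncomputable section

namespace InfiniteLQ

section Defs

variable {𝕜 H U X : Type*} [RCLike 𝕜]
  [NormedAddCommGroup H] [InnerProductSpace 𝕜 H] [CompleteSpace H]
  [NormedAddCommGroup U] [InnerProductSpace 𝕜 U] [CompleteSpace U]
  [NormedAddCommGroup X] [InnerProductSpace 𝕜 X]

/-- `Y t s`, used only for `0 ≤ s ≤ t`, is an evolution operator: `Y(t,t) = I`,
`Y(t,r) Y(r,s) = Y(t,s)`, and `Y` is strongly continuous in each time variable separately. -/
structure IsEvolutionOperator (Y : ℝ → ℝ → H →L[𝕜] H) : Prop where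
  self : ∀ t, 0 ≤ t → Y t t = ContinuousLinearMap.id 𝕜 H
  comp : ∀ t r s, 0 ≤ s → s ≤ r → r ≤ t → Y t r ∘L Y r s = Y t s
  continuousOn_left : ∀ s, 0 ≤ s → ∀ x : H, ContinuousOn (fun t => Y t s x) (Ici s)
  continuousOn_right : ∀ t, 0 ≤ t → ∀ x : H, ContinuousOn (fun s => Y t s x) (Icc 0 t)

/-- Exponential stability of an evolution operator. -/
def ExpStable (Y : ℝ → ℝ → H →L[𝕜] H) : Prop :=
  ∃ M α : ℝ, 0 ≤ M ∧ 0 < α ∧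
    ∀ s t, 0 ≤ s → s ≤ t → ‖Y t s‖ ≤ M * Real.exp (-α * (t - s))

/-- A family of bounded operators that is norm continuous and uniformly bounded on `[0, ∞)`. -/
def IsBoundedContinuousFamily {E F : Type*} [NormedAddCommGroup E] [NormedSpace 𝕜 E]
    [NormedAddCommGroup F] [NormedSpace 𝕜 F] (D : ℝ → E →L[𝕜] F) : Prop :=
  ContinuousOn D (Ici 0) ∧ ∃ M : ℝ, ∀ t, 0 ≤ t → ‖D t‖ ≤ M

/-- `V` is an evolution operator generated by the perturbation by `D(t)` of the generator of `Y`: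
`V(t,s)w = Y(t,s)w + ∫ₛᵗ Y(t,r) D(r) V(r,s) w dr`. -/
def IsPerturbedEvolution [NormedSpace ℝ H] (Y : ℝ → ℝ → H →L[𝕜] H) (D : ℝ → H →L[𝕜] H)
    (V : ℝ → ℝ → H →L[𝕜] H) : Prop :=
  IsEvolutionOperator V ∧
    ∀ s t, 0 ≤ s → s ≤ t → ∀ w : H,
      V t s w = Y t s w + ∫ r in s..t, Y t r (D r (V r s w))

/-- Uniform stabilizability of the pair `(A(t), B(t))`, where `A(t)` generates `Y`. -/
def UniformlyStabilizable [NormedSpace ℝ H] (Y : ℝ → ℝ → H →L[𝕜] H)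
    (B : ℝ → U →L[𝕜] H) : Prop :=
  ∃ K : ℝ → H →L[𝕜] U, IsBoundedContinuousFamily K ∧
    ∃ V : ℝ → ℝ → H →L[𝕜] H,
      IsPerturbedEvolution Y (fun t => B t ∘L K t) V ∧ ExpStable V

/-- Uniform detectability of the pair `(A(t), C(t))`, where `A(t)` generates `Y`. -/
def UniformlyDetectable [NormedSpace ℝ H] (Y : ℝ → ℝ → H →L[𝕜] H)
    (C : ℝ → H →L[𝕜] X) : Prop :=
  ∃ L : ℝ → X →L[𝕜] H, IsBoundedContinuousFamily L ∧
    ∃ V : ℝ → ℝ → H →L[𝕜] H,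
      IsPerturbedEvolution Y (fun t => L t ∘L C t) V ∧ ExpStable V

/-- `S` is the (unique) nonnegative self-adjoint square root of the nonnegative operator `W`. -/
def IsPositiveSqrt (S W : H →L[𝕜] H) : Prop :=
  S.IsPositive ∧ S ∘L S = W

/-- The operator `B(t) R(t)⁻¹ B(t)*`. -/
def feedbackTerm (B : ℝ → U →L[𝕜] H) (R : ℝ → U →L[𝕜] U) (t : ℝ) : H →L[𝕜] H :=
  B t ∘L (R t).inverse ∘L ContinuousLinearMap.adjoint (B t)

/-- The mild solution with control `u`, started at time `s` from `z₀`: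
`z(t) = Y(t,s) z₀ + ∫ₛᵗ Y(t,r) B(r) u(r) dr`. -/
def mildSolution [NormedSpace ℝ H] (Y : ℝ → ℝ → H →L[𝕜] H) (B : ℝ → U →L[𝕜] H)
    (s : ℝ) (z₀ : H) (u : ℝ → U) (t : ℝ) : H :=
  Y t s z₀ + ∫ r in s..t, Y t r (B r (u r))

/-- Admissible controls on `[s, ∞)`: the strongly measurable ones. (When `R` is uniformly coercive,
a control whose cost is finite is square integrable, so its mild solution is defined by
a convergent integral; a control that is not locally integrable has infinite cost.) -/
def IsAdmissible (s : ℝ) (u : ℝ → U) : Prop :=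
  AEStronglyMeasurable u (volume.restrict (Ici s))

/-- The infinite-horizon cost `∫ₛ^∞ (z, W z) + (u, R u) dr`, with values in `[0, ∞]`, along the
mild solution `z`. As the integrand is nonnegative this is the limit, as `T → ∞`, of the integrals
over `[s, T]`. -/
def cost [NormedSpace ℝ H] (Y : ℝ → ℝ → H →L[𝕜] H) (B : ℝ → U →L[𝕜] H)
    (W : ℝ → H →L[𝕜] H) (R : ℝ → U →L[𝕜] U) (s : ℝ) (z₀ : H) (u : ℝ → U) : ENNReal :=
  ∫⁻ r in Ici s, ENNReal.ofReal
    (RCLike.re (inner 𝕜 (mildSolution Y B s z₀ u r) (W r (mildSolution Y B s z₀ u r)))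
      + RCLike.re (inner 𝕜 (u r) (R r (u r))))

/-- `P` is a solution of the infinite-interval integral Riccati equation, in the class of strongly
measurable, uniformly bounded families of nonnegative self-adjoint operators on `[0, ∞)`:
there is an evolution operator `V` with
`V(t,s)z = Y(t,s)z - ∫ₛᵗ Y(t,r) B(r) R(r)⁻¹ B(r)* P(r) V(r,s) z dr` and
`P(s)z = V(t,s)* P(t) V(t,s) z
    + ∫ₛᵗ V(r,s)* (W(r) + P(r) B(r) R(r)⁻¹ B(r)* P(r)) V(r,s) z dr` for `0 ≤ s ≤ t`. -/
structure IsRiccatiSolution [NormedSpace ℝ H] (Y : ℝ → ℝ → H →L[𝕜] H) (B : ℝ → U →L[𝕜] H)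
    (W : ℝ → H →L[𝕜] H) (R : ℝ → U →L[𝕜] U) (P : ℝ → H →L[𝕜] H) : Prop where
  isPositive : ∀ s, 0 ≤ s → (P s).IsPositive
  bounded : ∃ M : ℝ, ∀ s, 0 ≤ s → ‖P s‖ ≤ M
  measurable : ∀ x : H, AEStronglyMeasurable (fun s => P s x) (volume.restrict (Ici 0))
  equation : ∃ V : ℝ → ℝ → H →L[𝕜] H,
    IsPerturbedEvolution Y (fun r => -(feedbackTerm B R r ∘L P r)) V ∧
    ∀ s t, 0 ≤ s → s ≤ t → ∀ z : H,
      P s z = ContinuousLinearMap.adjoint (V t s) (P t (V t s z))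
        + ∫ r in s..t, ContinuousLinearMap.adjoint (V r s)
            ((W r + P r ∘L feedbackTerm B R r ∘L P r) (V r s z))

end Defs

end InfiniteLQ

end

/-! The control problem minimises a nonnegative quadratic form over an affine space, and the two
structural hypotheses make that form finite and coercive. Stabilizability supplies a feedback `K`
with exponentially decaying trajectories, so every state `x` admits a control of cost at most a
constant times `‖x‖²`. Detectability gives the converse estimate `LQSetting.detect`: a finite cost
bounds `u` and `S z`, `S` the square root of `W`, in `L²`; relative to the stable evolution `VL` the
trajectory is driven by `B u - L S z`, hence it is square integrable, bounded and tends to zero.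
This is already claim (3).

Existence. With `v = u - K z` as the free variable, the trajectory is a bounded linear function of
`(x, v)` into `L²`. By `detect` the Hessian of the cost in `v` is coercive, so the Euler equation
has a solution linear in `x`, and `exists_optimal` produces `P(s)` representing the cross cost of
the optimal pair from `x` with every pair from `y`. Stationary pairs are unique, which yields
dynamic programming (`optimal_restart`), the evolution law of the optimal trajectories, and the
splitting of the cost at an intermediate time (`inner_P_split`). Testing that splitting against a
suitable variation gives the feedback law `optimal_feedback`; inserting the law back into the
splitting is the Riccati equation.

Uniqueness. Let `Q` be any bounded nonnegative solution. Dropping the terminal term shows that the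
feedback of `Q` costs at most `(Q x, x)` (`IsRiccatiPair.cost_le`). For an arbitrary control of
finite cost, completing the square gives `(Q x, x) ≤ (Q z(t), z(t)) + J`, and the terminal term
vanishes because `Q` is bounded and `z(t) → 0` (`IsRiccatiPair.le_cost`). So every solution has the
optimal cost as its quadratic form, which determines it.

Two technical devices run through the proof. `Y` is only separately strongly continuous, with no
joint bound at hand, so mild solutions are rewritten over `VK`, `VL` or the closed loop of `Q`,
where such a bound is available (`mild_rebase`). And since nothing is differentiable, energy
identities come from Fubini's theorem through `inner_mild_duality`. -/

open Set Filter Topology MeasureTheory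

noncomputable section

set_option linter.unusedSectionVars false

namespace InfiniteLQ

section

/-! ### Strong measurability, operator square roots, Fubini on a triangle -/

section Basics

variable {𝕜 : Type*} [RCLike 𝕜]

/-- Pointwise application of a pointwise strongly measurable family of operators to a strongly
measurable function is strongly measurable. -/
lemma stronglyMeasurable_apply {Ω E F : Type*} [MeasurableSpace Ω]
    [NormedAddCommGroup E] [NormedSpace 𝕜 E] [NormedAddCommGroup F] [NormedSpace 𝕜 F]
    {D : Ω → E →L[𝕜] F} {g : Ω → E} (hD : ∀ x, StronglyMeasurable (fun ω => D ω x))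
    (hg : StronglyMeasurable g) : StronglyMeasurable (fun ω => D ω (g ω)) := by
  refine stronglyMeasurable_of_tendsto atTop (f := fun n ω => D ω (hg.approx n ω))
    (fun n => ?_) (tendsto_pi_nhds.2 fun ω =>
      ((D ω).continuous.tendsto _).comp (hg.tendsto_approx ω))
  have hsum : (fun ω => D ω (hg.approx n ω)) = fun ω => ∑ y ∈ (hg.approx n).range,
      ((hg.approx n) ⁻¹' {y}).indicator (fun ω => D ω y) ω := by
    ext ω
    rw [Finset.sum_eq_single (hg.approx n ω)]
    · simp
    · intro y _ hy
      exact indicator_of_notMem (fun h => hy (by simpa using h.symm)) _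
    · intro h
      exact absurd (SimpleFunc.mem_range_self _ _) h
  rw [hsum]
  exact Finset.stronglyMeasurable_fun_sum _ fun y _ =>
    (hD y).indicator ((hg.approx n).measurableSet_fiber y)

/-- The argument can be replaced by a measurable representative, but the family cannot: its
exceptional null set depends on the vector. Simple functions involve countably many vectors only. -/
lemma aestronglyMeasurable_apply {Ω E F : Type*} [MeasurableSpace Ω] {μ : Measure Ω}
    [NormedAddCommGroup E] [NormedSpace 𝕜 E] [NormedAddCommGroup F] [NormedSpace 𝕜 F]
    {D : Ω → E →L[𝕜] F} {f : Ω → E} (hD : ∀ x, AEStronglyMeasurable (fun ω => D ω x) μ)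
    (hf : AEStronglyMeasurable f μ) : AEStronglyMeasurable (fun ω => D ω (f ω)) μ := by
  obtain ⟨g, hg, hfg⟩ := hf
  suffices h : AEStronglyMeasurable (fun ω => D ω (g ω)) μ from
    h.congr (hfg.mono fun ω hω => by simp only [hω])
  refine aestronglyMeasurable_of_tendsto_ae atTop (f := fun n ω => D ω (hg.approx n ω))
    (fun n => ?_) (Eventually.of_forall fun ω =>
      ((D ω).continuous.tendsto _).comp (hg.tendsto_approx ω))
  have hsum : (fun ω => D ω (hg.approx n ω)) = fun ω => ∑ y ∈ (hg.approx n).range,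
      ((hg.approx n) ⁻¹' {y}).indicator (fun ω => D ω y) ω := by
    ext ω
    rw [Finset.sum_eq_single (hg.approx n ω)]
    · simp
    · intro y _ hy
      exact indicator_of_notMem (fun h => hy (by simpa using h.symm)) _
    · intro h
      exact absurd (SimpleFunc.mem_range_self _ _) h
  rw [hsum]
  refine Finset.aestronglyMeasurable_fun_sum _ fun y _ => ?_
  exact (hD y).indicator ((hg.approx n).measurableSet_fiber y)

/-- A weakly continuous function from the line to a Hilbert space is strongly measurable. -/
lemma stronglyMeasurable_of_weakly_continuous {E : Type*} [NormedAddCommGroup E]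
    [InnerProductSpace 𝕜 E] [CompleteSpace E] {f : ℝ → E}
    (hf : ∀ y, Continuous fun t => inner 𝕜 y (f t)) : StronglyMeasurable f := by
  -- Every value of `f` lies in the closure of these increasing finite-dimensional spans, because a
  -- vector orthogonal to all of them gives a continuous scalar function that vanishes on a dense
  -- set. The projections of `f` onto the spans are continuous and converge pointwise.
  let S : ℕ → Submodule 𝕜 E := fun n =>
    Submodule.span 𝕜 ((fun k => f (TopologicalSpace.denseSeq ℝ k)) '' Iio n)
  have hfin : ∀ n, FiniteDimensional 𝕜 (S n) := fun n =>
    FiniteDimensional.span_of_finite 𝕜 ((finite_Iio n).image _)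
  have hmono : Monotone S := fun a b hab =>
    Submodule.span_mono (image_mono (Iio_subset_Iio hab))
  have hmem : ∀ t, f t ∈ (⨆ n, S n).topologicalClosure := by
    intro t
    rw [← Submodule.orthogonal_orthogonal_eq_closure, Submodule.mem_orthogonal]
    intro y hy
    have h0 : (fun t => inner 𝕜 y (f t)) = fun _ => 0 := by
      refine (hf y).ext_on (TopologicalSpace.denseRange_denseSeq ℝ) continuous_const ?_
      rintro _ ⟨k, rfl⟩
      rw [Submodule.mem_orthogonal'] at hy
      exact hy _ (Submodule.mem_iSup_of_mem (k + 1)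
        (Submodule.subset_span ⟨k, by simp, rfl⟩))
    exact congrFun h0 t
  refine stronglyMeasurable_of_tendsto atTop (f := fun n t => ((S n).starProjection (f t)))
    (fun n => ?_) (tendsto_pi_nhds.2 fun t => ?_)
  · have : Continuous fun t => (S n).starProjection (f t) := by
      have hb : ∀ t, (S n).starProjection (f t) =
          ∑ i, inner 𝕜 ((stdOrthonormalBasis 𝕜 (S n) i : S n) : E) (f t) •
            ((stdOrthonormalBasis 𝕜 (S n) i : S n) : E) := by
        intro t
        rw [Submodule.starProjection_apply,
          (stdOrthonormalBasis 𝕜 (S n)).orthogonalProjectionOnto_apply_eq_sum]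
        simp
      simp only [hb]
      exact continuous_finsetSum _ fun i _ => (hf _).smul continuous_const
    exact this.stronglyMeasurable
  · have := Submodule.starProjection_tendsto_closure_iSup S hmono (f t)
    rwa [Submodule.starProjection_eq_self_iff.2 (hmem t)] at this

/-- The positive square root depends continuously on the operator. -/
lemma norm_sub_sq_le_of_isPositiveSqrt {E : Type*} [NormedAddCommGroup E]
    [InnerProductSpace 𝕜 E] [CompleteSpace E] {S₁ S₂ W₁ W₂ : E →L[𝕜] E}
    (h₁ : IsPositiveSqrt S₁ W₁) (h₂ : IsPositiveSqrt S₂ W₂) :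
    ‖S₁ - S₂‖ ^ 2 ≤ ‖W₁ - W₂‖ := by
  set D := S₁ - S₂ with hD
  have hsym : D.IsSymmetric := fun x y => by
    simp [D, inner_sub_left, inner_sub_right, h₁.1.inner_left_eq_inner_right, h₂.1.inner_left_eq_inner_right]
  -- At an eigenvector of `D` for `±‖D‖`, the form of `W₁ - W₂` is `±‖D‖ (x, (S₁ + S₂) x)`, and `(x,
  -- (S₁ + S₂) x) ≥ |(x, D x)|`. In infinite dimension only approximate eigenvectors exist; the
  -- square root is the error, and it vanishes as the Rayleigh quotient approaches `‖D‖`.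
  have key : ∀ x, ‖D‖ * |D.rayleighQuotient x| ≤ ‖W₁ - W₂‖ +
      √(2 * ‖D‖ * (‖D‖ - |D.rayleighQuotient x|)) * ‖S₁ + S₂‖ := by
    intro x
    rcases eq_or_ne x 0 with rfl | hx
    · simp [ContinuousLinearMap.rayleighQuotient, ContinuousLinearMap.reApplyInnerSelf]
      positivity
    have hx' : 0 < ‖x‖ := norm_pos_iff.2 hx
    set ρ := D.rayleighQuotient x with hρ
    have ha : RCLike.re (inner 𝕜 (D x) x) = ρ * ‖x‖ ^ 2 := by
      rw [hρ, ContinuousLinearMap.rayleighQuotient, ContinuousLinearMap.reApplyInnerSelf]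
      field_simp
    obtain ⟨σ, hσ1, hσ2⟩ : ∃ σ : ℝ, |σ| = 1 ∧ σ * ρ = |ρ| := by
      rcases le_total 0 ρ with h | h
      · exact ⟨1, by simp, by simp [abs_of_nonneg h]⟩
      · exact ⟨-1, by simp, by simp [abs_of_nonpos h]⟩
    have hσ3 : σ ^ 2 = 1 := by rw [← sq_abs, hσ1]; norm_num
    set μ : ℝ := σ * ‖D‖ with hμ
    have hμρ : μ * ρ = ‖D‖ * |ρ| := by rw [hμ, ← hσ2]; ring
    have herr : ‖D x - (μ : 𝕜) • x‖ ≤ √(2 * ‖D‖ * (‖D‖ - |ρ|)) * ‖x‖ := by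
      have h0 : ‖D x - (μ : 𝕜) • x‖ ^ 2 ≤ 2 * ‖D‖ * (‖D‖ - |ρ|) * ‖x‖ ^ 2 := by
        rw [@norm_sub_sq 𝕜, inner_smul_right, RCLike.re_ofReal_mul, ha, norm_smul,
          RCLike.norm_ofReal]
        have h1 : ‖D x‖ ^ 2 ≤ (‖D‖ * ‖x‖) ^ 2 := by gcongr; exact D.le_opNorm x
        have h2 : |μ| = ‖D‖ := by rw [hμ, abs_mul, hσ1, abs_norm, one_mul]
        rw [h2]
        nlinarith [h1, hμρ]
      have h3 := Real.le_sqrt_of_sq_le h0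
      rwa [Real.sqrt_mul' _ (sq_nonneg _), Real.sqrt_sq (norm_nonneg x)] at h3
    have hid : RCLike.re (inner 𝕜 ((W₁ - W₂) x) x) =
        RCLike.re (inner 𝕜 (D x) ((S₁ + S₂) x)) := by
      rw [← h₁.2, ← h₂.2]
      simp only [D, _root_.sub_apply, _root_.add_apply,
        ContinuousLinearMap.comp_apply, inner_sub_left, inner_add_right,
        h₁.1.inner_left_eq_inner_right (S₁ x), h₂.1.inner_left_eq_inner_right (S₂ x)]
      have : RCLike.re (inner 𝕜 (S₁ x) (S₂ x)) = RCLike.re (inner 𝕜 (S₂ x) (S₁ x)) := by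
        rw [← inner_conj_symm, RCLike.conj_re]
      simp only [map_sub, map_add, this]
      ring
    have hsplit : RCLike.re (inner 𝕜 (D x) ((S₁ + S₂) x)) =
        RCLike.re (inner 𝕜 (D x - (μ : 𝕜) • x) ((S₁ + S₂) x)) +
          μ * RCLike.re (inner 𝕜 x ((S₁ + S₂) x)) := by
      rw [inner_sub_left, inner_smul_left, RCLike.conj_ofReal, map_sub, RCLike.re_ofReal_mul]
      ring
    have hpos1 : 0 ≤ RCLike.re (inner 𝕜 x (S₁ x)) := h₁.1.re_inner_nonneg_right x
    have hpos2 : 0 ≤ RCLike.re (inner 𝕜 x (S₂ x)) := h₂.1.re_inner_nonneg_right x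
    have hb : |ρ| * ‖x‖ ^ 2 ≤ RCLike.re (inner 𝕜 x ((S₁ + S₂) x)) := by
      have h3 : ρ * ‖x‖ ^ 2 = RCLike.re (inner 𝕜 x (S₁ x)) - RCLike.re (inner 𝕜 x (S₂ x)) := by
        rw [← ha, ← map_sub, ← inner_sub_right, ← inner_conj_symm, RCLike.conj_re]; rfl
      rw [← abs_of_nonneg (sq_nonneg ‖x‖), ← abs_mul, h3, _root_.add_apply,
        inner_add_right, map_add, abs_le]
      constructor <;> linarith
    have he : |RCLike.re (inner 𝕜 (D x - (μ : 𝕜) • x) ((S₁ + S₂) x))| ≤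
        √(2 * ‖D‖ * (‖D‖ - |ρ|)) * ‖S₁ + S₂‖ * ‖x‖ ^ 2 := by
      refine (RCLike.abs_re_le_norm _).trans ((norm_inner_le_norm _ _).trans ?_)
      calc _ ≤ (√(2 * ‖D‖ * (‖D‖ - |ρ|)) * ‖x‖) * (‖S₁ + S₂‖ * ‖x‖) := by
            gcongr
            exact (S₁ + S₂).le_opNorm x
        _ = _ := by ring
    have hw : |RCLike.re (inner 𝕜 ((W₁ - W₂) x) x)| ≤ ‖W₁ - W₂‖ * ‖x‖ ^ 2 := by
      refine (RCLike.abs_re_le_norm _).trans ((norm_inner_le_norm _ _).trans ?_)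
      calc _ ≤ (‖W₁ - W₂‖ * ‖x‖) * ‖x‖ := by gcongr; exact (W₁ - W₂).le_opNorm x
        _ = _ := by ring
    have hfin : ‖D‖ * (|ρ| * ‖x‖ ^ 2) ≤ |μ * RCLike.re (inner 𝕜 x ((S₁ + S₂) x))| := by
      rw [abs_mul, hμ, abs_mul, hσ1, abs_norm, one_mul]
      gcongr
      exact hb.trans (le_abs_self _)
    have : μ * RCLike.re (inner 𝕜 x ((S₁ + S₂) x)) = RCLike.re (inner 𝕜 ((W₁ - W₂) x) x) -
        RCLike.re (inner 𝕜 (D x - (μ : 𝕜) • x) ((S₁ + S₂) x)) := by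
      rw [hid, hsplit]; ring
    rw [this] at hfin
    have hfin2 := hfin.trans ((abs_sub _ _).trans (add_le_add hw he))
    have hx2 : 0 < ‖x‖ ^ 2 := by positivity
    refine le_of_mul_le_mul_right ?_ hx2
    linarith
  have hcl : ‖D‖ ∈ closure (range fun x => |D.rayleighQuotient x|) := by
    have := csSup_mem_closure (range_nonempty fun x => |D.rayleighQuotient x|)
      ⟨‖D‖, by rintro _ ⟨x, rfl⟩; exact D.rayleighQuotient_le_norm x⟩
    rwa [← iSup, ← D.norm_eq_iSup_rayleighQuotient hsym] at this
  have hclosed : IsClosed {r : ℝ | ‖D‖ * r ≤ ‖W₁ - W₂‖ +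
      √(2 * ‖D‖ * (‖D‖ - r)) * ‖S₁ + S₂‖} :=
    isClosed_le (by fun_prop) (by fun_prop)
  have := closure_minimal (by rintro _ ⟨x, rfl⟩; exact key x) hclosed hcl
  simpa [sq] using this

/-- Fubini's theorem on a triangle. -/
lemma integral_triangle_swap {G : Type*} [NormedAddCommGroup G] [NormedSpace ℝ G]
    {k : ℝ → ℝ → G} {s t : ℝ} (hst : s ≤ t)
    (hk : Integrable ({p : ℝ × ℝ | p.2 ≤ p.1}.indicator fun p => k p.1 p.2)
      ((volume.restrict (Ioc s t)).prod (volume.restrict (Ioc s t)))) :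
    IntegrableOn (fun σ => ∫ r in s..σ, k σ r) (Ioc s t) ∧
    IntegrableOn (fun r => ∫ σ in r..t, k σ r) (Ioc s t) ∧
    ∫ σ in s..t, ∫ r in s..σ, k σ r = ∫ r in s..t, ∫ σ in r..t, k σ r := by
  have h1 : ∀ σ ∈ Ioc s t, ∫ r in Ioc s t, {p : ℝ × ℝ | p.2 ≤ p.1}.indicator
      (fun p => k p.1 p.2) (σ, r) = ∫ r in s..σ, k σ r := by
    intro σ hσ
    rw [intervalIntegral.integral_of_le hσ.1.le]
    have : (fun r => {p : ℝ × ℝ | p.2 ≤ p.1}.indicator (fun p => k p.1 p.2) (σ, r)) =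
        (Iic σ).indicator (fun r => k σ r) := by
      ext r; simp [indicator]
    rw [this, integral_indicator measurableSet_Iic, Measure.restrict_restrict measurableSet_Iic]
    congr 2
    ext r
    simp only [mem_inter_iff, mem_Iic, mem_Ioc]
    exact ⟨fun h => ⟨h.2.1, h.1⟩, fun h => ⟨h.2, h.1, h.2.trans hσ.2⟩⟩
  have h2 : ∀ r ∈ Ioc s t, ∫ σ in Ioc s t, {p : ℝ × ℝ | p.2 ≤ p.1}.indicator
      (fun p => k p.1 p.2) (σ, r) = ∫ σ in r..t, k σ r := by
    intro r hr
    rw [intervalIntegral.integral_of_le hr.2]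
    have : (fun σ => {p : ℝ × ℝ | p.2 ≤ p.1}.indicator (fun p => k p.1 p.2) (σ, r)) =
        (Ici r).indicator (fun σ => k σ r) := by
      ext σ; simp [indicator]
    rw [this, integral_indicator measurableSet_Ici, Measure.restrict_restrict measurableSet_Ici,
      ← integral_Icc_eq_integral_Ioc]
    congr 2
    ext σ
    simp only [mem_inter_iff, mem_Ici, mem_Ioc, mem_Icc]
    exact ⟨fun h => ⟨h.1, h.2.2⟩, fun h => ⟨h.1, hr.1.trans_le h.1, h.2⟩⟩
  refine ⟨?_, ?_, ?_⟩
  · exact IntegrableOn.congr_fun hk.integral_prod_left h1 measurableSet_Ioc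
  · exact IntegrableOn.congr_fun hk.integral_prod_right h2 measurableSet_Ioc
  · rw [intervalIntegral.integral_of_le hst, intervalIntegral.integral_of_le hst,
      ← setIntegral_congr_fun measurableSet_Ioc h1, ← setIntegral_congr_fun measurableSet_Ioc h2]
    exact integral_integral_swap (f := fun σ r =>
      {p : ℝ × ℝ | p.2 ≤ p.1}.indicator (fun p => k p.1 p.2) (σ, r)) hk

end Basics

/-! ### Bounds and joint measurability of evolution operators -/

section Evolution

variable {𝕜 H : Type*} [RCLike 𝕜] [NormedAddCommGroup H] [InnerProductSpace 𝕜 H] [CompleteSpace H]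
  {V : ℝ → ℝ → H →L[𝕜] H}

/-- Local uniform boundedness of an evolution operator. -/
def LocallyBounded (V : ℝ → ℝ → H →L[𝕜] H) : Prop :=
  ∀ T, ∃ M : ℝ, 0 ≤ M ∧ ∀ s t, 0 ≤ s → s ≤ t → t ≤ T → ‖V t s‖ ≤ M

lemma ExpStable.locallyBounded (hV : ExpStable V) : LocallyBounded V := by
  obtain ⟨M, α, hM, hα, h⟩ := hV
  refine fun T => ⟨M, hM, fun s t hs hst _ => (h s t hs hst).trans ?_⟩
  refine mul_le_of_le_one_right hM (Real.exp_le_one_iff.2 ?_)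
  nlinarith

/-- Banach–Steinhaus with one time frozen. A bound on a whole triangle is the separate property
`LocallyBounded`, which is obtained from stability or from cost estimates. -/
lemma IsEvolutionOperator.exists_bound_right (hV : IsEvolutionOperator V) {t : ℝ} (ht : 0 ≤ t) :
    ∃ C : ℝ, 0 ≤ C ∧ ∀ r ∈ Icc 0 t, ‖V t r‖ ≤ C := by
  obtain ⟨C, hC⟩ := banach_steinhaus (g := fun r : Icc (0 : ℝ) t => V t r) fun x => by
    obtain ⟨C, hC⟩ := isCompact_Icc.exists_bound_of_continuousOn (hV.continuousOn_right t ht x)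
    exact ⟨C, fun r => hC r r.2⟩
  exact ⟨C, (norm_nonneg _).trans (hC ⟨0, by simp [ht]⟩), fun r hr => hC ⟨r, hr⟩⟩

lemma IsEvolutionOperator.exists_bound_left (hV : IsEvolutionOperator V) {s : ℝ} (hs : 0 ≤ s)
    (T : ℝ) : ∃ C : ℝ, 0 ≤ C ∧ ∀ t ∈ Icc s T, ‖V t s‖ ≤ C := by
  obtain ⟨C, hC⟩ := banach_steinhaus (g := fun t : Icc s T => V t s) fun x => by
    obtain ⟨C, hC⟩ := isCompact_Icc.exists_bound_of_continuousOn
      ((hV.continuousOn_left s hs x).mono Icc_subset_Ici_self)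
    exact ⟨C, fun r => hC r r.2⟩
  exact ⟨max C 0, le_max_right _ _, fun r hr => (hC ⟨r, hr⟩).trans (le_max_left _ _)⟩

lemma IsEvolutionOperator.aestronglyMeasurable_right (hV : IsEvolutionOperator V) {s t : ℝ}
    (hs : 0 ≤ s) (x : H) :
    AEStronglyMeasurable (fun r => V t r x) (volume.restrict (Ioc s t)) := by
  rcases le_total t s with h | h
  · simp [Ioc_eq_empty (not_lt.2 h)]
  exact ((hV.continuousOn_right t (hs.trans h) x).mono
    fun r hr => ⟨hs.trans hr.1.le, hr.2⟩).aestronglyMeasurable measurableSet_Ioc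

lemma IsEvolutionOperator.integrableOn_apply (hV : IsEvolutionOperator V) {s t : ℝ}
    (hs : 0 ≤ s) {g : ℝ → H} (hg : IntegrableOn g (Ioc s t)) :
    IntegrableOn (fun r => V t r (g r)) (Ioc s t) := by
  rcases le_total t s with h | h
  · simp [Ioc_eq_empty (not_lt.2 h)]
  obtain ⟨C, hC0, hC⟩ := hV.exists_bound_right (hs.trans h)
  refine Integrable.mono' (hg.norm.const_mul C)
    (aestronglyMeasurable_apply (hV.aestronglyMeasurable_right hs) hg.1) ?_
  refine (ae_restrict_iff' measurableSet_Ioc).2 (Eventually.of_forall fun r hr => ?_)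
  exact (V t r).le_of_opNorm_le (hC r ⟨hs.trans hr.1.le, hr.2⟩) _

/-- Joint measurability of `(t, r) ↦ V(t,r) g(r)` on the triangle `r ≤ t`. -/
lemma IsEvolutionOperator.aestronglyMeasurable_triangle (hV : IsEvolutionOperator V) {s T : ℝ}
    (hs : 0 ≤ s) {g : ℝ → H} (hg : AEStronglyMeasurable g (volume.restrict (Ioc s T))) :
    AEStronglyMeasurable ({p : ℝ × ℝ | p.2 ≤ p.1}.indicator fun p => V p.1 p.2 (g p.2))
      ((volume.restrict (Ioc s T)).prod (volume.restrict (Ioc s T))) := by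
  obtain ⟨f, hf, hgf⟩ := hg
  -- Clamping extends the family to the whole plane, as the identity for `t` before `r`. The
  -- extension is continuous in `t` and measurable in `r`, hence jointly measurable, and it agrees
  -- with `V` on the triangle.
  let c : ℝ → ℝ := fun r => max r 0
  have hc : ∀ r, 0 ≤ c r := fun r => le_max_right _ _
  have hmeas : StronglyMeasurable (Function.uncurry fun t r : ℝ => V (max t (c r)) (c r) (f r)) := by
    refine stronglyMeasurable_uncurry_of_continuous_of_stronglyMeasurable (fun r => ?_) fun t => ?_
    · exact (hV.continuousOn_left (c r) (hc r) (f r)).comp_continuous (by fun_prop)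
        fun t => mem_Ici.2 (le_max_right _ _)
    · have hx : ∀ x, StronglyMeasurable (fun r => V (max t (c r)) (c r) x) := by
        intro x
        rcases lt_or_ge t 0 with ht | ht
        · have : (fun r => V (max t (c r)) (c r) x) = fun _ => x := by
            ext r
            rw [max_eq_right (ht.le.trans (hc r)), hV.self _ (hc r)]; rfl
          rw [this]; exact stronglyMeasurable_const
        · have : (fun r => V (max t (c r)) (c r) x) =
              {r | c r ≤ t}.piecewise (fun r => V t (min (c r) t) x) fun _ => x := by
            ext r
            by_cases h : c r ≤ t
            · simp [Set.piecewise, h]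
            · have h' : t ≤ c r := (not_le.1 h).le
              simp [Set.piecewise, h, max_eq_right h', hV.self _ (hc r)]
          rw [this]
          refine StronglyMeasurable.piecewise (measurableSet_le (by fun_prop) (by fun_prop)) ?_
            stronglyMeasurable_const
          refine Continuous.stronglyMeasurable ((hV.continuousOn_right t ht x).comp_continuous
            (by fun_prop) fun r => ⟨le_min (hc r) ht, min_le_right _ _⟩)
      exact stronglyMeasurable_apply hx hf
  have hgf' : ∀ᵐ p ∂((volume.restrict (Ioc s T)).prod (volume.restrict (Ioc s T))),
      g p.2 = f p.2 := Measure.quasiMeasurePreserving_snd.ae hgf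
  have hmem : ∀ᵐ p ∂((volume.restrict (Ioc s T)).prod (volume.restrict (Ioc s T))),
      p.2 ∈ Ioc s T := Measure.quasiMeasurePreserving_snd.ae (ae_restrict_mem measurableSet_Ioc)
  refine (hmeas.aestronglyMeasurable.indicator
    (measurableSet_le measurable_snd measurable_fst)).congr ?_
  filter_upwards [hgf', hmem] with p hp hp2
  by_cases h : p.2 ≤ p.1
  · have h0 : c p.2 = p.2 := max_eq_left (hs.trans hp2.1.le)
    simp [indicator, h, Function.uncurry, h0, hp]
  · simp [indicator, h]

end Evolution

end

section

/-! ### Mild solutions: restart, change of generator, duality -/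

section Mild

variable {𝕜 H : Type*} [RCLike 𝕜] [NormedAddCommGroup H] [InnerProductSpace 𝕜 H] [CompleteSpace H]
  [NormedSpace ℝ H] {Y V : ℝ → ℝ → H →L[𝕜] H} {D : ℝ → H →L[𝕜] H} {f g : ℝ → H} {s t : ℝ}

/-- The mild solution with forcing term `g`. -/
def mild (V : ℝ → ℝ → H →L[𝕜] H) (g : ℝ → H) (s : ℝ) (x : H) (t : ℝ) : H :=
  V t s x + ∫ r in s..t, V t r (g r)

/-- Integrability on bounded intervals to the right of `s`. -/
def LocInt {E : Type*} [NormedAddCommGroup E] (s : ℝ) (g : ℝ → E) : Prop :=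
  ∀ T, IntegrableOn g (Ioc s T)

lemma LocInt.mono {E : Type*} [NormedAddCommGroup E] {g : ℝ → E} (hg : LocInt s g) (h : s ≤ t) :
    LocInt t g := fun T => (hg T).mono_set (Ioc_subset_Ioc_left h)

lemma LocInt.intervalIntegrable {E : Type*} [NormedAddCommGroup E] {g : ℝ → E} (hg : LocInt s g)
    (h : s ≤ t) : IntervalIntegrable g volume s t :=
  (intervalIntegrable_iff_integrableOn_Ioc_of_le h).2 (hg t)

lemma mild_self (hV : IsEvolutionOperator V) (hs : 0 ≤ s) (x : H) : mild V g s x s = x := by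
  simp [mild, hV.self s hs]

lemma intervalIntegrable_mild (hV : IsEvolutionOperator V) (hs : 0 ≤ s) (hst : s ≤ t)
    (hg : LocInt s g) : IntervalIntegrable (fun r => V t r (g r)) volume s t :=
  (intervalIntegrable_iff_integrableOn_Ioc_of_le hst).2 (hV.integrableOn_apply hs (hg t))

/-- The mild solution can be restarted. -/
lemma mild_restart (hV : IsEvolutionOperator V) (hs : 0 ≤ s) (hg : LocInt s g) (x : H) {r t : ℝ}
    (hsr : s ≤ r) (hrt : r ≤ t) : mild V g r (mild V g s x r) t = mild V g s x t := by
  have h1 := intervalIntegrable_mild hV hs (hsr.trans hrt) hg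
  have h2 := intervalIntegrable_mild hV hs hsr hg
  have h3 : ∫ σ in s..r, V t σ (g σ) = V t r (∫ σ in s..r, V r σ (g σ)) := by
    rw [← ContinuousLinearMap.intervalIntegral_comp_comm _ h2]
    refine intervalIntegral.integral_congr fun σ hσ => ?_
    rw [uIcc_of_le hsr] at hσ
    rw [← hV.comp t r σ (hs.trans hσ.1) hσ.2 hrt]; rfl
  have h4 : V t s x = V t r (V r s x) := by rw [← hV.comp t r s hs hsr hrt]; rfl
  have hr1 : r ∈ uIcc s t := by rw [uIcc_of_le (hsr.trans hrt)]; exact ⟨hsr, hrt⟩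
  rw [mild, mild, mild, map_add, ← h3, h4, add_assoc,
    intervalIntegral.integral_add_adjacent_intervals]
  · exact h1.mono_set (uIcc_subset_uIcc left_mem_uIcc hr1)
  · exact h1.mono_set (uIcc_subset_uIcc hr1 right_mem_uIcc)

lemma mild_congr {g' : ℝ → H} (hgg : ∀ᵐ r ∂(volume.restrict (Ioc s t)), g r = g' r) (x : H)
    (hst : s ≤ t) : mild V g s x t = mild V g' s x t := by
  rw [mild, mild, intervalIntegral.integral_of_le hst, intervalIntegral.integral_of_le hst]
  congr 1
  refine integral_congr_ae ?_
  filter_upwards [hgg] with r hr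
  simp only [hr]

lemma mild_add (hV : IsEvolutionOperator V) (hs : 0 ≤ s) (hst : s ≤ t) (hf : LocInt s f)
    (hg : LocInt s g) (x y : H) :
    mild V (fun r => f r + g r) s (x + y) t = mild V f s x t + mild V g s y t := by
  simp only [mild, map_add]
  rw [intervalIntegral.integral_add (intervalIntegrable_mild hV hs hst hf)
    (intervalIntegrable_mild hV hs hst hg)]
  abel

lemma mild_smul (c : 𝕜) (x : H) :
    mild V (fun r => c • f r) s (c • x) t = c • mild V f s x t := by
  simp only [mild, map_smul, smul_add]
  rw [intervalIntegral.integral_smul]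

/-- Continuity of mild solutions for locally bounded evolution operators. -/
lemma continuousOn_mild (hV : IsEvolutionOperator V) (hb : LocallyBounded V) (hs : 0 ≤ s)
    (hg : LocInt s g) (x : H) : ContinuousOn (mild V g s x) (Ici s) := by
  refine (hV.continuousOn_left s hs x).add ?_
  intro t₀ ht₀
  -- A horizon beyond `t₀` gives a full neighbourhood within `[s, ∞)`. The moving upper limit
  -- becomes an indicator, and for dominated convergence the integrand can fail to be continuous at
  -- `t₀` only for the null set `r = t₀`.
  set T := t₀ + 1
  obtain ⟨M, hM0, hM⟩ := hb T
  have hIcc : Icc s T ∈ 𝓝[Ici s] t₀ := by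
    have := inter_mem_nhdsWithin (Ici s) (Iic_mem_nhds (show t₀ < T by simp [T]))
    rwa [Ici_inter_Iic] at this
  have hF : ∀ t ∈ Icc s T, ∫ r in s..t, V t r (g r) =
      ∫ r in Ioc s T, (Iic t).indicator (fun r => V t r (g r)) r := by
    intro t ht
    rw [intervalIntegral.integral_of_le ht.1, integral_indicator measurableSet_Iic,
      Measure.restrict_restrict measurableSet_Iic]
    congr 2
    ext r
    simp only [mem_inter_iff, mem_Iic, mem_Ioc]
    exact ⟨fun h => ⟨h.2, h.1, h.2.trans ht.2⟩, fun h => ⟨h.2.1, h.1⟩⟩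
  suffices h : ContinuousWithinAt (fun t => ∫ r in Ioc s T,
      (Iic t).indicator (fun r => V t r (g r)) r) (Ici s) t₀ by
    refine h.congr_of_eventuallyEq ?_ (hF t₀ ⟨ht₀, by simp [T]⟩)
    filter_upwards [hIcc] with t ht using hF t ht
  refine continuousWithinAt_of_dominated (bound := fun r => M * ‖g r‖) ?_ ?_
    ((hg T).norm.const_mul M) ?_
  · filter_upwards [hIcc] with t ht
    have h1 := (hV.integrableOn_apply hs (hg t)).1
    have h2 : AEStronglyMeasurable (fun r => V t r (g r)) ((volume.restrict (Ioc s T)).restrict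
        (Iic t)) := by
      rw [Measure.restrict_restrict measurableSet_Iic]
      exact h1.mono_set (t := Ioc s t) fun r hr => ⟨hr.2.1, hr.1⟩
    exact (aestronglyMeasurable_indicator_iff measurableSet_Iic).2 h2
  · filter_upwards [hIcc] with t ht
    refine (ae_restrict_iff' measurableSet_Ioc).2 (Eventually.of_forall fun r hr => ?_)
    by_cases h : r ≤ t
    · simpa [indicator, h] using (V t r).le_of_opNorm_le (hM r t (hs.trans hr.1.le) h ht.2) (g r)
    · simp [indicator, h]; positivity
  · have hne : ∀ᵐ r ∂(volume.restrict (Ioc s T)), r ≠ t₀ :=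
      ae_restrict_of_ae (Measure.ae_ne volume t₀)
    filter_upwards [hne, ae_restrict_mem measurableSet_Ioc] with r hr hrs
    rcases lt_or_gt_of_ne hr with h | h
    · have hc : ContinuousWithinAt (fun t => V t r (g r)) (Ici s) t₀ := by
        have := (hV.continuousOn_left r (hs.trans hrs.1.le) (g r)).continuousAt (Ici_mem_nhds h)
        exact this.continuousWithinAt
      refine hc.congr_of_eventuallyEq ?_ (by simp [indicator, h.le])
      filter_upwards [mem_nhdsWithin_of_mem_nhds (Ioi_mem_nhds h)] with t ht
      simp [indicator, (mem_Ioi.1 ht).le]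
    · refine (continuousWithinAt_const (b := (0 : H))).congr_of_eventuallyEq ?_
        (by simp [indicator, h])
      filter_upwards [mem_nhdsWithin_of_mem_nhds (Iio_mem_nhds h)] with t ht
      simp [indicator, mem_Iio.1 ht]

/-- Pointwise strongly measurable, uniformly bounded families of operators on `[0, ∞)`. -/
def IsBoundedMeasurableFamily {E F : Type*} [NormedAddCommGroup E] [NormedSpace 𝕜 E]
    [NormedAddCommGroup F] [NormedSpace 𝕜 F] (D : ℝ → E →L[𝕜] F) : Prop :=
  (∀ x, AEStronglyMeasurable (fun t => D t x) (volume.restrict (Ici 0))) ∧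
    ∃ M : ℝ, 0 ≤ M ∧ ∀ t, 0 ≤ t → ‖D t‖ ≤ M

lemma IsBoundedContinuousFamily.isBoundedMeasurableFamily {E F : Type*} [NormedAddCommGroup E]
    [NormedSpace 𝕜 E] [NormedAddCommGroup F] [NormedSpace 𝕜 F] {D : ℝ → E →L[𝕜] F}
    (h : IsBoundedContinuousFamily D) : IsBoundedMeasurableFamily D := by
  refine ⟨fun x => (h.1.clm_apply continuousOn_const).aestronglyMeasurable measurableSet_Ici, ?_⟩
  obtain ⟨M, hM⟩ := h.2
  exact ⟨M, (norm_nonneg _).trans (hM 0 le_rfl), hM⟩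

lemma IsBoundedMeasurableFamily.comp {E F G : Type*} [NormedAddCommGroup E]
    [NormedSpace 𝕜 E] [NormedAddCommGroup F] [NormedSpace 𝕜 F] [NormedAddCommGroup G]
    [NormedSpace 𝕜 G] {D : ℝ → F →L[𝕜] G} {D' : ℝ → E →L[𝕜] F}
    (h : IsBoundedMeasurableFamily D) (h' : IsBoundedMeasurableFamily D') :
    IsBoundedMeasurableFamily fun t => D t ∘L D' t := by
  obtain ⟨h1, M, hM0, hM⟩ := h
  obtain ⟨h1', M', hM0', hM'⟩ := h'
  refine ⟨fun x => aestronglyMeasurable_apply (D := D) h1 (h1' x), M * M', by positivity, fun t ht => ?_⟩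
  exact ((D t).opNorm_comp_le _).trans (mul_le_mul (hM t ht) (hM' t ht) (norm_nonneg _) hM0)

lemma IsBoundedMeasurableFamily.add {E F : Type*} [NormedAddCommGroup E]
    [NormedSpace 𝕜 E] [NormedAddCommGroup F] [NormedSpace 𝕜 F] {D D' : ℝ → E →L[𝕜] F}
    (h : IsBoundedMeasurableFamily D) (h' : IsBoundedMeasurableFamily D') :
    IsBoundedMeasurableFamily fun t => D t + D' t := by
  obtain ⟨h1, M, hM0, hM⟩ := h
  obtain ⟨h1', M', hM0', hM'⟩ := h'
  exact ⟨fun x => (h1 x).add (h1' x), M + M', by positivity, fun t ht =>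
    (norm_add_le _ _).trans (add_le_add (hM t ht) (hM' t ht))⟩

lemma IsBoundedMeasurableFamily.neg {E F : Type*} [NormedAddCommGroup E]
    [NormedSpace 𝕜 E] [NormedAddCommGroup F] [NormedSpace 𝕜 F] {D : ℝ → E →L[𝕜] F}
    (h : IsBoundedMeasurableFamily D) : IsBoundedMeasurableFamily fun t => - D t := by
  obtain ⟨h1, M, hM0, hM⟩ := h
  exact ⟨fun x => (h1 x).neg, M, hM0, fun t ht => by simpa using hM t ht⟩

lemma IsBoundedMeasurableFamily.aestronglyMeasurable {E F : Type*} [NormedAddCommGroup E]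
    [NormedSpace 𝕜 E] [NormedAddCommGroup F] [NormedSpace 𝕜 F] {D : ℝ → E →L[𝕜] F}
    (h : IsBoundedMeasurableFamily D) {A : Set ℝ} (hA : A ⊆ Ici 0) {f : ℝ → E}
    (hf : AEStronglyMeasurable f (volume.restrict A)) :
    AEStronglyMeasurable (fun t => D t (f t)) (volume.restrict A) :=
  aestronglyMeasurable_apply (fun x => (h.1 x).mono_set hA) hf

lemma IsBoundedMeasurableFamily.locInt {E F : Type*} [NormedAddCommGroup E]
    [NormedSpace 𝕜 E] [NormedAddCommGroup F] [NormedSpace 𝕜 F] {D : ℝ → E →L[𝕜] F}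
    (h : IsBoundedMeasurableFamily D) (hs : 0 ≤ s) {f : ℝ → E} (hf : LocInt s f) :
    LocInt s fun t => D t (f t) := by
  intro T
  obtain ⟨M, hM0, hM⟩ := h.2
  refine Integrable.mono' ((hf T).norm.const_mul M)
    (h.aestronglyMeasurable (fun r hr => hs.trans hr.1.le) (hf T).1) ?_
  filter_upwards [ae_restrict_mem measurableSet_Ioc] with r hr
  exact (D r).le_of_opNorm_le (hM r (hs.trans hr.1.le)) _

lemma locInt_of_continuousOn {E : Type*} [NormedAddCommGroup E] {g : ℝ → E}
    (hg : ContinuousOn g (Ici s)) : LocInt s g := fun _ =>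
  ((hg.mono Icc_subset_Ici_self).integrableOn_compact isCompact_Icc).mono_set Ioc_subset_Icc_self

/-- A mild solution for a perturbed evolution operator is a mild solution for the original one. -/
lemma mild_eq_mild_of_perturbed (hY : IsEvolutionOperator Y) (hD : IsBoundedMeasurableFamily D)
    (hV : IsPerturbedEvolution Y D V) (hb : LocallyBounded V) (hs : 0 ≤ s)
    (hg : LocInt s g) (x : H) (hst : s ≤ t) :
    mild V g s x t = mild Y (fun r => g r + D r (mild V g s x r)) s x t := by
  obtain ⟨C, hC0, hC⟩ := hY.exists_bound_right (hs.trans hst)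
  obtain ⟨M, hM0, hM⟩ := hb t
  obtain ⟨N, hN0, hN⟩ := hD.2
  have hYD : ∀ x : H, AEStronglyMeasurable (fun σ => (Y t σ ∘L D σ) x)
      (volume.restrict (Ioc s t)) := fun x =>
    aestronglyMeasurable_apply (D := Y t) (hY.aestronglyMeasurable_right hs)
      ((hD.1 x).mono_set fun r hr => mem_Ici.2 (hs.trans hr.1.le))
  have hk : Integrable ({p : ℝ × ℝ | p.2 ≤ p.1}.indicator
      fun p => Y t p.1 (D p.1 (V p.1 p.2 (g p.2))))
      ((volume.restrict (Ioc s t)).prod (volume.restrict (Ioc s t))) := by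
    refine Integrable.mono' (g := fun p => C * N * M * ‖g p.2‖) ?_ ?_ ?_
    · exact ((hg t).norm.comp_snd _).const_mul _
    · have := aestronglyMeasurable_apply (D := fun p : ℝ × ℝ => Y t p.1 ∘L D p.1)
        (fun x => (hYD x).comp_fst) (hV.1.aestronglyMeasurable_triangle hs (hg t).1)
      refine this.congr (Eventually.of_forall fun p => ?_)
      by_cases h : p.2 ≤ p.1 <;> simp [indicator, h]
    · have hm1 : ∀ᵐ p ∂((volume.restrict (Ioc s t)).prod (volume.restrict (Ioc s t))),
          p.1 ∈ Ioc s t := Measure.quasiMeasurePreserving_fst.ae (ae_restrict_mem measurableSet_Ioc)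
      have hm2 : ∀ᵐ p ∂((volume.restrict (Ioc s t)).prod (volume.restrict (Ioc s t))),
          p.2 ∈ Ioc s t := Measure.quasiMeasurePreserving_snd.ae (ae_restrict_mem measurableSet_Ioc)
      filter_upwards [hm1, hm2] with p h1 h2
      by_cases h : p.2 ≤ p.1
      · have e1 := (V p.1 p.2).le_of_opNorm_le (hM p.2 p.1 (hs.trans h2.1.le) h h1.2) (g p.2)
        have e2 := (D p.1).le_of_opNorm_le (hN p.1 (hs.trans h1.1.le)) (V p.1 p.2 (g p.2))
        have e3 := (Y t p.1).le_of_opNorm_le (hC p.1 ⟨hs.trans h1.1.le, h1.2⟩)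
          (D p.1 (V p.1 p.2 (g p.2)))
        simp only [indicator, mem_ofPred_eq, h, if_true]
        calc _ ≤ _ := e3
          _ ≤ C * (N * (M * ‖g p.2‖)) := by gcongr; exact e2.trans (by gcongr)
          _ = _ := by ring
      · simp only [indicator, mem_ofPred_eq, h, if_false, norm_zero]; positivity
  -- One order of integration gives `Y D` applied to the convolution with `V`; the other gives `V g
  -- - Y g` by the perturbation identity.
  obtain ⟨i1, i2, heq⟩ := integral_triangle_swap
    (k := fun σ r => Y t σ (D σ (V σ r (g r)))) hst hk
  have hleft : ∀ σ ∈ uIcc s t, ∫ r in s..σ, Y t σ (D σ (V σ r (g r))) =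
      Y t σ (D σ (∫ r in s..σ, V σ r (g r))) := by
    intro σ hσ
    rw [uIcc_of_le hst] at hσ
    exact ContinuousLinearMap.intervalIntegral_comp_comm (Y t σ ∘L D σ)
      (intervalIntegrable_mild hV.1 hs hσ.1 hg)
  have hright : ∀ r ∈ uIcc s t, ∫ σ in r..t, Y t σ (D σ (V σ r (g r))) =
      V t r (g r) - Y t r (g r) := by
    intro r hr
    rw [uIcc_of_le hst] at hr
    rw [hV.2 r t (hs.trans hr.1) hr.2 (g r), add_sub_cancel_left]
  rw [intervalIntegral.integral_congr hleft, intervalIntegral.integral_congr hright,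
    intervalIntegral.integral_sub (intervalIntegrable_mild hV.1 hs hst hg)
      (intervalIntegrable_mild hY hs hst hg)] at heq
  have hVx : LocInt s fun r => V r s x := locInt_of_continuousOn (hV.1.continuousOn_left s hs x)
  have hmV : LocInt s (mild V g s x) := locInt_of_continuousOn (continuousOn_mild hV.1 hb hs hg x)
  have hconv : LocInt s fun σ => ∫ r in s..σ, V σ r (g r) := fun T => by
    refine ((hmV T).sub (hVx T)).congr (Eventually.of_forall fun σ => ?_)
    simp [mild]
  have hsum : ∫ r in s..t, Y t r (g r + D r (mild V g s x r)) =
      (∫ r in s..t, Y t r (g r)) + ((∫ r in s..t, Y t r (D r (V r s x))) +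
        ∫ σ in s..t, Y t σ (D σ (∫ r in s..σ, V σ r (g r)))) := by
    simp only [mild, map_add]
    rw [intervalIntegral.integral_add, intervalIntegral.integral_add]
    · exact intervalIntegrable_mild hY hs hst (hD.locInt hs hVx)
    · exact intervalIntegrable_mild hY hs hst (hD.locInt hs hconv)
    · exact intervalIntegrable_mild hY hs hst hg
    · exact (intervalIntegrable_mild hY hs hst (hD.locInt hs hVx)).add
        (intervalIntegrable_mild hY hs hst (hD.locInt hs hconv))
  rw [mild, mild, hsum, heq, hV.2 s t hs hst x]
  abel

/-- Solvability of the Volterra equation `x = V x₀ + ∫ V (f - D x)`. -/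
lemma exists_volterra_solution (hV : IsEvolutionOperator V) (hb : LocallyBounded V)
    (hD : IsBoundedMeasurableFamily D) (hs : 0 ≤ s) (hf : LocInt s f) (x : H) (hst : s ≤ t) :
    ∃ w : ℝ → H, Continuous w ∧
      ∀ r ∈ Icc s t, w r = mild V (fun r => f r - D r (w r)) s x r := by
  obtain ⟨M, hM0, hM⟩ := hb t
  obtain ⟨N, hN0, hN⟩ := hD.2
  -- Weight `exp (l (r - s))`: after conjugation by it the Volterra map has Lipschitz constant at
  -- most `M N / l ≤ 1/2`. The `+ 1` keeps `l` positive when `M N = 0`.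
  set l : ℝ := 2 * (M * N) + 1 with hl
  have hl0 : 0 < l := by positivity
  let e : C(Icc s t, H) → ℝ → H := fun w r => Real.exp (l * (r - s)) • IccExtend hst w r
  have he : ∀ w, Continuous (e w) := fun w =>
    Continuous.smul (by fun_prop) (w.continuous.Icc_extend' (h := hst))
  have hint : ∀ w, LocInt s fun r => f r - D r (e w r) := fun w T =>
    (hf T).sub (hD.locInt hs (locInt_of_continuousOn (he w).continuousOn) T)
  let G : C(Icc s t, H) → C(Icc s t, H) := fun w =>
    ⟨fun r => Real.exp (-(l * (r - s))) • mild V (fun r => f r - D r (e w r)) s x r,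
      Continuous.smul (by fun_prop) ((continuousOn_mild hV hb hs (hint w) x).comp_continuous
        continuous_subtype_val fun r => r.2.1)⟩
  have hG : ContractingWith (1 / 2) G := by
    refine ⟨by rw [← NNReal.coe_lt_coe]; norm_num, LipschitzWith.of_dist_le_mul fun w w' => ?_⟩
    refine (ContinuousMap.dist_le (by positivity)).2 fun r => ?_
    have hr := r.2
    have h1 : mild V (fun r => f r - D r (e w r)) s x r - mild V (fun r => f r - D r (e w' r)) s x r
        = ∫ σ in s..r, V r σ (D σ (e w' σ - e w σ)) := by
      rw [mild, mild, add_sub_add_left_eq_sub, ← intervalIntegral.integral_sub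
        (intervalIntegrable_mild hV hs hr.1 (hint w)) (intervalIntegrable_mild hV hs hr.1 (hint w'))]
      refine intervalIntegral.integral_congr fun σ _ => ?_
      simp only [map_sub]; abel
    have h2 : ∫ σ in s..(r : ℝ), M * N * dist w w' * Real.exp (l * (σ - s)) =
        M * N * dist w w' * ((Real.exp (l * (r - s)) - 1) / l) := by
      rw [intervalIntegral.integral_const_mul]
      congr 1
      have hd : ∀ σ ∈ uIcc s (r : ℝ), HasDerivAt (fun σ => Real.exp (l * (σ - s)) / l)
          (Real.exp (l * (σ - s))) σ := by
        intro σ _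
        have := ((((hasDerivAt_id σ).sub_const s).const_mul l).exp).div_const l
        simpa [hl0.ne'] using this
      rw [intervalIntegral.integral_eq_sub_of_hasDerivAt hd
        (Continuous.intervalIntegrable (by fun_prop) _ _)]
      simp [sub_div]
    have h3 : ‖∫ σ in s..(r : ℝ), V r σ (D σ (e w' σ - e w σ))‖ ≤
        M * N * dist w w' * ((Real.exp (l * (r - s)) - 1) / l) := by
      rw [← h2]
      refine intervalIntegral.norm_integral_le_of_norm_le hr.1 (Eventually.of_forall fun σ hσ => ?_)
        (Continuous.intervalIntegrable (by fun_prop) _ _)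
      have hσ0 := hs.trans hσ.1.le
      have e1 : ‖e w' σ - e w σ‖ ≤ Real.exp (l * (σ - s)) * dist w w' := by
        rw [← smul_sub, norm_smul, Real.norm_of_nonneg (Real.exp_pos _).le]
        gcongr
        rw [← dist_eq_norm, dist_comm]
        exact ContinuousMap.dist_apply_le_dist (projIcc s t hst σ)
      have e2 := (D σ).le_of_opNorm_le (hN σ hσ0) (e w' σ - e w σ)
      have e3 := (V r σ).le_of_opNorm_le (hM σ r hσ0 hσ.2 hr.2) (D σ (e w' σ - e w σ))
      calc _ ≤ _ := e3
        _ ≤ M * (N * (Real.exp (l * (σ - s)) * dist w w')) := by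
          gcongr; exact e2.trans (by gcongr)
        _ = _ := by ring
    rw [dist_eq_norm]
    simp only [G, ContinuousMap.coe_mk]
    rw [← smul_sub, h1, norm_smul, Real.norm_of_nonneg (Real.exp_pos _).le]
    have hexp : Real.exp (-(l * (r - s))) * Real.exp (l * (r - s)) = 1 := by
      rw [← Real.exp_add]; simp
    have hpos := Real.exp_pos (-(l * (r - s)))
    have hq : M * N / l ≤ 1 / 2 := by
      rw [div_le_div_iff₀ hl0 two_pos]; linarith
    calc _ ≤ Real.exp (-(l * (r - s))) * (M * N * dist w w' * ((Real.exp (l * (r - s)) - 1) / l)) := by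
          gcongr
      _ = M * N / l * dist w w' * (1 - Real.exp (-(l * (r - s)))) := by
          rw [show 1 - Real.exp (-(l * (r - s))) = Real.exp (-(l * (r - s))) *
            (Real.exp (l * (r - s)) - 1) by linear_combination -hexp]
          ring
      _ ≤ M * N / l * dist w w' * 1 := by gcongr; linarith
      _ ≤ 1 / 2 * dist w w' := by rw [mul_one]; gcongr
      _ = _ := by norm_num
  have : Nonempty C(Icc s t, H) := ⟨0⟩
  obtain ⟨w₀, hw₀⟩ : ∃ w, G w = w := ⟨hG.fixedPoint, hG.fixedPoint_isFixedPt⟩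
  refine ⟨e w₀, he _, fun r hr => ?_⟩
  have hfix := congrArg (fun w : C(Icc s t, H) => w ⟨r, hr⟩) hw₀
  simp only [G, ContinuousMap.coe_mk] at hfix
  change Real.exp (l * (r - s)) • IccExtend hst w₀ r = _
  rw [IccExtend_of_mem _ _ hr, ← hfix, smul_smul, ← Real.exp_add]
  simp

/-- Change of base: a mild solution for `Y` is a mild solution for the perturbed evolution
operator, and is continuous. -/
lemma mild_rebase (hY : IsEvolutionOperator Y) (hD : IsBoundedMeasurableFamily D)
    (hV : IsPerturbedEvolution Y D V) (hb : LocallyBounded V) (hs : 0 ≤ s)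
    (hf : LocInt s f) (x : H) : ContinuousOn (mild Y f s x) (Ici s) ∧
    ∀ t, s ≤ t → mild Y f s x t = mild V (fun r => f r - D r (mild Y f s x r)) s x t := by
  -- The equation over `V` is solved first. Converting its solution to `Y` turns the forcing `f - D
  -- w` into `f - D w + D w = f`, so it is the mild solution for `Y`. Only `V` has to be locally
  -- bounded.
  have key : ∀ T, s ≤ T → ∃ w : ℝ → H, Continuous w ∧ ∀ r ∈ Icc s T, mild Y f s x r = w r ∧
      w r = mild V (fun r => f r - D r (w r)) s x r := by
    intro T hT
    obtain ⟨w, hw, hwe⟩ := exists_volterra_solution hV.1 hb hD hs hf x hT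
    refine ⟨w, hw, fun r hr => ⟨?_, hwe r hr⟩⟩
    have hint : LocInt s fun r => f r - D r (w r) := fun T =>
      (hf T).sub (hD.locInt hs (locInt_of_continuousOn hw.continuousOn) T)
    rw [hwe r hr, mild_eq_mild_of_perturbed hY hD hV hb hs hint x hr.1]
    refine mild_congr ((ae_restrict_iff' measurableSet_Ioc).2 (Eventually.of_forall
      fun σ hσ => ?_)) x hr.1
    simp [← hwe σ ⟨hσ.1.le, hσ.2.trans hr.2⟩]
  constructor
  · intro t ht
    obtain ⟨w, hw, hwe⟩ := key (t + 1) (by linarith [mem_Ici.1 ht])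
    refine hw.continuousWithinAt.congr_of_eventuallyEq ?_ (hwe t ⟨ht, by linarith⟩).1
    filter_upwards [inter_mem_nhdsWithin (Ici s) (Iic_mem_nhds (lt_add_one t))] with r hr
    exact (hwe r hr).1
  · intro t ht
    obtain ⟨w, hw, hwe⟩ := key t ht
    rw [(hwe t ⟨ht, le_rfl⟩).1, (hwe t ⟨ht, le_rfl⟩).2]
    refine mild_congr ((ae_restrict_iff' measurableSet_Ioc).2 (Eventually.of_forall
      fun σ hσ => ?_)) x ht
    simp only [(hwe σ ⟨hσ.1.le, hσ.2⟩).1]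

lemma IntegrableOn.inner_continuousOn {m y : ℝ → H} (hm : IntegrableOn m (Ioc s t))
    (hy : ContinuousOn y (Icc s t)) : IntegrableOn (fun r => inner 𝕜 (m r) (y r)) (Ioc s t) := by
  obtain ⟨C, hC⟩ := isCompact_Icc.exists_bound_of_continuousOn hy
  refine Integrable.mono' (hm.norm.mul_const C) (hm.1.inner
    ((hy.mono Ioc_subset_Icc_self).aestronglyMeasurable measurableSet_Ioc)) ?_
  filter_upwards [ae_restrict_mem measurableSet_Ioc] with r hr
  exact (norm_inner_le_norm _ _).trans (by gcongr; exact hC r ⟨hr.1.le, hr.2⟩)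

/-- Duality between forward mild solutions and backward (weak) mild solutions. -/
lemma inner_mild_duality (hV : IsEvolutionOperator V) (hb : LocallyBounded V) (hs : 0 ≤ s)
    (hst : s ≤ t) {b m q : ℝ → H} (hbi : LocInt s b) (hm : IntegrableOn m (Ioc s t)) (z₀ : H)
    (hq : ∀ r ∈ Icc s t, ∀ y, inner 𝕜 (q r) y = inner 𝕜 (q t) (V t r y) +
      ∫ ρ in r..t, inner 𝕜 (m ρ) (V ρ r y)) :
    IntegrableOn (fun r => inner 𝕜 (q r) (b r)) (Ioc s t) ∧
    IntegrableOn (fun r => inner 𝕜 (m r) (mild V b s z₀ r)) (Ioc s t) ∧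
    inner 𝕜 (q t) (mild V b s z₀ t) = inner 𝕜 (q s) z₀ +
      (∫ r in s..t, inner 𝕜 (q r) (b r)) - ∫ r in s..t, inner 𝕜 (m r) (mild V b s z₀ r) := by
  obtain ⟨M, hM0, hM⟩ := hb t
  have hk : Integrable ({p : ℝ × ℝ | p.2 ≤ p.1}.indicator
      fun p => inner 𝕜 (m p.1) (V p.1 p.2 (b p.2)))
      ((volume.restrict (Ioc s t)).prod (volume.restrict (Ioc s t))) := by
    refine Integrable.mono' (g := fun p => M * (‖m p.1‖ * ‖b p.2‖)) ?_ ?_ ?_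
    · exact (Integrable.mul_prod hm.norm (hbi t).norm).const_mul _
    · refine (hm.1.comp_fst.inner (hV.aestronglyMeasurable_triangle hs (hbi t).1)).congr
        (Eventually.of_forall fun p => ?_)
      by_cases h : p.2 ≤ p.1 <;> simp [indicator, h]
    · have hm1 : ∀ᵐ p ∂((volume.restrict (Ioc s t)).prod (volume.restrict (Ioc s t))),
          p.1 ∈ Ioc s t := Measure.quasiMeasurePreserving_fst.ae (ae_restrict_mem measurableSet_Ioc)
      have hm2 : ∀ᵐ p ∂((volume.restrict (Ioc s t)).prod (volume.restrict (Ioc s t))),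
          p.2 ∈ Ioc s t := Measure.quasiMeasurePreserving_snd.ae (ae_restrict_mem measurableSet_Ioc)
      filter_upwards [hm1, hm2] with p h1 h2
      by_cases h : p.2 ≤ p.1
      · have e1 := (V p.1 p.2).le_of_opNorm_le (hM p.2 p.1 (hs.trans h2.1.le) h h1.2) (b p.2)
        simp only [indicator, mem_ofPred_eq, h, if_true]
        calc _ ≤ ‖m p.1‖ * ‖V p.1 p.2 (b p.2)‖ := norm_inner_le_norm _ _
          _ ≤ ‖m p.1‖ * (M * ‖b p.2‖) := by gcongr
          _ = _ := by ring
      · simp only [indicator, mem_ofPred_eq, h, if_false, norm_zero]; positivity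
  obtain ⟨i1, i2, heq⟩ := integral_triangle_swap
    (k := fun σ r => inner 𝕜 (m σ) (V σ r (b r))) hst hk
  have hpull : ∀ (y : H) σ, s ≤ σ → ∫ r in s..σ, inner 𝕜 y (V σ r (b r)) =
      inner 𝕜 y (∫ r in s..σ, V σ r (b r)) := fun y σ hσ =>
    ContinuousLinearMap.intervalIntegral_comp_comm (innerSL 𝕜 y)
      (intervalIntegrable_mild hV hs hσ hbi)
  -- The backward equation at time `r`, tested on the forcing `b r`, evaluates the inner integral
  -- after the swap.
  have hright : ∀ r ∈ Icc s t, ∫ σ in r..t, inner 𝕜 (m σ) (V σ r (b r)) =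
      inner 𝕜 (q r) (b r) - inner 𝕜 (q t) (V t r (b r)) := by
    intro r hr
    rw [hq r hr (b r), add_sub_cancel_left]
  have hqt : IntegrableOn (fun r => inner 𝕜 (q t) (V t r (b r))) (Ioc s t) :=
    (innerSL 𝕜 (q t)).integrable_comp (hV.integrableOn_apply hs (hbi t))
  have hqb : IntegrableOn (fun r => inner 𝕜 (q r) (b r)) (Ioc s t) := by
    refine IntegrableOn.congr_fun (i2.add hqt) (fun r hr => ?_) measurableSet_Ioc
    simp only [Pi.add_apply]
    rw [hright r ⟨hr.1.le, hr.2⟩, sub_add_cancel]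
  have hmz : IntegrableOn (fun r => inner 𝕜 (m r) (mild V b s z₀ r)) (Ioc s t) :=
    IntegrableOn.inner_continuousOn hm ((continuousOn_mild hV hb hs hbi z₀).mono Icc_subset_Ici_self)
  have hmV : IntegrableOn (fun r => inner 𝕜 (m r) (V r s z₀)) (Ioc s t) :=
    IntegrableOn.inner_continuousOn hm ((hV.continuousOn_left s hs z₀).mono Icc_subset_Ici_self)
  refine ⟨hqb, hmz, ?_⟩
  have hI := fun {g : ℝ → 𝕜} => (intervalIntegrable_iff_integrableOn_Ioc_of_le (f := g)
    (μ := volume) hst).2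
  have h1 : ∫ r in s..t, inner 𝕜 (m r) (mild V b s z₀ r) =
      (∫ r in s..t, inner 𝕜 (m r) (V r s z₀)) +
        ∫ σ in s..t, ∫ r in s..σ, inner 𝕜 (m σ) (V σ r (b r)) := by
    rw [← intervalIntegral.integral_add (hI hmV) (hI i1)]
    refine intervalIntegral.integral_congr fun σ hσ => ?_
    rw [uIcc_of_le hst] at hσ
    simp only [mild, inner_add_right]
    rw [hpull _ σ hσ.1]
  have h2 : ∫ r in s..t, ∫ σ in r..t, inner 𝕜 (m σ) (V σ r (b r)) =
      (∫ r in s..t, inner 𝕜 (q r) (b r)) - ∫ r in s..t, inner 𝕜 (q t) (V t r (b r)) := by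
    rw [← intervalIntegral.integral_sub (hI hqb) (hI hqt)]
    refine intervalIntegral.integral_congr fun r hr => ?_
    rw [uIcc_of_le hst] at hr
    exact hright r hr
  rw [h1, heq, h2, hq s ⟨le_rfl, hst⟩ z₀, mild, inner_add_right, hpull _ t hst]
  ring

end Mild

end

section

/-! ### Square integrability on half-lines -/

section SquareIntegrals

/-- The integral of the squared norm over `[s, ∞)`. -/
def sqInt {E : Type*} [NormedAddCommGroup E] (s : ℝ) (g : ℝ → E) : ENNReal :=
  ∫⁻ r in Ici s, ‖g r‖ₑ ^ 2

/-- Square integrable functions on `[s, ∞)`. -/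
abbrev SqInt {E : Type*} [NormedAddCommGroup E] (s : ℝ) (g : ℝ → E) : Prop :=
  MemLp g 2 (volume.restrict (Ici s))

variable {E F : Type*} [NormedAddCommGroup E] [NormedAddCommGroup F] {s t : ℝ} {f g : ℝ → E}

lemma eLpNorm_sq_eq_sqInt : eLpNorm g 2 (volume.restrict (Ici s)) ^ 2 = sqInt s g := by
  rw [eLpNorm_eq_lintegral_rpow_enorm_toReal (by norm_num) (by norm_num), sqInt,
    ← ENNReal.rpow_natCast, ← ENNReal.rpow_mul]
  simp

lemma sqInt_iff : SqInt s g ↔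
    AEStronglyMeasurable g (volume.restrict (Ici s)) ∧ sqInt s g < ⊤ := by
  rw [← eLpNorm_sq_eq_sqInt]
  simp [SqInt, MemLp]

lemma SqInt.lt_top (hg : SqInt s g) : sqInt s g < ⊤ := (sqInt_iff.1 hg).2

lemma SqInt.mono_left (hg : SqInt s g) (h : s ≤ t) : SqInt t g :=
  hg.mono_measure (Measure.restrict_mono (Ici_subset_Ici.2 h) le_rfl)

lemma SqInt.locInt (hg : SqInt s g) : LocInt s g := fun T => by
  have : MemLp g 2 (volume.restrict (Ioc s T)) :=
    hg.mono_measure (Measure.restrict_mono (fun r hr => hr.1.le) le_rfl)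
  exact this.integrable (by norm_num)

lemma SqInt.integrable_sq (hg : SqInt s g) : IntegrableOn (fun r => ‖g r‖ ^ 2) (Ici s) :=
  hg.integrable_norm_pow (by norm_num)

lemma ennreal_add_sq_le (a b : ENNReal) : (a + b) ^ 2 ≤ 2 * (a ^ 2 + b ^ 2) := by
  rcases eq_or_ne a ⊤ with rfl | ha
  · simp
  rcases eq_or_ne b ⊤ with rfl | hb
  · simp
  lift a to NNReal using ha
  lift b to NNReal using hb
  norm_cast
  exact add_sq_le

lemma enorm_add_sq_le (a b : E) : ‖a + b‖ₑ ^ 2 ≤ 2 * (‖a‖ₑ ^ 2 + ‖b‖ₑ ^ 2) :=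
  (pow_le_pow_left' (enorm_add_le a b) 2).trans (ennreal_add_sq_le _ _)

lemma sqInt_add_le (hg : AEStronglyMeasurable f (volume.restrict (Ici s))) :
    sqInt s (fun r => f r + g r) ≤ 2 * (sqInt s f + sqInt s g) := by
  rw [sqInt, sqInt, sqInt, ← lintegral_add_left' (hg.enorm.pow_const 2),
    ← lintegral_const_mul' _ _ (by norm_num)]
  exact lintegral_mono fun r => enorm_add_sq_le _ _

lemma sqInt_le_of_norm_le {h : ℝ → F} {C : NNReal} (hle : ∀ r, s ≤ r → ‖g r‖ ≤ C * ‖h r‖) :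
    sqInt s g ≤ C ^ 2 * sqInt s h := by
  rw [sqInt, sqInt, ← lintegral_const_mul' _ _ (by finiteness)]
  refine setLIntegral_mono' measurableSet_Ici fun r hr => ?_
  rw [← mul_pow]
  gcongr
  have := hle r hr
  rw [← ofReal_norm, ← ofReal_norm, ← ENNReal.ofReal_coe_nnreal,
    ← ENNReal.ofReal_mul C.coe_nonneg]
  exact ENNReal.ofReal_le_ofReal this

lemma SqInt.of_norm_le {h : ℝ → F} (hh : SqInt s h) {C : NNReal}
    (hg : AEStronglyMeasurable g (volume.restrict (Ici s)))
    (hle : ∀ r, s ≤ r → ‖g r‖ ≤ C * ‖h r‖) : SqInt s g :=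
  sqInt_iff.2 ⟨hg, (sqInt_le_of_norm_le hle).trans_lt (by have := hh.lt_top; finiteness)⟩

end SquareIntegrals

/-! ### Convolution estimates for exponentially stable evolutions -/

section ExpBounds

lemma lintegral_exp_Ici {α : ℝ} (hα : 0 < α) (r : ℝ) :
    ∫⁻ t in Ici r, ENNReal.ofReal (Real.exp (-α * (t - r))) = ENNReal.ofReal (1 / α) := by
  have hd : ∀ t ∈ Ici r, HasDerivAt (fun t => -(1 / α) * Real.exp (-α * (t - r)))
      (Real.exp (-α * (t - r))) t := by
    intro t _
    have := ((((hasDerivAt_id t).sub_const r).const_mul (-α)).exp).const_mul (-(1 / α))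
    refine this.congr_deriv ?_
    simp; field_simp
  have hlim : Tendsto (fun t => -(1 / α) * Real.exp (-α * (t - r))) atTop (𝓝 0) := by
    have : Tendsto (fun t => -α * (t - r)) atTop atBot :=
      (tendsto_id.atTop_add tendsto_const_nhds).const_mul_atTop_of_neg (by linarith)
    simpa using (Real.tendsto_exp_atBot.comp this).const_mul (-(1 / α))
  have hpos : ∀ t ∈ Ioi r, 0 ≤ Real.exp (-α * (t - r)) := fun t _ => (Real.exp_pos _).le
  rw [setLIntegral_congr Ioi_ae_eq_Ici.symm, ← ofReal_integral_eq_lintegral_ofReal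
    (integrableOn_Ioi_deriv_of_nonneg' hd hpos hlim) (Eventually.of_forall fun t => (Real.exp_pos _).le),
    integral_Ioi_of_hasDerivAt_of_nonneg' hd hpos hlim]
  simp

lemma lintegral_exp_Ioc_le {α : ℝ} (hα : 0 < α) (s t : ℝ) :
    ∫⁻ r in Ioc s t, ENNReal.ofReal (Real.exp (-α * (t - r))) ≤ ENNReal.ofReal (1 / α) := by
  rcases le_total t s with h | h
  · simp [Ioc_eq_empty (not_lt.2 h)]
  have hd : ∀ r ∈ uIcc s t, HasDerivAt (fun r => (1 / α) * Real.exp (-α * (t - r)))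
      (Real.exp (-α * (t - r))) r := by
    intro r _
    have := ((((hasDerivAt_id r).const_sub t).const_mul (-α)).exp).const_mul (1 / α)
    refine this.congr_deriv ?_
    simp; field_simp
  have hc : Continuous fun r => Real.exp (-α * (t - r)) := by fun_prop
  rw [← ofReal_integral_eq_lintegral_ofReal
    ((intervalIntegrable_iff_integrableOn_Ioc_of_le h).1 (hc.intervalIntegrable s t))
    (Eventually.of_forall fun t => (Real.exp_pos _).le), ← intervalIntegral.integral_of_le h,
    intervalIntegral.integral_eq_sub_of_hasDerivAt hd (hc.intervalIntegrable s t)]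
  refine ENNReal.ofReal_le_ofReal ?_
  simp only [sub_self, mul_zero, Real.exp_zero, mul_one]
  have := Real.exp_pos (-α * (t - s))
  have : 0 ≤ 1 / α * Real.exp (-α * (t - s)) := by positivity
  linarith

lemma lintegral_mul_sq_le {μ : Measure ℝ} {f g : ℝ → ENNReal} (hf : AEMeasurable f μ)
    (hg : AEMeasurable g μ) :
    (∫⁻ r, f r * g r ∂μ) ^ 2 ≤ (∫⁻ r, f r ^ 2 ∂μ) * ∫⁻ r, g r ^ 2 ∂μ := by
  have h := ENNReal.lintegral_mul_le_Lp_mul_Lq μ (p := 2) (q := 2) ⟨by norm_num, by norm_num, by norm_num⟩ hf hg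
  refine (pow_le_pow_left' h 2).trans (le_of_eq ?_)
  rw [mul_pow, ← ENNReal.rpow_natCast, ← ENNReal.rpow_natCast, ← ENNReal.rpow_mul,
    ← ENNReal.rpow_mul]
  simp

variable {𝕜 H : Type*} [RCLike 𝕜] [NormedAddCommGroup H] [InnerProductSpace 𝕜 H] [CompleteSpace H]
  [NormedSpace ℝ H] {V : ℝ → ℝ → H →L[𝕜] H} {g : ℝ → H} {s t : ℝ} {M α : ℝ}

/-- Cauchy–Schwarz after splitting the exponential kernel into two equal factors. One factor
integrates to at most `1/α`; the weight left on `‖g‖²` is what later yields both square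
integrability and decay. -/
lemma enorm_conv_sq_le (hM : 0 ≤ M) (hα : 0 < α)
    (hVM : ∀ s t, 0 ≤ s → s ≤ t → ‖V t s‖ ≤ M * Real.exp (-α * (t - s))) (hs : 0 ≤ s)
    (hst : s ≤ t) (hg : AEStronglyMeasurable g (volume.restrict (Ici s))) :
    ‖∫ r in s..t, V t r (g r)‖ₑ ^ 2 ≤ ENNReal.ofReal (M ^ 2 / α) *
      ∫⁻ r in Ioc s t, ENNReal.ofReal (Real.exp (-α * (t - r))) * ‖g r‖ₑ ^ 2 := by
  have hsub : Ioc s t ⊆ Ici s := fun r hr => hr.1.le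
  have hm : AEMeasurable (fun r => ENNReal.ofReal (Real.exp (-α / 2 * (t - r)))) 
    (volume.restrict (Ioc s t)) := (Measurable.ennreal_ofReal (by fun_prop)).aemeasurable
  have h1 : ‖∫ r in s..t, V t r (g r)‖ₑ ≤ ENNReal.ofReal M *
      ∫⁻ r in Ioc s t, ENNReal.ofReal (Real.exp (-α / 2 * (t - r))) *
        (ENNReal.ofReal (Real.exp (-α / 2 * (t - r))) * ‖g r‖ₑ) := by
    rw [intervalIntegral.integral_of_le hst, ← lintegral_const_mul' _ _ (by finiteness)]
    refine (enorm_integral_le_lintegral_enorm _).trans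
      (setLIntegral_mono' measurableSet_Ioc fun r hr => ?_)
    have h2 := (V t r).le_of_opNorm_le (hVM r t (hs.trans hr.1.le) hr.2) (g r)
    rw [← mul_assoc (ENNReal.ofReal (Real.exp _)), ← ENNReal.ofReal_mul (Real.exp_pos _).le,
      ← Real.exp_add, ← mul_assoc, ← ENNReal.ofReal_mul hM, ← ofReal_norm,
      ← ofReal_norm, ← ENNReal.ofReal_mul (by positivity)]
    refine ENNReal.ofReal_le_ofReal (h2.trans (le_of_eq ?_))
    congr 3; ring
  have hexp : ∀ r, ENNReal.ofReal (Real.exp (-α / 2 * (t - r))) ^ 2 =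
      ENNReal.ofReal (Real.exp (-α * (t - r))) := fun r => by
    rw [← ENNReal.ofReal_pow (Real.exp_pos _).le, ← Real.exp_nat_mul]
    congr 2; push_cast; ring
  have h3 := lintegral_mul_sq_le hm (hm.mul (hg.mono_set hsub).enorm)
  simp only [Pi.mul_apply, mul_pow, hexp] at h3
  calc _ ≤ _ := pow_le_pow_left' h1 2
    _ ≤ ENNReal.ofReal M ^ 2 * (ENNReal.ofReal (1 / α) *
        ∫⁻ r in Ioc s t, ENNReal.ofReal (Real.exp (-α * (t - r))) * ‖g r‖ₑ ^ 2) := by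
      rw [mul_pow]
      gcongr
      exact h3.trans (by gcongr; exact lintegral_exp_Ioc_le hα s t)
    _ = _ := by
      rw [← mul_assoc, ← ENNReal.ofReal_pow hM, ← ENNReal.ofReal_mul (by positivity)]
      congr 2; ring

lemma enorm_conv_sq_le_sqInt (hM : 0 ≤ M) (hα : 0 < α)
    (hVM : ∀ s t, 0 ≤ s → s ≤ t → ‖V t s‖ ≤ M * Real.exp (-α * (t - s))) (hs : 0 ≤ s)
    (hst : s ≤ t) (hg : AEStronglyMeasurable g (volume.restrict (Ici s))) :
    ‖∫ r in s..t, V t r (g r)‖ₑ ^ 2 ≤ ENNReal.ofReal (M ^ 2 / α) * sqInt s g := by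
  refine (enorm_conv_sq_le hM hα hVM hs hst hg).trans (mul_le_mul' le_rfl ?_)
  refine (setLIntegral_mono' measurableSet_Ioc (g := fun r => ‖g r‖ₑ ^ 2) fun r hr => ?_).trans
    (lintegral_mono' (Measure.restrict_mono (fun r hr => hr.1.le) le_rfl) le_rfl)
  refine mul_le_of_le_one_left' (ENNReal.ofReal_le_one.2 (Real.exp_le_one_iff.2 ?_))
  nlinarith [hr.2]

/-- Young's inequality: integrate the weighted pointwise bound in `t` and swap by Tonelli, so that
each `r` carries total weight at most `1/α`. -/
lemma sqInt_conv_le (hM : 0 ≤ M) (hα : 0 < α)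
    (hVM : ∀ s t, 0 ≤ s → s ≤ t → ‖V t s‖ ≤ M * Real.exp (-α * (t - s))) (hs : 0 ≤ s)
    (hg : AEStronglyMeasurable g (volume.restrict (Ici s))) :
    sqInt s (fun t => ∫ r in s..t, V t r (g r)) ≤
      ENNReal.ofReal (M ^ 2 / α) * (ENNReal.ofReal (1 / α) * sqInt s g) := by
  have h1 : sqInt s (fun t => ∫ r in s..t, V t r (g r)) ≤ ∫⁻ t in Ici s,
      ENNReal.ofReal (M ^ 2 / α) * ∫⁻ r in Ici s, {p : ℝ × ℝ | p.2 ≤ p.1}.indicator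
        (fun p => ENNReal.ofReal (Real.exp (-α * (p.1 - p.2))) * ‖g p.2‖ₑ ^ 2) (t, r) := by
    refine setLIntegral_mono' measurableSet_Ici fun t ht => ?_
    refine (enorm_conv_sq_le hM hα hVM hs ht hg).trans (mul_le_mul' le_rfl ?_)
    have : ∀ r, {p : ℝ × ℝ | p.2 ≤ p.1}.indicator
        (fun p => ENNReal.ofReal (Real.exp (-α * (p.1 - p.2))) * ‖g p.2‖ₑ ^ 2) (t, r) =
        (Iic t).indicator (fun r => ENNReal.ofReal (Real.exp (-α * (t - r))) * ‖g r‖ₑ ^ 2) r :=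
      fun r => by simp [indicator]
    simp only [this]
    rw [lintegral_indicator measurableSet_Iic, Measure.restrict_restrict measurableSet_Iic]
    exact lintegral_mono' (Measure.restrict_mono
      (show Ioc s t ⊆ Iic t ∩ Ici s from fun r hr => ⟨hr.2, hr.1.le⟩) le_rfl) le_rfl
  refine h1.trans ?_
  rw [lintegral_const_mul' _ _ (by finiteness)]
  gcongr
  have hmeas : AEMeasurable (Function.uncurry fun t r => {p : ℝ × ℝ | p.2 ≤ p.1}.indicator
        (fun p => ENNReal.ofReal (Real.exp (-α * (p.1 - p.2))) * ‖g p.2‖ₑ ^ 2) (t, r))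
        ((volume.restrict (Ici s)).prod (volume.restrict (Ici s))) := by
    refine AEMeasurable.indicator ?_ (measurableSet_le measurable_snd measurable_fst)
    exact (Measurable.ennreal_ofReal (by fun_prop)).aemeasurable.mul
      ((hg.comp_snd (μ := volume.restrict (Ici s))).enorm.pow_const 2)
  rw [lintegral_lintegral_swap hmeas, sqInt, ← lintegral_const_mul' _ _ (by finiteness)]
  refine lintegral_mono fun r => ?_
  have : ∀ t, {p : ℝ × ℝ | p.2 ≤ p.1}.indicator
      (fun p => ENNReal.ofReal (Real.exp (-α * (p.1 - p.2))) * ‖g p.2‖ₑ ^ 2) (t, r) =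
      (Ici r).indicator (fun t => ENNReal.ofReal (Real.exp (-α * (t - r)))) t * ‖g r‖ₑ ^ 2 :=
    fun t => by by_cases h : r ≤ t <;> simp [indicator, h]
  simp only [this]
  rw [lintegral_mul_const _ (Measurable.indicator (Measurable.ennreal_ofReal (by fun_prop))
    measurableSet_Ici)]
  gcongr
  rw [← lintegral_exp_Ici hα r, lintegral_indicator measurableSet_Ici]
  exact lintegral_mono' (Measure.restrict_mono_measure Measure.restrict_le_self _) le_rfl

/-- Dominated convergence in the weighted bound: for fixed `r` the kernel decays in `t`, and `‖g‖²`
dominates. -/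
lemma tendsto_conv (hM : 0 ≤ M) (hα : 0 < α)
    (hVM : ∀ s t, 0 ≤ s → s ≤ t → ‖V t s‖ ≤ M * Real.exp (-α * (t - s))) (hs : 0 ≤ s)
    (hg : SqInt s g) : Tendsto (fun t => ∫ r in s..t, V t r (g r)) atTop (𝓝 0) := by
  have h1 : Tendsto (fun t => ∫⁻ r in Ici s, (Iic t).indicator
      (fun r => ENNReal.ofReal (Real.exp (-α * (t - r))) * ‖g r‖ₑ ^ 2) r) atTop (𝓝 0) := by
    have h0 : (0 : ENNReal) = ∫⁻ r in Ici s, 0 := by simp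
    rw [h0]
    refine tendsto_lintegral_filter_of_dominated_convergence' (fun r => ‖g r‖ₑ ^ 2)
      (Eventually.of_forall fun t => ?_) (Eventually.of_forall fun t => ?_) hg.lt_top.ne ?_
    · exact ((Measurable.ennreal_ofReal (by fun_prop)).aemeasurable.mul
        (hg.1.enorm.pow_const 2)).indicator measurableSet_Iic
    · refine Eventually.of_forall fun r => ?_
      by_cases h : r ≤ t
      · simp only [indicator, mem_Iic, h, if_true]
        refine mul_le_of_le_one_left' (ENNReal.ofReal_le_one.2 (Real.exp_le_one_iff.2 ?_))
        nlinarith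
      · simp [indicator, h]
    · refine Eventually.of_forall fun r => ?_
      have hlim : Tendsto (fun t => ENNReal.ofReal (Real.exp (-α * (t - r))) * ‖g r‖ₑ ^ 2)
          atTop (𝓝 0) := by
        have : Tendsto (fun t => -α * (t - r)) atTop atBot :=
          (tendsto_id.atTop_add tendsto_const_nhds).const_mul_atTop_of_neg (by linarith)
        have := (ENNReal.continuous_ofReal.tendsto _).comp (Real.tendsto_exp_atBot.comp this)
        simpa using ENNReal.Tendsto.mul_const this (Or.inr (by finiteness))
      refine tendsto_of_tendsto_of_tendsto_of_le_of_le tendsto_const_nhds hlim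
        (fun t => zero_le) fun t => indicator_le_self _ _ _
  have h2 : Tendsto (fun t => ENNReal.ofReal (M ^ 2 / α) * ∫⁻ r in Ici s, (Iic t).indicator
      (fun r => ENNReal.ofReal (Real.exp (-α * (t - r))) * ‖g r‖ₑ ^ 2) r) atTop (𝓝 0) := by
    simpa using ENNReal.Tendsto.const_mul h1 (Or.inr (by finiteness))
  have h3 : Tendsto (fun t => ‖∫ r in s..t, V t r (g r)‖ₑ ^ 2) atTop (𝓝 0) := by
    refine tendsto_of_tendsto_of_tendsto_of_le_of_le' tendsto_const_nhds h2
      (Eventually.of_forall fun t => zero_le) ?_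
    filter_upwards [eventually_ge_atTop s] with t ht
    refine (enorm_conv_sq_le hM hα hVM hs ht hg.1).trans (mul_le_mul' le_rfl ?_)
    rw [lintegral_indicator measurableSet_Iic, Measure.restrict_restrict measurableSet_Iic]
    exact lintegral_mono' (Measure.restrict_mono
      (show Ioc s t ⊆ Iic t ∩ Ici s from fun r hr => ⟨hr.2, hr.1.le⟩) le_rfl) le_rfl
  rw [tendsto_zero_iff_norm_tendsto_zero]
  have h4 : Tendsto (fun t => ‖∫ r in s..t, V t r (g r)‖ ^ 2) atTop (𝓝 0) := by
    have := (ENNReal.tendsto_toReal ENNReal.zero_ne_top).comp h3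
    simpa [Function.comp_def] using this
  have h5 := (Real.continuous_sqrt.tendsto 0).comp h4
  simpa [Function.comp_def, Real.sqrt_sq (norm_nonneg _)] using h5

/-- Bounds for mild solutions of an exponentially stable evolution operator. -/
lemma ExpStable.mild_bounds (hV : IsEvolutionOperator V) (hst : ExpStable V) :
    ∃ C : NNReal, ∀ s, 0 ≤ s → ∀ (x : H) (g : ℝ → H), SqInt s g →
      SqInt s (mild V g s x) ∧ sqInt s (mild V g s x) ≤ C * (‖x‖ₑ ^ 2 + sqInt s g) ∧
      (∀ t, s ≤ t → ‖mild V g s x t‖ₑ ^ 2 ≤ C * (‖x‖ₑ ^ 2 + sqInt s g)) ∧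
      Tendsto (mild V g s x) atTop (𝓝 0) := by
  have hlb := hst.locallyBounded
  obtain ⟨M, α, hM, hα, hVM⟩ := hst
  -- `c₁` and `c₂` bound the convolution in `L²` and pointwise; `c₃` and `c₄` bound the homogeneous
  -- part pointwise and in `L²`. The factor 2 below is that of `(a + b)² ≤ 2 (a² + b²)`.
  set c₁ := ENNReal.ofReal (M ^ 2 / α) * ENNReal.ofReal (1 / α) with hc₁
  set c₂ := ENNReal.ofReal (M ^ 2 / α) with hc₂
  set c₃ := ENNReal.ofReal (M ^ 2) with hc₃
  set c₄ := ENNReal.ofReal (M ^ 2) * ENNReal.ofReal (1 / α) with hc₄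
  obtain ⟨C, hC⟩ : ∃ C : NNReal, (C : ENNReal) = 2 * (c₁ + c₂ + c₃ + c₄) :=
    ENNReal.canLift.prf _ (by finiteness)
  have hV1 : ∀ s t, 0 ≤ s → s ≤ t → ∀ x, ‖V t s x‖ₑ ^ 2 ≤
      c₃ * (ENNReal.ofReal (Real.exp (-α * (t - s))) * ‖x‖ₑ ^ 2) := by
    intro s t hs hst x
    have h1 := (V t s).le_of_opNorm_le (hVM s t hs hst) x
    have h2 : Real.exp (-α * (t - s)) ≤ 1 := Real.exp_le_one_iff.2 (by nlinarith)
    have h3 := Real.exp_pos (-α * (t - s))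
    rw [← ofReal_norm, ← ofReal_norm, ← ENNReal.ofReal_pow (norm_nonneg _),
      ← ENNReal.ofReal_pow (norm_nonneg _), ← ENNReal.ofReal_mul h3.le,
      ← ENNReal.ofReal_mul (by positivity)]
    refine ENNReal.ofReal_le_ofReal ((pow_le_pow_left₀ (norm_nonneg _) h1 2).trans ?_)
    calc _ = M ^ 2 * (Real.exp (-α * (t - s)) * (Real.exp (-α * (t - s)) * ‖x‖ ^ 2)) := by ring
      _ ≤ M ^ 2 * (1 * (Real.exp (-α * (t - s)) * ‖x‖ ^ 2)) := by gcongr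
      _ = _ := by ring
  refine ⟨C, fun s hs x g hg => ?_⟩
  have hcont := continuousOn_mild hV hlb hs hg.locInt x
  have hVx : AEStronglyMeasurable (fun t => V t s x) (volume.restrict (Ici s)) :=
    (hV.continuousOn_left s hs x).aestronglyMeasurable measurableSet_Ici
  have hsq : sqInt s (mild V g s x) ≤ C * (‖x‖ₑ ^ 2 + sqInt s g) := by
    have h1 : sqInt s (fun t => V t s x) ≤ c₄ * ‖x‖ₑ ^ 2 := by
      refine (setLIntegral_mono' measurableSet_Ici fun t ht => hV1 s t hs ht x).trans ?_
      rw [lintegral_const_mul' _ _ (by finiteness), lintegral_mul_const _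
        (Measurable.ennreal_ofReal (by fun_prop)), lintegral_exp_Ici hα, mul_assoc]
    have h2 := sqInt_conv_le hM hα hVM hs hg.1
    refine (sqInt_add_le hVx).trans ?_
    rw [hC, mul_assoc]
    gcongr
    rw [← mul_assoc] at h2
    calc _ ≤ c₄ * ‖x‖ₑ ^ 2 + c₁ * sqInt s g := add_le_add h1 h2
      _ ≤ (c₁ + c₂ + c₃ + c₄) * ‖x‖ₑ ^ 2 + (c₁ + c₂ + c₃ + c₄) * sqInt s g := by
        gcongr
        · exact le_add_self
        · rw [add_assoc, add_assoc]; exact le_self_add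
      _ = _ := by ring
  have hE : (C : ENNReal) * (‖x‖ₑ ^ 2 + sqInt s g) < ⊤ := by
    have := hg.lt_top; finiteness
  refine ⟨sqInt_iff.2 ⟨hcont.aestronglyMeasurable measurableSet_Ici, hsq.trans_lt hE⟩, hsq,
    fun t ht => ?_, ?_⟩
  · refine (enorm_add_sq_le _ _).trans ?_
    rw [hC, mul_assoc]
    gcongr
    have h1 : ‖V t s x‖ₑ ^ 2 ≤ c₃ * ‖x‖ₑ ^ 2 := by
      refine (hV1 s t hs ht x).trans ?_
      gcongr
      refine mul_le_of_le_one_left' (ENNReal.ofReal_le_one.2 (Real.exp_le_one_iff.2 ?_))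
      nlinarith
    have h2 := enorm_conv_sq_le_sqInt hM hα hVM hs ht hg.1
    calc _ ≤ c₃ * ‖x‖ₑ ^ 2 + c₂ * sqInt s g := add_le_add h1 h2
      _ ≤ (c₁ + c₂ + c₃ + c₄) * ‖x‖ₑ ^ 2 + (c₁ + c₂ + c₃ + c₄) * sqInt s g := by
        gcongr
        · rw [add_assoc _ c₃]; exact le_add_self.trans' le_self_add
        · rw [add_assoc, add_assoc]; exact le_add_self.trans' le_self_add
      _ = _ := by ring
  · have h1 : Tendsto (fun t => V t s x) atTop (𝓝 0) := by
      have hexp : Tendsto (fun t => M * Real.exp (-α * (t - s)) * ‖x‖) atTop (𝓝 0) := by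
        have : Tendsto (fun t => -α * (t - s)) atTop atBot :=
          (tendsto_id.atTop_add tendsto_const_nhds).const_mul_atTop_of_neg (by linarith)
        simpa using ((Real.tendsto_exp_atBot.comp this).const_mul M).mul_const ‖x‖
      refine squeeze_zero_norm' ?_ hexp
      filter_upwards [eventually_ge_atTop s] with t ht
      exact (V t s).le_of_opNorm_le (hVM s t hs ht) x
    simpa using! h1.add (tendsto_conv hM hα hVM hs hg)

end ExpBounds

end

section

/-! ### Square roots and inverses of operator families -/

section Families

variable {𝕜 : Type*} [RCLike 𝕜] {E F : Type*} [NormedAddCommGroup E] [InnerProductSpace 𝕜 E]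
  [CompleteSpace E] [NormedAddCommGroup F] [InnerProductSpace 𝕜 F] [CompleteSpace F]

lemma IsBoundedContinuousFamily.adjoint {D : ℝ → E →L[𝕜] F} (h : IsBoundedContinuousFamily D) :
    IsBoundedContinuousFamily fun t => ContinuousLinearMap.adjoint (D t) := by
  obtain ⟨h1, M, hM⟩ := h
  refine ⟨(LinearIsometryEquiv.continuous _).comp_continuousOn h1, M, fun t ht => ?_⟩
  simpa using hM t ht

lemma IsPositiveSqrt.norm_sq {S W : E →L[𝕜] E} (h : IsPositiveSqrt S W) (x : E) :
    ‖S x‖ ^ 2 = RCLike.re (inner 𝕜 x (W x)) := by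
  rw [← h.2, ContinuousLinearMap.comp_apply, ← h.1.inner_left_eq_inner_right, inner_self_eq_norm_sq]

/-- Only `W` is assumed norm continuous while detectability involves its root. The Hölder-1/2
estimate for the root transfers continuity, and `‖S x‖² = (x, W x)` transfers the bound. -/
lemma isBoundedContinuousFamily_sqrt {S W : ℝ → E →L[𝕜] E} (hW : IsBoundedContinuousFamily W)
    (h : ∀ t, 0 ≤ t → IsPositiveSqrt (S t) (W t)) : IsBoundedContinuousFamily S := by
  obtain ⟨h1, M, hM⟩ := hW
  have hM0 : 0 ≤ M := (norm_nonneg _).trans (hM 0 le_rfl)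
  refine ⟨fun t ht => ?_, √M, fun t ht => ?_⟩
  · rw [ContinuousWithinAt, tendsto_iff_norm_sub_tendsto_zero]
    have h2 := (tendsto_iff_norm_sub_tendsto_zero.1 (h1 t ht)).sqrt
    rw [Real.sqrt_zero] at h2
    refine squeeze_zero' (Eventually.of_forall fun r => norm_nonneg _) ?_ h2
    filter_upwards [self_mem_nhdsWithin] with r hr
    exact Real.le_sqrt_of_sq_le (norm_sub_sq_le_of_isPositiveSqrt (h r hr) (h t ht))
  · refine ContinuousLinearMap.opNorm_le_bound _ (Real.sqrt_nonneg _) fun x => ?_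
    refine le_of_sq_le_sq ?_ (by positivity)
    rw [(h t ht).norm_sq, mul_pow, Real.sq_sqrt hM0]
    refine (RCLike.re_le_norm _).trans ((norm_inner_le_norm _ _).trans ?_)
    calc ‖x‖ * ‖W t x‖ ≤ ‖x‖ * (M * ‖x‖) := by
          gcongr; exact (W t).le_of_opNorm_le (hM t ht) x
      _ = _ := by ring

/-- Lax–Milgram. It serves for `R(t)` and for the Hessian of the cost. -/
lemma isUnit_of_coercive {T : E →L[𝕜] E} {δ : ℝ} (hδ : 0 < δ)
    (h : ∀ x, δ * ‖x‖ ^ 2 ≤ RCLike.re (inner 𝕜 x (T x))) : IsUnit T := by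
  refine T.isUnit_of_forall_le_norm_inner_map (c := ⟨δ, hδ.le⟩) hδ fun x => ?_
  rw [norm_inner_symm, mul_comm]
  exact (h x).trans (RCLike.re_le_norm _)

lemma apply_inverse_of_isUnit {T : E →L[𝕜] E} (h : IsUnit T) (x : E) : T (T.inverse x) = x := by
  rw [← ContinuousLinearMap.ringInverse_eq_inverse]
  exact congrArg (fun L : E →L[𝕜] E => L x) (Ring.mul_inverse_cancel T h)

lemma inverse_apply_of_isUnit {T : E →L[𝕜] E} (h : IsUnit T) (x : E) : T.inverse (T x) = x := by
  rw [← ContinuousLinearMap.ringInverse_eq_inverse]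
  exact congrArg (fun L : E →L[𝕜] E => L x) (Ring.inverse_mul_cancel T h)

/-- Inversion is continuous at units; coercivity at `y = R⁻¹ x` gives the bound `1/δ` uniformly in
time. -/
lemma isBoundedContinuousFamily_inverse {R : ℝ → E →L[𝕜] E} (hR : IsBoundedContinuousFamily R)
    {δ : ℝ} (hδ : 0 < δ)
    (h : ∀ t, 0 ≤ t → ∀ x, δ * ‖x‖ ^ 2 ≤ RCLike.re (inner 𝕜 x (R t x))) :
    IsBoundedContinuousFamily fun t => (R t).inverse := by
  have hu := fun t ht => isUnit_of_coercive hδ (h t ht)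
  refine ⟨fun t ht => ?_, δ⁻¹, fun t ht => ?_⟩
  · rw [← ContinuousLinearMap.ringInverse_eq_inverse]
    obtain ⟨u, hu⟩ := hu t ht
    have := NormedRing.inverse_continuousAt u
    rw [hu] at this
    exact this.comp_continuousWithinAt (hR.1 t ht)
  · refine ContinuousLinearMap.opNorm_le_bound _ (by positivity) fun x => ?_
    set y := (R t).inverse x with hy
    have h1 := h t ht y
    rw [hy, apply_inverse_of_isUnit (hu t ht), ← hy] at h1
    have h2 := h1.trans ((RCLike.re_le_norm _).trans (norm_inner_le_norm y x))
    rcases eq_or_ne y 0 with h0 | h0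
    · rw [h0, norm_zero]; positivity
    · have hy0 : 0 < ‖y‖ := norm_pos_iff.2 h0
      rw [inv_mul_eq_div, le_div_iff₀ hδ]
      refine le_of_mul_le_mul_right ?_ hy0
      nlinarith

end Families

/-! ### The setting, and the consequences of detectability -/

variable {𝕜 H U : Type*} [RCLike 𝕜]
  [NormedAddCommGroup H] [InnerProductSpace 𝕜 H] [CompleteSpace H] [NormedSpace ℝ H]
  [NormedAddCommGroup U] [InnerProductSpace 𝕜 U] [CompleteSpace U]

/-- The data of the problem: stabilizing and detecting perturbations included. -/
structure LQSetting (Y : ℝ → ℝ → H →L[𝕜] H) (B : ℝ → U →L[𝕜] H) (W : ℝ → H →L[𝕜] H)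
    (R : ℝ → U →L[𝕜] U) (K : ℝ → H →L[𝕜] U) (VK : ℝ → ℝ → H →L[𝕜] H) (S L : ℝ → H →L[𝕜] H)
    (VL : ℝ → ℝ → H →L[𝕜] H) : Prop where
  evol : IsEvolutionOperator Y
  B_cont : IsBoundedContinuousFamily B
  W_cont : IsBoundedContinuousFamily W
  W_pos : ∀ t, 0 ≤ t → (W t).IsPositive
  R_cont : IsBoundedContinuousFamily R
  R_sa : ∀ t, 0 ≤ t → IsSelfAdjoint (R t)
  R_coer : ∃ δ : ℝ, 0 < δ ∧ ∀ t, 0 ≤ t → ∀ w : U, δ * ‖w‖ ^ 2 ≤ RCLike.re (inner 𝕜 w (R t w))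
  K_cont : IsBoundedContinuousFamily K
  VK_pert : IsPerturbedEvolution Y (fun t => B t ∘L K t) VK
  VK_stable : ExpStable VK
  sqrt : ∀ t, 0 ≤ t → IsPositiveSqrt (S t) (W t)
  L_cont : IsBoundedContinuousFamily L
  VL_pert : IsPerturbedEvolution Y (fun t => L t ∘L S t) VL
  VL_stable : ExpStable VL

namespace LQSetting

variable {Y VK VL : ℝ → ℝ → H →L[𝕜] H} {B : ℝ → U →L[𝕜] H} {W S L : ℝ → H →L[𝕜] H}
  {R : ℝ → U →L[𝕜] U} {K : ℝ → H →L[𝕜] U} {s t : ℝ}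

lemma B_meas (h : LQSetting Y B W R K VK S L VL) : IsBoundedMeasurableFamily B :=
  h.B_cont.isBoundedMeasurableFamily

lemma W_meas (h : LQSetting Y B W R K VK S L VL) : IsBoundedMeasurableFamily W :=
  h.W_cont.isBoundedMeasurableFamily

lemma R_meas (h : LQSetting Y B W R K VK S L VL) : IsBoundedMeasurableFamily R :=
  h.R_cont.isBoundedMeasurableFamily

lemma K_meas (h : LQSetting Y B W R K VK S L VL) : IsBoundedMeasurableFamily K :=
  h.K_cont.isBoundedMeasurableFamily

lemma S_meas (h : LQSetting Y B W R K VK S L VL) : IsBoundedMeasurableFamily S :=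
  (isBoundedContinuousFamily_sqrt h.W_cont h.sqrt).isBoundedMeasurableFamily

lemma L_meas (h : LQSetting Y B W R K VK S L VL) : IsBoundedMeasurableFamily L :=
  h.L_cont.isBoundedMeasurableFamily

lemma adjointB_meas (h : LQSetting Y B W R K VK S L VL) :
    IsBoundedMeasurableFamily fun t => ContinuousLinearMap.adjoint (B t) :=
  h.B_cont.adjoint.isBoundedMeasurableFamily

lemma invR_meas (h : LQSetting Y B W R K VK S L VL) :
    IsBoundedMeasurableFamily fun t => (R t).inverse := by
  obtain ⟨δ, hδ, hR⟩ := h.R_coer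
  exact (isBoundedContinuousFamily_inverse h.R_cont hδ hR).isBoundedMeasurableFamily

lemma R_unit (h : LQSetting Y B W R K VK S L VL) (ht : 0 ≤ t) : IsUnit (R t) := by
  obtain ⟨δ, hδ, hR⟩ := h.R_coer
  exact isUnit_of_coercive hδ (hR t ht)

lemma inner_R (h : LQSetting Y B W R K VK S L VL) (ht : 0 ≤ t) (x y : U) :
    inner 𝕜 (R t x) y = inner 𝕜 x (R t y) :=
  (ContinuousLinearMap.isSelfAdjoint_iff_isSymmetric.1 (h.R_sa t ht)) x y

lemma re_R_nonneg (h : LQSetting Y B W R K VK S L VL) (ht : 0 ≤ t) (x : U) :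
    0 ≤ RCLike.re (inner 𝕜 x (R t x)) := by
  obtain ⟨δ, hδ, hR⟩ := h.R_coer
  exact le_trans (by positivity) (hR t ht x)

end LQSetting

section SqIntFamilies

variable {E F : Type*} [NormedAddCommGroup E] [NormedSpace 𝕜 E] [NormedAddCommGroup F]
  [NormedSpace 𝕜 F] {s : ℝ}

lemma IsBoundedMeasurableFamily.exists_bound {D : ℝ → E →L[𝕜] F}
    (hD : IsBoundedMeasurableFamily D) :
    ∃ C : NNReal, ∀ t, 0 ≤ t → ∀ x, ‖D t x‖ ≤ C * ‖x‖ := by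
  obtain ⟨M, hM0, hM⟩ := hD.2
  exact ⟨⟨M, hM0⟩, fun t ht x => (D t).le_of_opNorm_le (hM t ht) x⟩

lemma IsBoundedMeasurableFamily.sqInt {D : ℝ → E →L[𝕜] F} (hD : IsBoundedMeasurableFamily D)
    (hs : 0 ≤ s) {f : ℝ → E} (hf : SqInt s f) : SqInt s fun t => D t (f t) := by
  obtain ⟨C, hC⟩ := hD.exists_bound
  exact hf.of_norm_le (hD.aestronglyMeasurable (Ici_subset_Ici.2 hs) hf.1)
    fun r hr => hC r (hs.trans hr) _

lemma IsBoundedMeasurableFamily.exists_sqInt_le {D : ℝ → E →L[𝕜] F}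
    (hD : IsBoundedMeasurableFamily D) :
    ∃ C : NNReal, ∀ s, 0 ≤ s → ∀ f : ℝ → E, InfiniteLQ.sqInt s (fun t => D t (f t)) ≤
      C * InfiniteLQ.sqInt s f := by
  obtain ⟨C, hC⟩ := hD.exists_bound
  refine ⟨C ^ 2, fun s hs f => ?_⟩
  have := sqInt_le_of_norm_le (g := fun t => D t (f t)) fun r hr => hC r (hs.trans hr) (f r)
  exact_mod_cast this

end SqIntFamilies

namespace LQSetting

variable {Y VK VL : ℝ → ℝ → H →L[𝕜] H} {B : ℝ → U →L[𝕜] H} {W S L : ℝ → H →L[𝕜] H}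
  {R : ℝ → U →L[𝕜] U} {K : ℝ → H →L[𝕜] U} {s t : ℝ}

lemma mildSolution_eq (s : ℝ) (x : H) (u : ℝ → U) :
    mildSolution Y B s x u = mild Y (fun r => B r (u r)) s x := rfl

/-- For controls with finite cost the control and the trajectory are square integrable, and the
trajectory vanishes at infinity. -/
lemma detect (h : LQSetting Y B W R K VK S L VL) : ∃ C : NNReal, ∀ s, 0 ≤ s → ∀ (x : H)
    (u : ℝ → U), IsAdmissible s u → cost Y B W R s x u < ⊤ →
    SqInt s u ∧ SqInt s (mildSolution Y B s x u) ∧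
    sqInt s u ≤ C * cost Y B W R s x u ∧
    sqInt s (mildSolution Y B s x u) ≤ C * (‖x‖ₑ ^ 2 + cost Y B W R s x u) ∧
    (∀ t, s ≤ t → ‖mildSolution Y B s x u t‖ₑ ^ 2 ≤ C * (‖x‖ₑ ^ 2 + cost Y B W R s x u)) ∧
    Tendsto (mildSolution Y B s x u) atTop (𝓝 0) := by
  obtain ⟨δ, hδ, hR⟩ := h.R_coer
  obtain ⟨C₁, hC₁⟩ := h.VL_stable.mild_bounds h.VL_pert.1
  obtain ⟨C₂, hC₂⟩ := h.B_meas.exists_sqInt_le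
  obtain ⟨C₃, hC₃⟩ := h.L_meas.neg.exists_sqInt_le
  obtain ⟨c, hc⟩ : ∃ c : NNReal, (c : ENNReal) = ENNReal.ofReal δ⁻¹ :=
    ENNReal.canLift.prf _ (by finiteness)
  set C₄ : NNReal := 2 * (C₂ * c + C₃) with hC₄
  refine ⟨c + C₁ + C₁ * C₄, fun s hs x u hu hcost => ?_⟩
  set J := cost Y B W R s x u with hJ
  set z := mildSolution Y B s x u with hz
  have hW0 : ∀ r, s ≤ r → 0 ≤ RCLike.re (inner 𝕜 (z r) (W r (z r))) := fun r hr =>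
    (h.W_pos r (hs.trans hr)).re_inner_nonneg_right _
  have hu2 : sqInt s u ≤ c * J := by
    rw [hc, hJ, cost, ← lintegral_const_mul' _ _ (by finiteness)]
    refine setLIntegral_mono' measurableSet_Ici fun r hr => ?_
    have h1 := hR r (hs.trans hr) (u r)
    rw [← ENNReal.ofReal_mul (by positivity), ← ofReal_norm, ← ENNReal.ofReal_pow (norm_nonneg _)]
    refine ENNReal.ofReal_le_ofReal ?_
    rw [inv_mul_eq_div, le_div_iff₀ hδ]
    linarith [hW0 r hr]
  have hS2 : sqInt s (fun r => S r (z r)) ≤ J := by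
    refine setLIntegral_mono' measurableSet_Ici fun r hr => ?_
    rw [← ofReal_norm, ← ENNReal.ofReal_pow (norm_nonneg _), (h.sqrt r (hs.trans hr)).norm_sq]
    exact ENNReal.ofReal_le_ofReal (le_add_of_nonneg_right (h.re_R_nonneg (hs.trans hr) _))
  have hui : SqInt s u := sqInt_iff.2 ⟨hu, hu2.trans_lt (by finiteness)⟩
  -- Relative to `VL` the trajectory is driven by `B u - L S z`. The cost controls this forcing in
  -- `L²` before `z` itself is known to be square integrable.
  obtain ⟨hzc, hze⟩ := mild_rebase h.evol (h.L_meas.comp h.S_meas) h.VL_pert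
    h.VL_stable.locallyBounded hs (h.B_meas.sqInt hs hui).locInt x
  have hzm : AEStronglyMeasurable z (volume.restrict (Ici s)) :=
    hzc.aestronglyMeasurable measurableSet_Ici
  have hSi : SqInt s (fun r => S r (z r)) := sqInt_iff.2
    ⟨h.S_meas.aestronglyMeasurable (Ici_subset_Ici.2 hs) hzm, hS2.trans_lt hcost⟩
  set g : ℝ → H := fun r => B r (u r) + -L r (S r (z r)) with hg
  have hgi : SqInt s g := (h.B_meas.sqInt hs hui).add (h.L_meas.neg.sqInt hs hSi)
  have hg2 : sqInt s g ≤ C₄ * J := by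
    refine (sqInt_add_le (h.B_meas.sqInt hs hui).1).trans ?_
    have h1 := hC₂ s hs u
    have h2 := hC₃ s hs fun r => S r (z r)
    simp only [_root_.neg_apply] at h2
    rw [hC₄]
    push_cast
    calc _ ≤ 2 * (C₂ * (c * J) + C₃ * J) := by
          gcongr
          · exact h1.trans (by gcongr)
          · exact h2.trans (by gcongr)
      _ = _ := by ring
  have hzeq : ∀ t, s ≤ t → z t = mild VL g s x t := fun t ht => by
    rw [hz, mildSolution_eq, hze t ht]
    simp [hg, sub_eq_add_neg, hz, mildSolution_eq]
  obtain ⟨hmi, hm2, hmt, hmlim⟩ := hC₁ s hs x g hgi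
  have hae : mild VL g s x =ᵐ[volume.restrict (Ici s)] z :=
    (ae_restrict_iff' measurableSet_Ici).2 (Eventually.of_forall fun t ht => (hzeq t ht).symm)
  have hfin : C₁ * (‖x‖ₑ ^ 2 + sqInt s g) ≤ ((c + C₁ + C₁ * C₄ : NNReal) : ENNReal) *
      (‖x‖ₑ ^ 2 + J) := by
    calc C₁ * (‖x‖ₑ ^ 2 + sqInt s g) ≤ C₁ * (‖x‖ₑ ^ 2 + C₄ * J) := by gcongr
      _ = C₁ * ‖x‖ₑ ^ 2 + C₁ * C₄ * J := by ring
      _ ≤ (c + C₁ + C₁ * C₄) * ‖x‖ₑ ^ 2 + (c + C₁ + C₁ * C₄) * J := by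
        gcongr
        · rw [add_assoc]; exact le_add_self.trans' le_self_add
        · exact le_add_self
      _ = _ := by push_cast; ring
  refine ⟨hui, hmi.ae_eq hae, hu2.trans ?_, ?_, fun t ht => ?_, ?_⟩
  · gcongr
    rw [add_assoc]; exact le_self_add
  · have : sqInt s z = sqInt s (mild VL g s x) :=
      lintegral_congr_ae (hae.mono fun r hr => by simp only [hr])
    rw [this]
    exact hm2.trans hfin
  · rw [hzeq t ht]; exact (hmt t ht).trans hfin
  · refine hmlim.congr' ?_
    filter_upwards [eventually_ge_atTop s] with t ht using (hzeq t ht).symm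

end LQSetting

end

/-! ### The cost as a sesquilinear form on square integrable pairs -/

section

section Lift

variable {𝕜 : Type*} [RCLike 𝕜] {X F : Type*} [NormedAddCommGroup X] [NormedSpace 𝕜 X]
  [NormedAddCommGroup F] [NormedSpace 𝕜 F] {s : ℝ}

lemma Lp_enorm_sq (f : Lp F 2 (volume.restrict (Ici s))) : ‖f‖ₑ ^ 2 = sqInt s f := by
  rw [Lp.enorm_def, eLpNorm_sq_eq_sqInt]

lemma exists_clm_Lp (Φ : X → ℝ → F) (hΦ : ∀ x, SqInt s (Φ x))
    (hadd : ∀ x y, Φ (x + y) =ᵐ[volume.restrict (Ici s)] Φ x + Φ y)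
    (hsmul : ∀ (c : 𝕜) x, Φ (c • x) =ᵐ[volume.restrict (Ici s)] c • Φ x)
    (C : NNReal) (hC : ∀ x, sqInt s (Φ x) ≤ C * ‖x‖ₑ ^ 2) :
    ∃ T : X →L[𝕜] Lp F 2 (volume.restrict (Ici s)),
      ∀ x, T x =ᵐ[volume.restrict (Ici s)] Φ x := by
  let T₀ : X →ₗ[𝕜] Lp F 2 (volume.restrict (Ici s)) :=
    { toFun := fun x => (hΦ x).toLp
      map_add' := fun x y => by
        rw [← MemLp.toLp_add]
        exact MemLp.toLp_congr _ _ (hadd x y)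
      map_smul' := fun c x => by
        simp only [RingHom.id_apply]
        rw [← MemLp.toLp_const_smul]
        exact MemLp.toLp_congr _ _ (hsmul c x) }
  have hco : ∀ x, T₀ x =ᵐ[volume.restrict (Ici s)] Φ x := fun x => (hΦ x).coeFn_toLp
  have hb : ∀ x, ‖T₀ x‖ ≤ √C * ‖x‖ := by
    intro x
    have h1 : ‖T₀ x‖ₑ ^ 2 ≤ C * ‖x‖ₑ ^ 2 := by
      rw [Lp_enorm_sq]
      refine le_trans (le_of_eq ?_) (hC x)
      exact lintegral_congr_ae ((hco x).mono fun r hr => by simp only [hr])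
    rw [← ofReal_norm, ← ofReal_norm, ← ENNReal.ofReal_pow (norm_nonneg _),
      ← ENNReal.ofReal_pow (norm_nonneg _), ← ENNReal.ofReal_coe_nnreal,
      ← ENNReal.ofReal_mul C.coe_nonneg, ENNReal.ofReal_le_ofReal_iff (by positivity)] at h1
    refine le_of_sq_le_sq ?_ (by positivity)
    rwa [mul_pow, Real.sq_sqrt C.coe_nonneg]
  exact ⟨T₀.mkContinuous _ hb, hco⟩

end Lift

variable {𝕜 H U : Type*} [RCLike 𝕜]
  [NormedAddCommGroup H] [InnerProductSpace 𝕜 H] [CompleteSpace H] [NormedSpace ℝ H]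
  [NormedAddCommGroup U] [InnerProductSpace 𝕜 U] [CompleteSpace U]

/-- The sesquilinear running cost of two trajectory-control pairs. -/
def crossCost (W : ℝ → H →L[𝕜] H) (R : ℝ → U →L[𝕜] U) (z : ℝ → H) (u : ℝ → U) (y : ℝ → H)
    (w : ℝ → U) (r : ℝ) : 𝕜 :=
  inner 𝕜 (W r (z r)) (y r) + inner 𝕜 (R r (u r)) (w r)

namespace LQSetting

variable {Y VK VL : ℝ → ℝ → H →L[𝕜] H} {B : ℝ → U →L[𝕜] H} {W S L : ℝ → H →L[𝕜] H}
  {R : ℝ → U →L[𝕜] U} {K : ℝ → H →L[𝕜] U} {s t : ℝ}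

/-- A square integrable control whose trajectory from `x` is square integrable. -/
def IsPair (Y : ℝ → ℝ → H →L[𝕜] H) (B : ℝ → U →L[𝕜] H) (s : ℝ) (x : H) (u : ℝ → U) : Prop :=
  SqInt s u ∧ SqInt s (mildSolution Y B s x u)

lemma _root_.InfiniteLQ.SqInt.integrableOn_inner {E : Type*} [NormedAddCommGroup E]
    [InnerProductSpace 𝕜 E] {f g : ℝ → E} (hf : SqInt s f) (hg : SqInt s g) :
    IntegrableOn (fun r => inner 𝕜 (f r) (g r)) (Ici s) := by
  refine Integrable.mono' (hf.integrable_sq.add hg.integrable_sq) (hf.1.inner hg.1)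
    (Eventually.of_forall fun r => (norm_inner_le_norm _ _).trans ?_)
  simp only [Pi.add_apply]
  nlinarith [sq_nonneg (‖f r‖ - ‖g r‖), sq_nonneg (‖f r‖), sq_nonneg (‖g r‖)]

lemma integrableOn_crossCost (h : LQSetting Y B W R K VK S L VL) (hs : 0 ≤ s) {z y : ℝ → H}
    {u w : ℝ → U} (hz : SqInt s z) (hu : SqInt s u) (hy : SqInt s y) (hw : SqInt s w) :
    IntegrableOn (crossCost W R z u y w) (Ici s) :=
  ((h.W_meas.sqInt hs hz).integrableOn_inner hy).add ((h.R_meas.sqInt hs hu).integrableOn_inner hw)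

lemma continuousOn_mildSolution (h : LQSetting Y B W R K VK S L VL) (hs : 0 ≤ s) {u : ℝ → U}
    (hu : SqInt s u) (x : H) : ContinuousOn (mildSolution Y B s x u) (Ici s) :=
  (mild_rebase h.evol (h.B_meas.comp h.K_meas) h.VK_pert h.VK_stable.locallyBounded hs
    (h.B_meas.sqInt hs hu).locInt x).1

/-- In terms of the stabilized evolution operator, the control is `u - K z`. -/
lemma mildSolution_eq_stabilized (h : LQSetting Y B W R K VK S L VL) (hs : 0 ≤ s) {u : ℝ → U}
    (hu : SqInt s u) (x : H) (hst : s ≤ t) : mildSolution Y B s x u t =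
      mild VK (fun r => B r (u r - K r (mildSolution Y B s x u r))) s x t := by
  have := (mild_rebase h.evol (h.B_meas.comp h.K_meas) h.VK_pert h.VK_stable.locallyBounded hs
    (h.B_meas.sqInt hs hu).locInt x).2 t hst
  rw [mildSolution_eq, this]
  simp only [map_sub, ContinuousLinearMap.comp_apply]

/-- Converse of `mildSolution_eq_stabilized`: any square integrable `v` arises from the control `v +
K z`, so `v` ranges over all of `L²` without constraint. -/
lemma stabilized_eq_mildSolution (h : LQSetting Y B W R K VK S L VL) (hs : 0 ≤ s) {v : ℝ → U}
    (hv : SqInt s v) (x : H) (hst : s ≤ t) : mild VK (fun r => B r (v r)) s x t =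
      mildSolution Y B s x (fun r => v r + K r (mild VK (fun r => B r (v r)) s x r)) t := by
  have := mild_eq_mild_of_perturbed h.evol (h.B_meas.comp h.K_meas) h.VK_pert
    h.VK_stable.locallyBounded hs (h.B_meas.sqInt hs hv).locInt x hst
  rw [this, mildSolution_eq]
  simp only [map_add, ContinuousLinearMap.comp_apply]

/-- The constant does not depend on the initial time; the uniform bound on `P(s)` rests on this. -/
lemma stabilized_bounds (h : LQSetting Y B W R K VK S L VL) : ∃ C : NNReal, ∀ s, 0 ≤ s →
    ∀ (x : H) (v : ℝ → U), SqInt s v → SqInt s (mild VK (fun r => B r (v r)) s x) ∧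
      sqInt s (mild VK (fun r => B r (v r)) s x) ≤ C * (‖x‖ₑ ^ 2 + sqInt s v) ∧
      ∀ t, s ≤ t → ‖mild VK (fun r => B r (v r)) s x t‖ₑ ^ 2 ≤ C * (‖x‖ₑ ^ 2 + sqInt s v) := by
  obtain ⟨C₁, hC₁⟩ := h.VK_stable.mild_bounds h.VK_pert.1
  obtain ⟨C₂, hC₂⟩ := h.B_meas.exists_sqInt_le
  have hle : ∀ s, 0 ≤ s → ∀ (x : H) (v : ℝ → U), C₁ * (‖x‖ₑ ^ 2 + sqInt s fun r => B r (v r)) ≤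
      ((C₁ * (1 + C₂) : NNReal) : ENNReal) * (‖x‖ₑ ^ 2 + sqInt s v) := fun s hs x v => by
    push_cast
    rw [mul_assoc]
    gcongr
    calc _ ≤ 1 * ‖x‖ₑ ^ 2 + C₂ * sqInt s v := by rw [one_mul]; gcongr; exact hC₂ s hs v
      _ ≤ (1 + C₂) * ‖x‖ₑ ^ 2 + (1 + C₂) * sqInt s v := by
        gcongr
        · exact le_self_add
        · exact le_add_self
      _ = _ := by ring
  refine ⟨C₁ * (1 + C₂), fun s hs x v hv => ?_⟩
  obtain ⟨h1, h2, h3, -⟩ := hC₁ s hs x _ (h.B_meas.sqInt hs hv)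
  exact ⟨h1, h2.trans (hle s hs x v), fun t ht => (h3 t ht).trans (hle s hs x v)⟩

lemma mildSolution_congr {u w : ℝ → U} (huw : u =ᵐ[volume.restrict (Ici s)] w) (x : H)
    (hst : s ≤ t) : mildSolution Y B s x u t = mildSolution Y B s x w t := by
  refine mild_congr ?_ x hst
  filter_upwards [ae_restrict_of_ae_restrict_of_subset
    (show Ioc s t ⊆ Ici s from fun r hr => hr.1.le) huw] with r hr
  simp only [hr]

lemma mildSolution_add (h : LQSetting Y B W R K VK S L VL) (hs : 0 ≤ s) (hst : s ≤ t)
    {u w : ℝ → U} (hu : SqInt s u) (hw : SqInt s w) (x y : H) :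
    mildSolution Y B s (x + y) (u + w) t =
      mildSolution Y B s x u t + mildSolution Y B s y w t := by
  have := mild_add h.evol hs hst (h.B_meas.sqInt hs hu).locInt (h.B_meas.sqInt hs hw).locInt x y
  simpa only [mildSolution_eq, Pi.add_apply, map_add] using this

lemma mildSolution_smul (c : 𝕜) (x : H) (u : ℝ → U) :
    mildSolution Y B s (c • x) (c • u) t = c • mildSolution Y B s x u t := by
  have := mild_smul (V := Y) (f := fun r => B r (u r)) (s := s) (t := t) c x
  simpa only [mildSolution_eq, Pi.smul_apply, map_smul] using this

lemma re_crossCost_self (h : LQSetting Y B W R K VK S L VL) {r : ℝ} (hr : 0 ≤ r) (z : ℝ → H)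
    (u : ℝ → U) : RCLike.re (crossCost W R z u z u r) =
      RCLike.re (inner 𝕜 (z r) (W r (z r))) + RCLike.re (inner 𝕜 (u r) (R r (u r))) := by
  rw [crossCost, map_add, (h.W_pos r hr).inner_left_eq_inner_right, h.inner_R hr]

lemma re_crossCost_self_nonneg (h : LQSetting Y B W R K VK S L VL) {r : ℝ} (hr : 0 ≤ r)
    (z : ℝ → H) (u : ℝ → U) : 0 ≤ RCLike.re (crossCost W R z u z u r) := by
  rw [h.re_crossCost_self hr]
  exact add_nonneg ((h.W_pos r hr).re_inner_nonneg_right _) (h.re_R_nonneg hr _)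

/-- For a pair the running cost is integrable, so the extended-real cost becomes the diagonal of a
sesquilinear form and Hilbert space arguments apply. -/
lemma cost_eq (h : LQSetting Y B W R K VK S L VL) (hs : 0 ≤ s) {x : H} {u : ℝ → U}
    (hu : IsPair Y B s x u) : cost Y B W R s x u = ENNReal.ofReal (RCLike.re
      (∫ r in Ici s, crossCost W R (mildSolution Y B s x u) u (mildSolution Y B s x u) u r)) := by
  have hi := h.integrableOn_crossCost hs hu.2 hu.1 hu.2 hu.1
  have hre : RCLike.re
      (∫ r in Ici s, crossCost W R (mildSolution Y B s x u) u (mildSolution Y B s x u) u r) =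
      ∫ r in Ici s, RCLike.re
        (crossCost W R (mildSolution Y B s x u) u (mildSolution Y B s x u) u r) :=
    (integral_re hi).symm
  rw [hre, ofReal_integral_eq_lintegral_ofReal hi.re]
  · refine setLIntegral_congr_fun measurableSet_Ici fun r hr => ?_
    simp only [h.re_crossCost_self (hs.trans hr)]
  · exact (ae_restrict_iff' measurableSet_Ici).2 (Eventually.of_forall fun r hr =>
      h.re_crossCost_self_nonneg (hs.trans hr) _ _)

lemma cost_le (h : LQSetting Y B W R K VK S L VL) : ∃ C : NNReal, ∀ s, 0 ≤ s →
    ∀ (x : H) (u : ℝ → U), SqInt s u →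
      cost Y B W R s x u ≤ C * (sqInt s (mildSolution Y B s x u) + sqInt s u) := by
  obtain ⟨C₁, hC₁⟩ := h.W_meas.exists_bound
  obtain ⟨C₂, hC₂⟩ := h.R_meas.exists_bound
  refine ⟨C₁ + C₂, fun s hs x u hu => ?_⟩
  rw [sqInt, sqInt, ← lintegral_add_right' _ (hu.1.enorm.pow_const 2),
    ← lintegral_const_mul' _ _ (by finiteness), cost]
  refine setLIntegral_mono' measurableSet_Ici fun r hr => ?_
  set z := mildSolution Y B s x u r
  have h1 : RCLike.re (inner 𝕜 z (W r z)) ≤ C₁ * ‖z‖ ^ 2 := by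
    refine (RCLike.re_le_norm _).trans ((norm_inner_le_norm _ _).trans ?_)
    nlinarith [hC₁ r (hs.trans hr) z, norm_nonneg z]
  have h2 : RCLike.re (inner 𝕜 (u r) (R r (u r))) ≤ C₂ * ‖u r‖ ^ 2 := by
    refine (RCLike.re_le_norm _).trans ((norm_inner_le_norm _ _).trans ?_)
    nlinarith [hC₂ r (hs.trans hr) (u r), norm_nonneg (u r)]
  rw [← ofReal_norm, ← ofReal_norm, ← ENNReal.ofReal_pow (norm_nonneg _),
    ← ENNReal.ofReal_pow (norm_nonneg _), ← ENNReal.ofReal_coe_nnreal,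
    ← ENNReal.ofReal_add (by positivity) (by positivity), ← ENNReal.ofReal_mul (by positivity)]
  refine ENNReal.ofReal_le_ofReal ?_
  push_cast
  have : 0 ≤ C₁ * ‖u r‖ ^ 2 + C₂ * ‖z‖ ^ 2 := by positivity
  nlinarith

lemma IsPair.cost_lt_top (h : LQSetting Y B W R K VK S L VL) (hs : 0 ≤ s) {x : H} {u : ℝ → U}
    (hu : IsPair Y B s x u) : cost Y B W R s x u < ⊤ := by
  rw [h.cost_eq hs hu]; exact ENNReal.ofReal_lt_top

/-- The feedback control `K` gives finite cost. -/
lemma exists_feedback (h : LQSetting Y B W R K VK S L VL) : ∃ C : NNReal, ∀ s, 0 ≤ s → ∀ x : H,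
    IsPair Y B s x (fun r => K r (VK r s x)) ∧
    (∀ t, s ≤ t → mildSolution Y B s x (fun r => K r (VK r s x)) t = VK t s x) ∧
    cost Y B W R s x (fun r => K r (VK r s x)) ≤ C * ‖x‖ₑ ^ 2 ∧
    (∀ t, s ≤ t → ‖VK t s x‖ₑ ^ 2 ≤ C * ‖x‖ₑ ^ 2) := by
  obtain ⟨C₁, hC₁⟩ := h.stabilized_bounds
  obtain ⟨C₂, hC₂⟩ := h.cost_le
  obtain ⟨C₃, hC₃⟩ := h.K_meas.exists_sqInt_le
  refine ⟨C₂ * (C₁ + C₃ * C₁) + C₁, fun s hs x => ?_⟩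
  -- The feedback control is the choice `v = 0` in the stabilized variables.
  have h0 : SqInt s (fun _ : ℝ => (0 : U)) := MemLp.zero'
  have hm : mild VK (fun r => B r ((fun _ : ℝ => (0 : U)) r)) s x = fun t => VK t s x := by
    ext t; simp [mild]
  have hsq0 : sqInt s (fun _ : ℝ => (0 : U)) = 0 := by simp [sqInt]
  obtain ⟨h1, h2, h3⟩ := hC₁ s hs x _ h0
  rw [hm] at h1 h2
  rw [hsq0, add_zero] at h2 h3
  simp only [hm] at h3
  have heq : ∀ t, s ≤ t → mildSolution Y B s x (fun r => K r (VK r s x)) t = VK t s x := by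
    intro t ht
    have := h.stabilized_eq_mildSolution hs h0 x ht
    rw [hm] at this
    simpa using this.symm
  have hae : (fun t => VK t s x) =ᵐ[volume.restrict (Ici s)]
      mildSolution Y B s x (fun r => K r (VK r s x)) :=
    (ae_restrict_iff' measurableSet_Ici).2 (Eventually.of_forall fun t ht => (heq t ht).symm)
  have hK := h.K_meas.sqInt hs h1
  have hsq : sqInt s (mildSolution Y B s x (fun r => K r (VK r s x))) =
      sqInt s (fun t => VK t s x) :=
    lintegral_congr_ae (hae.mono fun r hr => by simp only [hr])
  refine ⟨⟨hK, h1.ae_eq hae⟩, heq, ?_, fun t ht => (h3 t ht).trans ?_⟩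
  · refine (hC₂ s hs x _ hK).trans ?_
    rw [hsq]
    calc _ ≤ C₂ * (C₁ * ‖x‖ₑ ^ 2 + C₃ * (C₁ * ‖x‖ₑ ^ 2)) := by
          gcongr; exact (hC₃ s hs _).trans (by gcongr)
      _ = (C₂ * (C₁ + C₃ * C₁) : NNReal) * ‖x‖ₑ ^ 2 := by push_cast; ring
      _ ≤ _ := by gcongr; exact le_self_add
  · gcongr; exact le_add_self

end LQSetting

end

/-! ### Minimisation over `L²` -/

section

section Multiplication

variable {𝕜 : Type*} [RCLike 𝕜] {E F : Type*} [NormedAddCommGroup E] [NormedSpace 𝕜 E]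
  [NormedAddCommGroup F] [NormedSpace 𝕜 F] {s : ℝ}

/-- Multiplication by a bounded measurable family of operators as an operator on `L²(s, ∞)`. -/
lemma IsBoundedMeasurableFamily.exists_mulLp {D : ℝ → E →L[𝕜] F}
    (hD : IsBoundedMeasurableFamily D) (hs : 0 ≤ s) :
    ∃ T : Lp E 2 (volume.restrict (Ici s)) →L[𝕜] Lp F 2 (volume.restrict (Ici s)),
      ∀ f, T f =ᵐ[volume.restrict (Ici s)] fun r => D r (f r) := by
  obtain ⟨C, hC⟩ := hD.exists_sqInt_le
  refine exists_clm_Lp (fun (f : Lp E 2 (volume.restrict (Ici s))) r => D r (f r))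
    (fun f => hD.sqInt hs (Lp.memLp f)) (fun f g => ?_)
    (fun c f => ?_) C fun f => ?_
  · filter_upwards [Lp.coeFn_add f g] with r hr
    rw [Pi.add_apply, hr, Pi.add_apply, map_add]
  · filter_upwards [Lp.coeFn_smul c f] with r hr
    rw [Pi.smul_apply, hr, Pi.smul_apply, map_smul]
  · rw [Lp_enorm_sq]; exact hC s hs f

end Multiplication

variable {𝕜 H U : Type*} [RCLike 𝕜]
  [NormedAddCommGroup H] [InnerProductSpace 𝕜 H] [CompleteSpace H] [NormedSpace ℝ H]
  [NormedAddCommGroup U] [InnerProductSpace 𝕜 U] [CompleteSpace U]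

namespace LQSetting

variable {Y VK VL : ℝ → ℝ → H →L[𝕜] H} {B : ℝ → U →L[𝕜] H} {W S L : ℝ → H →L[𝕜] H}
  {R : ℝ → U →L[𝕜] U} {K : ℝ → H →L[𝕜] U} {s t : ℝ}

/-- Stability of `VK` makes the trajectory map bounded in the variable `v`; in the raw control it
need not even take values in `L²`. The factor 2 in its bound comes from the maximum norm on the
product. -/
lemma exists_stabilizedLp (h : LQSetting Y B W R K VK S L VL) (hs : 0 ≤ s) :
    ∃ T : (H × Lp U 2 (volume.restrict (Ici s))) →L[𝕜] Lp H 2 (volume.restrict (Ici s)),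
      ∀ p, T p =ᵐ[volume.restrict (Ici s)] mild VK (fun r => B r (p.2 r)) s p.1 := by
  obtain ⟨C, hC⟩ := h.stabilized_bounds
  have hp : ∀ p : H × Lp U 2 (volume.restrict (Ici s)), LocInt s fun r => B r (p.2 r) :=
    fun p => (h.B_meas.sqInt hs (Lp.memLp p.2)).locInt
  have hae : ∀ {f g : ℝ → H}, (∀ t, s ≤ t → f t = g t) → f =ᵐ[volume.restrict (Ici s)] g :=
    fun hfg => (ae_restrict_iff' measurableSet_Ici).2 (Eventually.of_forall hfg)
  have hsub : ∀ t, Ioc s t ⊆ Ici s := fun t r hr => hr.1.le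
  refine exists_clm_Lp _ (fun p => (hC s hs p.1 p.2 (Lp.memLp p.2)).1) (fun p q => hae fun t ht => ?_)
    (fun c p => hae fun t ht => ?_) (2 * C) fun p => ?_
  · simp only [Pi.add_apply]
    rw [← mild_add h.VK_pert.1 hs ht (hp p) (hp q)]
    refine mild_congr ?_ _ ht
    filter_upwards [ae_restrict_of_ae_restrict_of_subset (hsub t) (Lp.coeFn_add p.2 q.2)] with r hr
    rw [Prod.snd_add, hr, Pi.add_apply, map_add]
  · simp only [Pi.smul_apply]
    rw [← mild_smul]
    refine mild_congr ?_ _ ht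
    filter_upwards [ae_restrict_of_ae_restrict_of_subset (hsub t) (Lp.coeFn_smul c p.2)] with r hr
    rw [Prod.smul_snd, hr, Pi.smul_apply, map_smul]
  · refine (hC s hs p.1 p.2 (Lp.memLp p.2)).2.1.trans ?_
    rw [← Lp_enorm_sq]
    push_cast
    rw [mul_comm 2, mul_assoc, two_mul]
    gcongr
    · rw [← ofReal_norm, ← ofReal_norm]; exact ENNReal.ofReal_le_ofReal (norm_fst_le p)
    · rw [← ofReal_norm, ← ofReal_norm]; exact ENNReal.ofReal_le_ofReal (norm_snd_le p)

/-- Existence of optimal pairs depending linearly on the initial state, and of the operator that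
represents the cost. -/
lemma exists_optimal (h : LQSetting Y B W R K VK S L VL) (hs : 0 ≤ s) :
    ∃ (P : H →L[𝕜] H) (u : H → ℝ → U), (∀ x, IsPair Y B s x (u x)) ∧
      (∀ x y, u (x + y) =ᵐ[volume.restrict (Ici s)] u x + u y) ∧
      (∀ (c : 𝕜) x, u (c • x) =ᵐ[volume.restrict (Ici s)] c • u x) ∧
      ∀ x y w, IsPair Y B s y w →
        ∫ r in Ici s, crossCost W R (mildSolution Y B s x (u x)) (u x) (mildSolution Y B s y w) w r
          = inner 𝕜 (P x) y := by
  obtain ⟨T, hT⟩ := h.exists_stabilizedLp hs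
  obtain ⟨Wm, hWm⟩ := h.W_meas.exists_mulLp hs
  obtain ⟨Rm, hRm⟩ := h.R_meas.exists_mulLp hs
  obtain ⟨Km, hKm⟩ := h.K_meas.exists_mulLp hs
  let N : (H × Lp U 2 (volume.restrict (Ici s))) →L[𝕜] Lp U 2 (volume.restrict (Ici s)) := ContinuousLinearMap.snd 𝕜 H _ + Km ∘L T
  have hae : ∀ {f g : ℝ → H}, (∀ t, s ≤ t → f t = g t) → f =ᵐ[volume.restrict (Ici s)] g :=
    fun hfg => (ae_restrict_iff' measurableSet_Ici).2 (Eventually.of_forall hfg)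
  have hN : ∀ p, N p =ᵐ[volume.restrict (Ici s)]
      fun r => p.2 r + K r (mild VK (fun r => B r (p.2 r)) s p.1 r) := fun p => by
    filter_upwards [Lp.coeFn_add p.2 (Km (T p)), hKm (T p), hT p] with r h1 h2 h3
    change (p.2 + Km (T p)) r = _
    rw [h1, Pi.add_apply, h2, h3]
  have hTN : ∀ p, mildSolution Y B s p.1 (N p) =ᵐ[volume.restrict (Ici s)] T p := fun p => by
    refine (hae fun t ht => ?_).trans (hT p).symm
    rw [mildSolution_congr (hN p) _ ht, ← h.stabilized_eq_mildSolution hs (Lp.memLp p.2) _ ht]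
  have hpair : ∀ p, IsPair Y B s p.1 (N p) := fun p =>
    ⟨Lp.memLp _, (Lp.memLp (T p)).ae_eq (hTN p).symm⟩
  -- `N` rebuilds the control `v + K z`, and every pair is reached, by `v = w - K z`.
  have hconv : ∀ y w, IsPair Y B s y w → ∃ v : Lp U 2 (volume.restrict (Ici s)), N (y, v) =ᵐ[volume.restrict (Ici s)] w := by
    intro y w hw
    have hv : SqInt s (fun r => w r - K r (mildSolution Y B s y w r)) :=
      hw.1.sub (h.K_meas.sqInt hs hw.2)
    refine ⟨hv.toLp, (hN _).trans ?_⟩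
    filter_upwards [hv.coeFn_toLp, ae_restrict_mem measurableSet_Ici] with r hr hrs
    have h1 : mild VK (fun r => B r ((hv.toLp : Lp U 2 (volume.restrict (Ici s))) r)) s y r = mildSolution Y B s y w r := by
      rw [h.mildSolution_eq_stabilized hs hw.1 y hrs]
      refine mild_congr ?_ _ hrs
      filter_upwards [ae_restrict_of_ae_restrict_of_subset
        (show Ioc s r ⊆ Ici s from fun r hr => hr.1.le) hv.coeFn_toLp] with r' hr'
      rw [hr']
    simp only [h1, hr, sub_add_cancel]
  have hform : ∀ p y w q, N q =ᵐ[volume.restrict (Ici s)] w → q.1 = y →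
      ∫ r in Ici s, crossCost W R (mildSolution Y B s p.1 (N p)) (N p) (mildSolution Y B s y w) w r
        = inner 𝕜 (Wm (T p)) (T q) + inner 𝕜 (Rm (N p)) (N q) := by
    rintro p y w q hw rfl
    rw [L2.inner_def, L2.inner_def, ← integral_add (L2.integrable_inner _ _)
      (L2.integrable_inner _ _)]
    refine integral_congr_ae ?_
    have h4 : mildSolution Y B s q.1 w =ᵐ[volume.restrict (Ici s)] T q :=
      (hae fun t ht => mildSolution_congr hw.symm _ ht).trans (hTN q)
    filter_upwards [hWm (T p), hRm (N p), hTN p, h4, hw] with r e1 e2 e3 e4 e5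
    rw [crossCost, e1, e2, e3, e4, e5]
  let Z : Lp U 2 (volume.restrict (Ici s)) →L[𝕜] Lp H 2 (volume.restrict (Ici s)) := T ∘L ContinuousLinearMap.inr 𝕜 H _
  let X : H →L[𝕜] Lp H 2 (volume.restrict (Ici s)) := T ∘L ContinuousLinearMap.inl 𝕜 H _
  let Nv : Lp U 2 (volume.restrict (Ici s)) →L[𝕜] Lp U 2 (volume.restrict (Ici s)) := N ∘L ContinuousLinearMap.inr 𝕜 H _
  let Nx : H →L[𝕜] Lp U 2 (volume.restrict (Ici s)) := N ∘L ContinuousLinearMap.inl 𝕜 H _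
  have hTsplit : ∀ x v, T (x, v) = X x + Z v := fun x v => by
    change _ = T (x, 0) + T (0, v)
    rw [← map_add]; simp
  have hNsplit : ∀ x v, N (x, v) = Nx x + Nv v := fun x v => by
    change _ = N (x, 0) + N (0, v)
    rw [← map_add]; simp
  -- The Hessian of the cost in `v`. It is coercive because, from the initial state 0, `detect`
  -- bounds both `u` and `z` in `L²` by the cost, and `v = u - K z`.
  let A : Lp U 2 (volume.restrict (Ici s)) →L[𝕜] Lp U 2 (volume.restrict (Ici s)) := ContinuousLinearMap.adjoint Z ∘L Wm ∘L Z +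
    ContinuousLinearMap.adjoint Nv ∘L Rm ∘L Nv
  have hA : ∀ v w, inner 𝕜 (A v) w = inner 𝕜 (Wm (Z v)) (Z w) + inner 𝕜 (Rm (Nv v)) (Nv w) :=
    fun v w => by
      simp only [A, _root_.add_apply, ContinuousLinearMap.comp_apply, inner_add_left,
        ContinuousLinearMap.adjoint_inner_left]
  have hAunit : IsUnit A := by
    obtain ⟨C₁, hC₁⟩ := h.detect
    obtain ⟨C₂, hC₂⟩ := h.K_meas.neg.exists_sqInt_le
    set C : NNReal := 2 * (C₁ + C₂ * C₁) + 1 with hC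
    have hCpos : (0 : ℝ) < C := by rw [hC]; positivity
    refine isUnit_of_coercive (δ := (C : ℝ)⁻¹) (by positivity) fun v => ?_
    have hp := hpair (0, v)
    obtain ⟨-, -, h1, h2, -⟩ := hC₁ s hs 0 _ hp.1.1 (hp.cost_lt_top h hs)
    set J := cost Y B W R s 0 (N (0, v)) with hJ
    rw [enorm_zero, zero_pow two_ne_zero, zero_add] at h2
    have hv : ‖v‖ₑ ^ 2 ≤ C * J := by
      rw [Lp_enorm_sq]
      have h3 : sqInt s v = sqInt s (fun r => N (0, v) r +
          -K r (mildSolution Y B s 0 (N (0, v)) r)) := by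
        refine lintegral_congr_ae ?_
        filter_upwards [hN (0, v), hTN (0, v), hT (0, v)] with r e1 e2 e3
        rw [e1, e2, e3, add_neg_cancel_right]
      rw [h3]
      refine (sqInt_add_le hp.1.1).trans ?_
      have h4 : sqInt s (fun r => -K r (mildSolution Y B s 0 (N (0, v)) r)) ≤
          C₂ * sqInt s (mildSolution Y B s 0 (N (0, v))) := hC₂ s hs _
      calc _ ≤ 2 * (C₁ * J + C₂ * (C₁ * J)) := by
            gcongr
            exact h4.trans (by gcongr)
        _ = (2 * (C₁ + C₂ * C₁) : NNReal) * J := by push_cast; ring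
        _ ≤ _ := by gcongr; exact le_self_add
    have hJr : J = ENNReal.ofReal (RCLike.re (inner 𝕜 (A v) v)) := by
      rw [hJ, h.cost_eq hs hp, hform (0, v) 0 _ (0, v) (ae_eq_refl _) rfl, hA]
      rfl
    rw [hJr, ← ofReal_norm, ← ENNReal.ofReal_pow (norm_nonneg _), ← ENNReal.ofReal_coe_nnreal,
      ← ENNReal.ofReal_mul C.coe_nonneg] at hv
    rw [inv_mul_le_iff₀ hCpos, ← inner_conj_symm, RCLike.conj_re]
    rcases le_or_gt (C * RCLike.re (inner 𝕜 (A v) v)) 0 with h0 | h0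
    · rw [ENNReal.ofReal_of_nonpos h0] at hv
      have h5 : ‖v‖ ^ 2 ≤ 0 := ENNReal.ofReal_eq_zero.1 (le_antisymm hv zero_le)
      have h6 : v = 0 := by
        rw [← norm_eq_zero]
        exact pow_eq_zero_iff two_ne_zero |>.1 (le_antisymm h5 (sq_nonneg _))
      simp [h6]
    · exact (ENNReal.ofReal_le_ofReal_iff h0.le).1 hv
  -- The mixed term in `x` and `v`; the Euler equation is `A v + G x = 0`.
  let G : H →L[𝕜] Lp U 2 (volume.restrict (Ici s)) := ContinuousLinearMap.adjoint Z ∘L Wm ∘L X +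
    ContinuousLinearMap.adjoint Nv ∘L Rm ∘L Nx
  let vopt : H →L[𝕜] Lp U 2 (volume.restrict (Ici s)) := -(A.inverse ∘L G)
  let p : H →L[𝕜] (H × Lp U 2 (volume.restrict (Ici s))) := (ContinuousLinearMap.id 𝕜 H).prod vopt
  have horth : ∀ x w, inner 𝕜 (Wm (T (p x))) (Z w) + inner 𝕜 (Rm (N (p x))) (Nv w) = 0 := by
    intro x w
    have h1 : p x = (x, vopt x) := rfl
    have h2 : A (vopt x) = - G x := by
      change A (-(A.inverse (G x))) = _
      rw [map_neg, apply_inverse_of_isUnit hAunit]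
    have h3 := hA (vopt x) w
    rw [h2, inner_neg_left] at h3
    have h4 : inner 𝕜 (G x) w = inner 𝕜 (Wm (X x)) (Z w) + inner 𝕜 (Rm (Nx x)) (Nv w) := by
      simp only [G, _root_.add_apply, ContinuousLinearMap.comp_apply, inner_add_left,
        ContinuousLinearMap.adjoint_inner_left]
    rw [h1, hTsplit, hNsplit, map_add, map_add, inner_add_left, inner_add_left]
    rw [h4] at h3
    linear_combination -h3
  -- By orthogonality only the part of the test pair due to its initial state contributes, hence the
  -- adjoints of `X` and `Nx`.
  refine ⟨ContinuousLinearMap.adjoint X ∘L Wm ∘L T ∘L p +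
    ContinuousLinearMap.adjoint Nx ∘L Rm ∘L N ∘L p, fun x => N (p x), fun x => hpair (p x),
    fun x y => ?_, fun c x => ?_, fun x y w hw => ?_⟩
  · simp only [map_add]; exact Lp.coeFn_add _ _
  · simp only [map_smul]; exact Lp.coeFn_smul _ _
  · obtain ⟨v, hv⟩ := hconv y w hw
    refine (hform (p x) y w (y, v) hv rfl).trans ?_
    rw [hTsplit y, hNsplit y, inner_add_right, inner_add_right,
      add_add_add_comm, horth, add_zero]
    simp only [_root_.add_apply, ContinuousLinearMap.comp_apply, inner_add_left,
      ContinuousLinearMap.adjoint_inner_left]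

end LQSetting

end

/-! ### Optimal pairs: uniqueness, dynamic programming, splitting of the cost -/

section

variable {𝕜 H U : Type*} [RCLike 𝕜]
  [NormedAddCommGroup H] [InnerProductSpace 𝕜 H] [CompleteSpace H] [NormedSpace ℝ H]
  [NormedAddCommGroup U] [InnerProductSpace 𝕜 U] [CompleteSpace U]

lemma norm_le_of_enorm_sq_le {E F : Type*} [NormedAddCommGroup E] [NormedAddCommGroup F]
    {C : NNReal} {a : E} {b : F} (h : ‖a‖ₑ ^ 2 ≤ C * ‖b‖ₑ ^ 2) : ‖a‖ ≤ √C * ‖b‖ := by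
  rw [← ofReal_norm, ← ofReal_norm, ← ENNReal.ofReal_pow (norm_nonneg _),
    ← ENNReal.ofReal_pow (norm_nonneg _), ← ENNReal.ofReal_coe_nnreal,
    ← ENNReal.ofReal_mul C.coe_nonneg, ENNReal.ofReal_le_ofReal_iff (by positivity)] at h
  refine le_of_sq_le_sq ?_ (by positivity)
  rwa [mul_pow, Real.sq_sqrt C.coe_nonneg]

/-- Cauchy–Schwarz against 1. Controls are only square integrable, so their effect over a short
interval is of order `√(t - s)`. -/
lemma integral_norm_le_of_sqInt_le {E F : Type*} [NormedAddCommGroup E] [NormedAddCommGroup F]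
    {C : NNReal} {s t : ℝ} (hst : s ≤ t) {f : ℝ → E} {b : F} (hf : SqInt s f)
    (h : sqInt s f ≤ C * ‖b‖ₑ ^ 2) : ∫ r in s..t, ‖f r‖ ≤ √(t - s) * (√C * ‖b‖) := by
  have h1 : (∫⁻ r in Ioc s t, ‖f r‖ₑ) ^ 2 ≤ ENNReal.ofReal (t - s) * (C * ‖b‖ₑ ^ 2) := by
    have h2 := lintegral_mul_sq_le (μ := volume.restrict (Ioc s t)) (f := fun _ => 1)
      (g := fun r => ‖f r‖ₑ) aemeasurable_const
      (hf.1.mono_set (show Ioc s t ⊆ Ici s from fun r hr => hr.1.le)).enorm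
    simp only [one_mul, one_pow, lintegral_one, Measure.restrict_apply_univ, Real.volume_Ioc] at h2
    refine h2.trans (mul_le_mul' le_rfl (le_trans ?_ h))
    exact lintegral_mono' (Measure.restrict_mono
      (show Ioc s t ⊆ Ici s from fun r hr => hr.1.le) le_rfl) le_rfl
  have h3 : ENNReal.ofReal (∫ r in s..t, ‖f r‖) = ∫⁻ r in Ioc s t, ‖f r‖ₑ := by
    rw [intervalIntegral.integral_of_le hst,
      ofReal_integral_eq_lintegral_ofReal (hf.locInt t).norm
        (Eventually.of_forall fun r => norm_nonneg _)]
    simp only [ofReal_norm]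
  have h0 : 0 ≤ ∫ r in s..t, ‖f r‖ :=
    intervalIntegral.integral_nonneg hst fun r _ => norm_nonneg _
  have hts : 0 ≤ t - s := sub_nonneg.2 hst
  rw [← h3, ← ofReal_norm, ← ENNReal.ofReal_pow h0, ← ENNReal.ofReal_pow (norm_nonneg _),
    ← ENNReal.ofReal_coe_nnreal, ← ENNReal.ofReal_mul C.coe_nonneg, ← ENNReal.ofReal_mul hts,
    ENNReal.ofReal_le_ofReal_iff (by positivity)] at h1
  refine le_of_sq_le_sq ?_ (by positivity)
  rwa [mul_pow, mul_pow, Real.sq_sqrt hts, Real.sq_sqrt C.coe_nonneg]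

/-- Strong continuity of an evolution operator across the diagonal. -/
lemma IsEvolutionOperator.tendsto_diagonal {V : ℝ → ℝ → H →L[𝕜] H} (hV : IsEvolutionOperator V)
    {s₀ : ℝ} (hs₀ : 0 ≤ s₀) (x : H) :
    Tendsto (fun s => V (max s s₀) (min s s₀) x) (𝓝[Ici 0] s₀) (𝓝 x) := by
  have hsplit : Ici (0 : ℝ) = Icc 0 s₀ ∪ Ici s₀ := by
    ext r; simp only [mem_Ici, mem_union, mem_Icc]
    constructor
    · intro h; rcases le_total r s₀ with h' | h'
      · exact Or.inl ⟨h, h'⟩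
      · exact Or.inr h'
    · rintro (h | h)
      · exact h.1
      · exact hs₀.trans h
  rw [hsplit, nhdsWithin_union, tendsto_sup]
  have hself : V s₀ s₀ x = x := by rw [hV.self s₀ hs₀]; rfl
  constructor
  · have := hV.continuousOn_right s₀ hs₀ x s₀ ⟨hs₀, le_rfl⟩
    rw [ContinuousWithinAt, hself] at this
    refine this.congr' ?_
    filter_upwards [self_mem_nhdsWithin] with r hr
    rw [max_eq_right hr.2, min_eq_left hr.2]
  · have := hV.continuousOn_left s₀ hs₀ x s₀ (mem_Ici.2 le_rfl)
    rw [ContinuousWithinAt, hself] at this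
    refine this.congr' ?_
    filter_upwards [self_mem_nhdsWithin] with r hr
    rw [max_eq_left hr, min_eq_right hr]

namespace LQSetting

variable {Y VK VL : ℝ → ℝ → H →L[𝕜] H} {B : ℝ → U →L[𝕜] H} {W S L : ℝ → H →L[𝕜] H}
  {R : ℝ → U →L[𝕜] U} {K : ℝ → H →L[𝕜] U} {s t : ℝ}

/-- A family of optimal controls, linear in the initial state, with the operators representing
the optimal cost. -/
structure IsOptimalFamily (Y : ℝ → ℝ → H →L[𝕜] H) (B : ℝ → U →L[𝕜] H) (W : ℝ → H →L[𝕜] H)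
    (R : ℝ → U →L[𝕜] U) (P : ℝ → H →L[𝕜] H) (u : ℝ → H → ℝ → U) : Prop where
  pair : ∀ s, 0 ≤ s → ∀ x, IsPair Y B s x (u s x)
  add : ∀ s, 0 ≤ s → ∀ x y, u s (x + y) =ᵐ[volume.restrict (Ici s)] u s x + u s y
  smul : ∀ s, 0 ≤ s → ∀ (c : 𝕜) x, u s (c • x) =ᵐ[volume.restrict (Ici s)] c • u s x
  repr : ∀ s, 0 ≤ s → ∀ x y w, IsPair Y B s y w →
    ∫ r in Ici s, crossCost W R (mildSolution Y B s x (u s x)) (u s x) (mildSolution Y B s y w) w r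
      = inner 𝕜 (P s x) y

lemma exists_optimalFamily (h : LQSetting Y B W R K VK S L VL) :
    ∃ P u, IsOptimalFamily Y B W R P u := by
  have := fun s : {s : ℝ // 0 ≤ s} => h.exists_optimal s.2
  choose P u h1 h2 h3 h4 using this
  refine ⟨fun s => if hs : 0 ≤ s then P ⟨s, hs⟩ else 0, fun s => if hs : 0 ≤ s then u ⟨s, hs⟩ else 0,
    fun s hs => ?_, fun s hs => ?_, fun s hs => ?_, fun s hs => ?_⟩ <;> simp only [hs, dif_pos]
  · exact h1 ⟨s, hs⟩
  · exact h2 ⟨s, hs⟩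
  · exact h3 ⟨s, hs⟩
  · exact h4 ⟨s, hs⟩

variable {P : ℝ → H →L[𝕜] H} {u : ℝ → H → ℝ → U}

lemma crossCost_symm (h : LQSetting Y B W R K VK S L VL) {r : ℝ} (hr : 0 ≤ r) (z y : ℝ → H)
    (u w : ℝ → U) : starRingEnd 𝕜 (crossCost W R z u y w r) = crossCost W R y w z u r := by
  rw [crossCost, crossCost, map_add, inner_conj_symm, inner_conj_symm,
    (h.W_pos r hr).inner_left_eq_inner_right, h.inner_R hr]

lemma P_isPositive (h : LQSetting Y B W R K VK S L VL) (hP : IsOptimalFamily Y B W R P u)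
    (hs : 0 ≤ s) : (P s).IsPositive := by
  have hself := fun x => hP.repr s hs x x _ (hP.pair s hs x)
  refine ⟨fun x y => ?_, fun x => ?_⟩
  · have h1 := hP.repr s hs x y _ (hP.pair s hs y)
    have h2 := hP.repr s hs y x _ (hP.pair s hs x)
    change inner 𝕜 (P s x) y = inner 𝕜 x (P s y)
    rw [← h1, ← inner_conj_symm x, ← h2, ← integral_conj]
    refine setIntegral_congr_fun measurableSet_Ici fun r hr => ?_
    exact (h.crossCost_symm (hs.trans hr) _ _ _ _).symm
  · rw [ContinuousLinearMap.reApplyInnerSelf, ← hself]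
    have hp := hP.pair s hs x
    have hre := integral_re (𝕜 := 𝕜) (h.integrableOn_crossCost hs hp.2 hp.1 hp.2 hp.1)
    refine le_trans ?_ (le_of_eq hre)
    exact setIntegral_nonneg measurableSet_Ici fun r hr =>
      h.re_crossCost_self_nonneg (hs.trans hr) _ _

lemma cost_optimal (h : LQSetting Y B W R K VK S L VL) (hP : IsOptimalFamily Y B W R P u)
    (hs : 0 ≤ s) (x : H) :
    cost Y B W R s x (u s x) = ENNReal.ofReal (RCLike.re (inner 𝕜 (P s x) x)) := by
  rw [h.cost_eq hs (hP.pair s hs x), hP.repr s hs x x _ (hP.pair s hs x)]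

lemma crossCost_add_ge (h : LQSetting Y B W R K VK S L VL) {r : ℝ} (hr : 0 ≤ r) (z y : ℝ → H)
    (u w : ℝ → U) : 2 * RCLike.re (crossCost W R z u y w r) ≤
      RCLike.re (crossCost W R z u z u r) + RCLike.re (crossCost W R y w y w r) := by
  have h1 := h.re_crossCost_self_nonneg hr (z - y) (u - w)
  have h2 := congrArg RCLike.re (h.crossCost_symm hr z y u w)
  rw [RCLike.conj_re] at h2
  have h3 : crossCost W R (z - y) (u - w) (z - y) (u - w) r = crossCost W R z u z u r -
      crossCost W R z u y w r - crossCost W R y w z u r + crossCost W R y w y w r := by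
    simp only [crossCost, Pi.sub_apply, map_sub, inner_sub_left, inner_sub_right]
    ring
  rw [h3] at h1
  simp only [map_add, map_sub] at h1
  linarith

/-- The optimal pair has the same cross cost `(P x, x)` with every pair from `x` as with itself; the
polarised inequality `crossCost_add_ge` then gives minimality. -/
lemma cost_optimal_le (h : LQSetting Y B W R K VK S L VL) (hP : IsOptimalFamily Y B W R P u)
    (hs : 0 ≤ s) {x : H} {w : ℝ → U} (hw : IsPair Y B s x w) :
    cost Y B W R s x (u s x) ≤ cost Y B W R s x w := by
  have hp := hP.pair s hs x
  have i1 := h.integrableOn_crossCost hs hp.2 hp.1 hp.2 hp.1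
  have i2 := h.integrableOn_crossCost hs hp.2 hp.1 hw.2 hw.1
  have i3 := h.integrableOn_crossCost hs hw.2 hw.1 hw.2 hw.1
  rw [h.cost_eq hs hp, h.cost_eq hs hw]
  refine ENNReal.ofReal_le_ofReal ?_
  have e1 := hP.repr s hs x x _ hp
  have e2 := hP.repr s hs x x _ hw
  have r1 := integral_re (𝕜 := 𝕜) i1
  have r2 := integral_re (𝕜 := 𝕜) i2
  have r3 := integral_re (𝕜 := 𝕜) i3
  have hle : ∫ r in Ici s, 2 * RCLike.re (crossCost W R (mildSolution Y B s x (u s x)) (u s x)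
      (mildSolution Y B s x w) w r) ≤ ∫ r in Ici s, (RCLike.re (crossCost W R
        (mildSolution Y B s x (u s x)) (u s x) (mildSolution Y B s x (u s x)) (u s x) r) +
        RCLike.re (crossCost W R (mildSolution Y B s x w) w (mildSolution Y B s x w) w r)) :=
    setIntegral_mono_on (i2.re.const_mul 2) (i1.re.add i3.re) measurableSet_Ici fun r hr =>
      h.crossCost_add_ge (hs.trans hr) _ _ _ _
  rw [integral_const_mul, integral_add i1.re i3.re, r1, r2, r3, e1, e2] at hle
  rw [e1]
  linarith

/-- Uniform bounds for optimal pairs. -/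
lemma optimal_bounds (h : LQSetting Y B W R K VK S L VL) (hP : IsOptimalFamily Y B W R P u) :
    ∃ C : NNReal, ∀ s, 0 ≤ s → ∀ x, sqInt s (u s x) ≤ C * ‖x‖ₑ ^ 2 ∧
      (∀ t, s ≤ t → ‖mildSolution Y B s x (u s x) t‖ ≤ C * ‖x‖) ∧
      RCLike.re (inner 𝕜 (P s x) x) ≤ C * ‖x‖ ^ 2 := by
  obtain ⟨C₁, hC₁⟩ := h.exists_feedback
  obtain ⟨C₂, hC₂⟩ := h.detect
  set C₃ := C₂ * (1 + C₁) with hC₃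
  -- `C₃` serves the control in `L²`, `√C₃` the norm of the trajectory, `C₁` the quadratic form.
  refine ⟨C₁ + C₃ + NNReal.sqrt C₃, fun s hs x => ?_⟩
  have hp := hP.pair s hs x
  obtain ⟨hf, -, hfc, -⟩ := hC₁ s hs x
  have hc := (h.cost_optimal_le hP hs hf).trans hfc
  obtain ⟨-, -, h1, -, h2, -⟩ := hC₂ s hs x _ hp.1.1 (hp.cost_lt_top h hs)
  have h0 : C₂ * (‖x‖ₑ ^ 2 + cost Y B W R s x (u s x)) ≤ C₃ * ‖x‖ₑ ^ 2 := by
    rw [hC₃]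
    push_cast
    calc _ ≤ C₂ * (‖x‖ₑ ^ 2 + C₁ * ‖x‖ₑ ^ 2) := by gcongr
      _ = _ := by ring
  refine ⟨?_, fun t ht => ?_, ?_⟩
  · calc _ ≤ C₂ * (‖x‖ₑ ^ 2 + cost Y B W R s x (u s x)) :=
          h1.trans (mul_le_mul' le_rfl le_add_self)
      _ ≤ _ := h0
      _ ≤ _ := by
        gcongr
        rw [add_assoc]
        exact le_add_self.trans' le_self_add
  · refine (norm_le_of_enorm_sq_le ((h2 t ht).trans h0)).trans ?_
    gcongr
    push_cast
    have : (0 : ℝ) ≤ C₁ + C₃ := by positivity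
    linarith
  · rw [h.cost_optimal hP hs, ← ofReal_norm, ← ENNReal.ofReal_pow (norm_nonneg _),
      ← ENNReal.ofReal_coe_nnreal, ← ENNReal.ofReal_mul C₁.coe_nonneg,
      ENNReal.ofReal_le_ofReal_iff (by positivity)] at hc
    refine hc.trans ?_
    gcongr
    rw [add_assoc]; exact le_self_add

lemma mildSolution_restart (h : LQSetting Y B W R K VK S L VL) (hs : 0 ≤ s) {w : ℝ → U}
    (hw : SqInt s w) (x : H) {r : ℝ} (hsr : s ≤ r) (hrt : r ≤ t) :
    mildSolution Y B r (mildSolution Y B s x w r) w t = mildSolution Y B s x w t :=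
  mild_restart h.evol hs (h.B_meas.sqInt hs hw).locInt x hsr hrt

lemma IsPair.restart (h : LQSetting Y B W R K VK S L VL) (hs : 0 ≤ s) (hst : s ≤ t) {w : ℝ → U}
    {x : H} (hw : IsPair Y B s x w) : IsPair Y B t (mildSolution Y B s x w t) w := by
  refine ⟨hw.1.mono_left hst, (hw.2.mono_left hst).ae_eq ?_⟩
  exact (ae_restrict_iff' measurableSet_Ici).2 (Eventually.of_forall fun r hr =>
    (h.mildSolution_restart hs hw.1 x hst hr).symm)

/-- A pair orthogonal to all variations is the optimal one. -/
lemma optimal_unique (h : LQSetting Y B W R K VK S L VL) (hP : IsOptimalFamily Y B W R P u)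
    (hs : 0 ≤ s) {x : H} {w : ℝ → U} (hw : IsPair Y B s x w)
    (horth : ∀ v, IsPair Y B s 0 v → ∫ r in Ici s, crossCost W R (mildSolution Y B s x w) w
      (mildSolution Y B s 0 v) v r = 0) : w =ᵐ[volume.restrict (Ici s)] u s x := by
  have hp := hP.pair s hs x
  have hd1 : SqInt s (w + (-1 : 𝕜) • u s x) := hw.1.add (hp.1.const_smul _)
  have hdeq : ∀ t, s ≤ t → mildSolution Y B s 0 (w + (-1 : 𝕜) • u s x) t =
      mildSolution Y B s x w t - mildSolution Y B s x (u s x) t := by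
    intro t ht
    have h0 : (0 : H) = x + (-1 : 𝕜) • x := by simp
    rw [h0, h.mildSolution_add hs ht hw.1 (hp.1.const_smul _), mildSolution_smul]
    simp [sub_eq_add_neg]
  have hd : IsPair Y B s 0 (w + (-1 : 𝕜) • u s x) := by
    refine ⟨hd1, (hw.2.sub hp.2).ae_eq ?_⟩
    exact (ae_restrict_iff' measurableSet_Ici).2 (Eventually.of_forall fun t ht => by
      rw [hdeq t ht]; rfl)
  set d := w + (-1 : 𝕜) • u s x with hd_def
  -- Both `w` and the optimal pair are orthogonal to `d`, which starts from 0, so their difference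
  -- `d` is orthogonal to itself.
  have hcost : cost Y B W R s 0 d = 0 := by
    rw [h.cost_eq hs hd]
    have e1 := horth d hd
    have e2 := hP.repr s hs x 0 d hd
    rw [inner_zero_right] at e2
    have e3 : ∫ r in Ici s, crossCost W R (mildSolution Y B s 0 d) d (mildSolution Y B s 0 d) d r =
        (∫ r in Ici s, crossCost W R (mildSolution Y B s x w) w (mildSolution Y B s 0 d) d r) -
        ∫ r in Ici s, crossCost W R (mildSolution Y B s x (u s x)) (u s x)
          (mildSolution Y B s 0 d) d r := by
      rw [← integral_sub (h.integrableOn_crossCost hs hw.2 hw.1 hd.2 hd.1)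
        (h.integrableOn_crossCost hs hp.2 hp.1 hd.2 hd.1)]
      refine setIntegral_congr_fun measurableSet_Ici fun r hr => ?_
      have e4 : d r = w r - u s x r := by simp [hd_def, sub_eq_add_neg]
      simp only [crossCost]
      rw [hdeq r hr, e4, map_sub, map_sub, inner_sub_left (W r _), inner_sub_left (R r _)]
      ring
    rw [e3, e1, e2]
    simp
  obtain ⟨C, hC⟩ := h.detect
  obtain ⟨-, -, h1, -⟩ := hC s hs 0 d hd1.1 (by rw [hcost]; exact ENNReal.zero_lt_top)
  rw [hcost, mul_zero, nonpos_iff_eq_zero, sqInt,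
    lintegral_eq_zero_iff' (hd1.1.enorm.pow_const 2)] at h1
  filter_upwards [h1] with r hr
  have : d r = 0 := by simpa using hr
  have e4 : d r = w r - u s x r := by simp [hd_def, sub_eq_add_neg]
  rw [e4, sub_eq_zero] at this
  exact this

/-- Dynamic programming: the restriction of an optimal control is optimal. -/
lemma optimal_restart (h : LQSetting Y B W R K VK S L VL) (hP : IsOptimalFamily Y B W R P u)
    (hs : 0 ≤ s) (hst : s ≤ t) (x : H) :
    u s x =ᵐ[volume.restrict (Ici t)] u t (mildSolution Y B s x (u s x) t) := by
  have hp := hP.pair s hs x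
  refine h.optimal_unique hP (hs.trans hst) (hp.restart h hs hst) fun v hv => ?_
  -- A variation after `t`, extended by zero, is a variation after `s` whose trajectory vanishes up
  -- to `t`; orthogonality of the original optimal pair applies to it.
  set v' : ℝ → U := (Ici t).indicator v with hv'
  have hv'i : SqInt s v' := by
    refine (memLp_indicator_iff_restrict measurableSet_Ici).2 ?_
    rw [Measure.restrict_restrict measurableSet_Ici, inter_eq_left.2 (Ici_subset_Ici.2 hst)]
    exact hv.1
  have hz1 : ∀ r, s ≤ r → r ≤ t → mildSolution Y B s 0 v' r = 0 := by
    intro r hsr hrt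
    have : mildSolution Y B s 0 v' r = mildSolution Y B s 0 (fun _ => (0 : U)) r := by
      refine mild_congr ?_ _ hsr
      filter_upwards [ae_restrict_mem measurableSet_Ioc,
        ae_restrict_of_ae (Measure.ae_ne volume t)] with σ hσ hσt
      have : ¬ (t ≤ σ) := fun h' => hσt (le_antisymm (hσ.2.trans hrt) h')
      simp [hv', this]
    rw [this]
    simp [mildSolution]
  have hz2 : ∀ r, t ≤ r → mildSolution Y B s 0 v' r = mildSolution Y B t 0 v r := by
    intro r hr
    rw [← h.mildSolution_restart hs hv'i 0 hst hr, hz1 t hst le_rfl]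
    refine mild_congr ?_ _ hr
    filter_upwards [ae_restrict_mem measurableSet_Ioc] with σ hσ
    simp [hv', hσ.1.le]
  have hv'p : IsPair Y B s 0 v' := by
    refine ⟨hv'i, ?_⟩
    have h1 : SqInt s ((Ici t).indicator (mildSolution Y B t 0 v)) := by
      refine (memLp_indicator_iff_restrict measurableSet_Ici).2 ?_
      rw [Measure.restrict_restrict measurableSet_Ici, inter_eq_left.2 (Ici_subset_Ici.2 hst)]
      exact hv.2
    refine h1.ae_eq ((ae_restrict_iff' measurableSet_Ici).2 (Eventually.of_forall fun r hr => ?_))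
    by_cases hrt : t ≤ r
    · simp [indicator, hrt, hz2 r hrt]
    · simp [indicator, hrt, hz1 r hr (not_le.1 hrt).le]
  have e1 := hP.repr s hs x 0 v' hv'p
  rw [inner_zero_right] at e1
  rw [← e1]
  have e2 : ∀ r ∈ Ici s, crossCost W R (mildSolution Y B s x (u s x)) (u s x)
      (mildSolution Y B s 0 v') v' r = (Ici t).indicator (crossCost W R
        (mildSolution Y B t (mildSolution Y B s x (u s x) t) (u s x)) (u s x)
        (mildSolution Y B t 0 v) v) r := by
    intro r hr
    by_cases hrt : t ≤ r
    · have hvr : v' r = v r := indicator_of_mem (mem_Ici.2 hrt) v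
      rw [indicator_of_mem (mem_Ici.2 hrt), crossCost, crossCost, hz2 r hrt, hvr,
        h.mildSolution_restart hs hp.1 x hst hrt]
    · have hvr : v' r = 0 := indicator_of_notMem (by simpa using hrt) v
      rw [indicator_of_notMem (by simpa using hrt), crossCost, hz1 r hr (not_le.1 hrt).le, hvr]
      simp
  rw [setIntegral_congr_fun measurableSet_Ici e2, integral_indicator measurableSet_Ici,
    Measure.restrict_restrict measurableSet_Ici, inter_eq_left.2 (Ici_subset_Ici.2 hst)]

lemma optimal_trajectory_restart (h : LQSetting Y B W R K VK S L VL)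
    (hP : IsOptimalFamily Y B W R P u) (hs : 0 ≤ s) (x : H) {r : ℝ} (hsr : s ≤ r) (hrt : r ≤ t) :
    mildSolution Y B r (mildSolution Y B s x (u s x) r) (u r (mildSolution Y B s x (u s x) r)) t =
      mildSolution Y B s x (u s x) t := by
  rw [← h.mildSolution_restart hs (hP.pair s hs x).1 x hsr hrt]
  exact mildSolution_congr (h.optimal_restart hP hs hsr x).symm _ hrt

/-- Splitting the cost at an intermediate time. -/
lemma inner_P_split (h : LQSetting Y B W R K VK S L VL) (hP : IsOptimalFamily Y B W R P u)
    (hs : 0 ≤ s) (hst : s ≤ t) (x : H) {y : H} {w : ℝ → U} (hw : IsPair Y B s y w) :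
    inner 𝕜 (P s x) y = (∫ r in s..t, crossCost W R (mildSolution Y B s x (u s x)) (u s x)
        (mildSolution Y B s y w) w r) +
      inner 𝕜 (P t (mildSolution Y B s x (u s x) t)) (mildSolution Y B s y w t) := by
  have hp := hP.pair s hs x
  have hi := h.integrableOn_crossCost hs hp.2 hp.1 hw.2 hw.1
  rw [← hP.repr s hs x y w hw, ← hP.repr t (hs.trans hst) _ _ w (hw.restart h hs hst)]
  have e1 : ∫ r in Ici t, crossCost W R (mildSolution Y B t (mildSolution Y B s x (u s x) t)
        (u t (mildSolution Y B s x (u s x) t))) (u t (mildSolution Y B s x (u s x) t))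
      (mildSolution Y B t (mildSolution Y B s y w t) w) w r =
      ∫ r in Ici t, crossCost W R (mildSolution Y B s x (u s x)) (u s x)
        (mildSolution Y B s y w) w r := by
    refine integral_congr_ae ?_
    filter_upwards [ae_restrict_mem measurableSet_Ici, h.optimal_restart hP hs hst x] with r hr hur
    simp only [crossCost]
    rw [h.optimal_trajectory_restart hP hs x hst hr, h.mildSolution_restart hs hw.1 y hst hr, hur]
  rw [e1, intervalIntegral.integral_of_le hst, integral_Ici_eq_integral_Ioi,
    integral_Ici_eq_integral_Ioi, ← Ioc_union_Ioi_eq_Ioi hst]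
  rw [setIntegral_union (Ioc_disjoint_Ioi le_rfl) measurableSet_Ioi]
  · exact hi.mono_set fun r hr => hr.1.le
  · exact hi.mono_set fun r hr => hst.trans hr.le

end LQSetting

end

/-! ### Uniform bounds and weak continuity of `P` -/

section

variable {𝕜 H U : Type*} [RCLike 𝕜]
  [NormedAddCommGroup H] [InnerProductSpace 𝕜 H] [CompleteSpace H] [NormedSpace ℝ H]
  [NormedAddCommGroup U] [InnerProductSpace 𝕜 U] [CompleteSpace U]

lemma norm_le_of_isPositive {E : Type*} [NormedAddCommGroup E] [InnerProductSpace 𝕜 E]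
    {P : E →L[𝕜] E} (hP : P.IsPositive) {C : ℝ} (hC0 : 0 ≤ C)
    (hC : ∀ x, RCLike.re (inner 𝕜 (P x) x) ≤ C * ‖x‖ ^ 2) : ‖P‖ ≤ C := by
  rw [P.norm_eq_iSup_rayleighQuotient hP.isSymmetric]
  refine ciSup_le fun x => ?_
  rw [ContinuousLinearMap.rayleighQuotient, ContinuousLinearMap.reApplyInnerSelf,
    abs_of_nonneg (div_nonneg (hP.re_inner_nonneg_left x) (sq_nonneg _))]
  rcases eq_or_ne x 0 with rfl | hx
  · simpa using hC0
  · rw [div_le_iff₀ (by positivity)]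
    exact hC x

/-- Adjoints of an evolution operator may be integrated weakly. -/
lemma IsEvolutionOperator.inner_integral_adjoint {V : ℝ → ℝ → H →L[𝕜] H}
    (hV : IsEvolutionOperator V) {s t : ℝ} (hs : 0 ≤ s) (hst : s ≤ t) {g : ℝ → H}
    (hg : IntegrableOn g (Ioc s t)) (y : H) :
    inner 𝕜 (∫ r in s..t, ContinuousLinearMap.adjoint (V r s) (g r)) y =
      ∫ r in s..t, inner 𝕜 (g r) (V r s y) := by
  obtain ⟨C, hC0, hC⟩ := hV.exists_bound_left hs t
  -- The adjoints are only weakly continuous in `r`. Strong measurability is indispensable here: a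
  -- Bochner integral of a non-integrable function is 0 by convention.
  have hmeas : ∀ x, StronglyMeasurable fun r => ContinuousLinearMap.adjoint (V (max r s) s) x := by
    intro x
    refine stronglyMeasurable_of_weakly_continuous (𝕜 := 𝕜) fun y => ?_
    simp only [ContinuousLinearMap.adjoint_inner_right]
    exact ((hV.continuousOn_left s hs y).comp_continuous (by fun_prop)
      fun r => mem_Ici.2 (le_max_right _ _)).inner continuous_const
  have hint : IntegrableOn (fun r => ContinuousLinearMap.adjoint (V r s) (g r)) (Ioc s t) := by
    refine Integrable.mono' (hg.norm.const_mul C) ?_ ?_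
    · refine (aestronglyMeasurable_apply
        (D := fun r => ContinuousLinearMap.adjoint (V (max r s) s))
        (fun x => (hmeas x).aestronglyMeasurable) hg.1).congr ?_
      filter_upwards [ae_restrict_mem measurableSet_Ioc] with r hr
      rw [max_eq_left hr.1.le]
    · filter_upwards [ae_restrict_mem measurableSet_Ioc] with r hr
      refine ContinuousLinearMap.le_of_opNorm_le _ ?_ _
      rw [LinearIsometryEquiv.norm_map]
      exact hC r ⟨hr.1.le, hr.2⟩
  rw [← inner_conj_symm]
  have h1 := ContinuousLinearMap.intervalIntegral_comp_comm (innerSL 𝕜 y)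
    ((intervalIntegrable_iff_integrableOn_Ioc_of_le hst).2 hint)
  simp only [innerSL_apply_apply] at h1
  rw [← h1, intervalIntegral.integral_of_le hst, intervalIntegral.integral_of_le hst,
    ← integral_conj]
  refine integral_congr_ae (Eventually.of_forall fun r => ?_)
  simp only [ContinuousLinearMap.adjoint_inner_right, inner_conj_symm]

namespace LQSetting

variable {Y VK VL : ℝ → ℝ → H →L[𝕜] H} {B : ℝ → U →L[𝕜] H} {W S L : ℝ → H →L[𝕜] H}
  {R : ℝ → U →L[𝕜] U} {K : ℝ → H →L[𝕜] U} {s t : ℝ}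
  {P : ℝ → H →L[𝕜] H} {u : ℝ → H → ℝ → U}

lemma exists_norm_P_le (h : LQSetting Y B W R K VK S L VL) (hP : IsOptimalFamily Y B W R P u) :
    ∃ C : ℝ, 0 ≤ C ∧ ∀ s, 0 ≤ s → ‖P s‖ ≤ C := by
  obtain ⟨C, hC⟩ := h.optimal_bounds hP
  exact ⟨C, C.coe_nonneg, fun s hs => norm_le_of_isPositive (h.P_isPositive hP hs) C.coe_nonneg
    fun x => (hC s hs x).2.2⟩

/-- Optimal trajectories start continuously, uniformly in the initial time. -/
lemma exists_trajectory_near (h : LQSetting Y B W R K VK S L VL)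
    (hP : IsOptimalFamily Y B W R P u) : ∃ C : ℝ, 0 ≤ C ∧ ∀ s t, 0 ≤ s → s ≤ t → ∀ x,
      ‖mildSolution Y B s x (u s x) t - x‖ ≤
        ‖VK t s x - x‖ + C * (√(t - s) + (t - s)) * ‖x‖ := by
  obtain ⟨C₁, hC₁⟩ := h.optimal_bounds hP
  obtain ⟨C₂, hC₂⟩ := h.B_meas.exists_bound
  obtain ⟨C₃, hC₃⟩ := h.K_meas.exists_bound
  obtain ⟨C₄, hC₄⟩ := h.exists_feedback
  refine ⟨√C₄ * C₂ * (√C₁ + C₃ * C₁), by positivity, fun s t hs hst x => ?_⟩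
  obtain ⟨hu2, hz, -⟩ := hC₁ s hs x
  have hp := hP.pair s hs x
  set z := mildSolution Y B s x (u s x) with hzd
  have h0 : 0 ≤ t - s := sub_nonneg.2 hst
  have hint : ‖∫ r in s..t, VK t r (B r (u s x r - K r (z r)))‖ ≤
      ∫ r in s..t, √C₄ * (C₂ * (‖u s x r‖ + C₃ * (C₁ * ‖x‖))) := by
    refine intervalIntegral.norm_integral_le_of_norm_le hst (Eventually.of_forall fun r hr => ?_) ?_
    · have hr0 := hs.trans hr.1.le
      have e1 := norm_le_of_enorm_sq_le ((hC₄ r hr0 (B r (u s x r - K r (z r)))).2.2.2 t hr.2)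
      have e2 := hC₂ r hr0 (u s x r - K r (z r))
      have e3 : ‖u s x r - K r (z r)‖ ≤ ‖u s x r‖ + C₃ * (C₁ * ‖x‖) := by
        refine (norm_sub_le _ _).trans (add_le_add le_rfl ((hC₃ r hr0 _).trans ?_))
        gcongr
        exact hz r hr.1.le
      refine e1.trans ?_
      gcongr
      exact e2.trans (by gcongr)
    · have := (hp.1.locInt.intervalIntegrable hst).norm
      exact ((this.add intervalIntegrable_const).const_mul _).const_mul _
  have hval : ∫ r in s..t, √C₄ * (C₂ * (‖u s x r‖ + C₃ * (C₁ * ‖x‖))) ≤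
      √C₄ * C₂ * (√C₁ + C₃ * C₁) * (√(t - s) + (t - s)) * ‖x‖ := by
    rw [intervalIntegral.integral_const_mul, intervalIntegral.integral_const_mul,
      intervalIntegral.integral_add (hp.1.locInt.intervalIntegrable hst).norm
        intervalIntegrable_const, intervalIntegral.integral_const, smul_eq_mul]
    have e1 := integral_norm_le_of_sqInt_le hst hp.1 hu2
    -- The cross terms that complete the product `(√C₁ + C₃ C₁) (√(t - s) + (t - s))`.
    have e2 : (0 : ℝ) ≤ √C₁ * (t - s) * ‖x‖ + C₃ * C₁ * √(t - s) * ‖x‖ := by positivity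
    calc _ ≤ √C₄ * (C₂ * (√(t - s) * (√C₁ * ‖x‖) + (t - s) * (C₃ * (C₁ * ‖x‖)))) := by gcongr
      _ ≤ √C₄ * (C₂ * (√(t - s) * (√C₁ * ‖x‖) + (t - s) * (C₃ * (C₁ * ‖x‖)) +
          (√C₁ * (t - s) * ‖x‖ + C₃ * C₁ * √(t - s) * ‖x‖))) := by
        exact mul_le_mul_of_nonneg_left (mul_le_mul_of_nonneg_left
          (le_add_of_nonneg_right e2) (by positivity)) (by positivity)
      _ = _ := by ring
  rw [hzd, h.mildSolution_eq_stabilized hs hp.1 x hst, mild, add_sub_right_comm]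
  exact (norm_add_le _ _).trans (add_le_add le_rfl (hint.trans hval))

/-- `min` and `max` treat times before and after `s₀` together, as needed for the weak continuity of
`P` and for the closed loop in its initial time. -/
lemma tendsto_trajectory_diagonal (h : LQSetting Y B W R K VK S L VL)
    (hP : IsOptimalFamily Y B W R P u) {s₀ : ℝ} (hs₀ : 0 ≤ s₀) (x : H) :
    Tendsto (fun s => mildSolution Y B (min s s₀) x (u (min s s₀) x) (max s s₀))
      (𝓝[Ici 0] s₀) (𝓝 x) := by
  obtain ⟨C, hC0, hC⟩ := h.exists_trajectory_near hP
  rw [tendsto_iff_norm_sub_tendsto_zero]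
  have h1 := tendsto_iff_norm_sub_tendsto_zero.1 (h.VK_pert.1.tendsto_diagonal hs₀ x)
  have h2 : Tendsto (fun s => C * (√(max s s₀ - min s s₀) + (max s s₀ - min s s₀)) * ‖x‖)
      (𝓝[Ici 0] s₀) (𝓝 0) := by
    have hc : Continuous fun s => C * (√(max s s₀ - min s s₀) + (max s s₀ - min s s₀)) * ‖x‖ := by
      fun_prop
    have := hc.tendsto s₀
    simp only [max_self, min_self, sub_self, Real.sqrt_zero, add_zero, mul_zero, zero_mul] at this
    exact this.mono_left nhdsWithin_le_nhds
  have h3 := h1.add h2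
  rw [add_zero] at h3
  refine squeeze_zero' (Eventually.of_forall fun s => norm_nonneg _) ?_ h3
  filter_upwards [self_mem_nhdsWithin] with s hs
  exact hC _ _ (le_min hs hs₀) min_le_max x

/-- Split the form at `t`, testing with the feedback pair from `y`. The running cost over `[s, t]`
is small, and the rest measures how far the two trajectories have moved from `x` and `y`. -/
lemma exists_inner_P_near (h : LQSetting Y B W R K VK S L VL)
    (hP : IsOptimalFamily Y B W R P u) : ∃ C : ℝ, 0 ≤ C ∧ ∀ s t, 0 ≤ s → s ≤ t → ∀ x y,
      ‖inner 𝕜 (P s x) y - inner 𝕜 (P t x) y‖ ≤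
        C * (√(t - s) + (t - s)) * ‖x‖ * ‖y‖ +
        C * ‖mildSolution Y B s x (u s x) t - x‖ * ‖y‖ + C * ‖x‖ * ‖VK t s y - y‖ := by
  obtain ⟨C₁, hC₁⟩ := h.optimal_bounds hP
  obtain ⟨C₂, hC₂⟩ := h.W_meas.exists_bound
  obtain ⟨C₃, hC₃⟩ := h.R_meas.exists_bound
  obtain ⟨C₄, hC₄⟩ := h.exists_feedback
  obtain ⟨C₅, hC₅⟩ := h.K_meas.exists_bound
  obtain ⟨N, hN0, hN⟩ := h.exists_norm_P_le hP
  set c₁ : ℝ := C₂ * C₁ * √C₄ + C₃ * (C₅ * √C₄) * √C₁ with hc₁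
  have hc₁0 : 0 ≤ c₁ := by positivity
  refine ⟨c₁ + N * √C₄ + N, by positivity, fun s t hs hst x y => ?_⟩
  obtain ⟨hu2, hz, -⟩ := hC₁ s hs x
  obtain ⟨hfp, hfe, -, hfb⟩ := hC₄ s hs y
  have hp := hP.pair s hs x
  set z := mildSolution Y B s x (u s x) with hzd
  have h0 : 0 ≤ t - s := sub_nonneg.2 hst
  have hV : ∀ r, s ≤ r → ‖VK r s y‖ ≤ √C₄ * ‖y‖ := fun r hr => norm_le_of_enorm_sq_le (hfb r hr)
  have hsplit := h.inner_P_split hP hs hst x hfp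
  rw [hfe t hst, ← hzd] at hsplit
  have hint : ‖∫ r in s..t, crossCost W R z (u s x) (mildSolution Y B s y fun r => K r (VK r s y))
      (fun r => K r (VK r s y)) r‖ ≤ ∫ r in s..t, (C₂ * (C₁ * ‖x‖) * (√C₄ * ‖y‖) +
        C₃ * (C₅ * (√C₄ * ‖y‖)) * ‖u s x r‖) := by
    refine intervalIntegral.norm_integral_le_of_norm_le hst (Eventually.of_forall fun r hr => ?_) ?_
    · have hr0 := hs.trans hr.1.le
      rw [crossCost, hfe r hr.1.le]
      refine (norm_add_le _ _).trans (add_le_add ?_ ?_)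
      · refine (norm_inner_le_norm _ _).trans ?_
        gcongr
        · exact (hC₂ r hr0 _).trans (by gcongr; exact hz r hr.1.le)
        · exact hV r hr.1.le
      · refine (norm_inner_le_norm _ _).trans ?_
        have e1 := hC₃ r hr0 (u s x r)
        have e2 := (hC₅ r hr0 (VK r s y)).trans
          (mul_le_mul_of_nonneg_left (hV r hr.1.le) C₅.coe_nonneg)
        calc _ ≤ (C₃ * ‖u s x r‖) * (C₅ * (√C₄ * ‖y‖)) := by gcongr
          _ = _ := by ring
    · exact intervalIntegrable_const.add ((hp.1.locInt.intervalIntegrable hst).norm.const_mul _)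
  have hval : ∫ r in s..t, (C₂ * (C₁ * ‖x‖) * (√C₄ * ‖y‖) +
        C₃ * (C₅ * (√C₄ * ‖y‖)) * ‖u s x r‖) ≤ c₁ * (√(t - s) + (t - s)) * ‖x‖ * ‖y‖ := by
    rw [intervalIntegral.integral_add intervalIntegrable_const
      ((hp.1.locInt.intervalIntegrable hst).norm.const_mul _),
      intervalIntegral.integral_const, smul_eq_mul, intervalIntegral.integral_const_mul]
    have e1 := integral_norm_le_of_sqInt_le hst hp.1 hu2
    have e2 : (0 : ℝ) ≤ (C₂ * C₁ * √C₄ * √(t - s) + C₃ * (C₅ * √C₄) * √C₁ * (t - s)) * ‖x‖ * ‖y‖ := by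
      positivity
    calc _ ≤ (t - s) * (C₂ * (C₁ * ‖x‖) * (√C₄ * ‖y‖)) +
          C₃ * (C₅ * (√C₄ * ‖y‖)) * (√(t - s) * (√C₁ * ‖x‖)) :=
          add_le_add le_rfl (mul_le_mul_of_nonneg_left e1 (by positivity))
      _ ≤ _ := le_add_of_nonneg_right e2
      _ = _ := by rw [hc₁]; ring
  have hdiff : inner 𝕜 (P s x) y - inner 𝕜 (P t x) y = (∫ r in s..t, crossCost W R z (u s x)
      (mildSolution Y B s y fun r => K r (VK r s y)) (fun r => K r (VK r s y)) r) +
      (inner 𝕜 (P t (z t - x)) (VK t s y) + inner 𝕜 (P t x) (VK t s y - y)) := by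
    rw [hsplit, map_sub, inner_sub_left, inner_sub_right]
    ring
  have hPt := hN t (hs.trans hst)
  have g1 : ‖inner 𝕜 (P t (z t - x)) (VK t s y)‖ ≤ N * √C₄ * ‖z t - x‖ * ‖y‖ := by
    refine (norm_inner_le_norm _ _).trans ?_
    calc _ ≤ (N * ‖z t - x‖) * (√C₄ * ‖y‖) := by
          gcongr
          · exact (P t).le_of_opNorm_le hPt _
          · exact hV t hst
      _ = _ := by ring
  have g2 : ‖inner 𝕜 (P t x) (VK t s y - y)‖ ≤ N * ‖x‖ * ‖VK t s y - y‖ := by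
    refine (norm_inner_le_norm _ _).trans ?_
    gcongr
    exact (P t).le_of_opNorm_le hPt _
  rw [hdiff]
  have hk1 : c₁ ≤ c₁ + N * √C₄ + N := by
    have : 0 ≤ N * √C₄ + N := by positivity
    linarith
  have hk2 : N * √C₄ ≤ c₁ + N * √C₄ + N := by linarith
  have hk3 : N ≤ c₁ + N * √C₄ + N := by
    have : 0 ≤ c₁ + N * √C₄ := by positivity
    linarith
  calc _ ≤ c₁ * (√(t - s) + (t - s)) * ‖x‖ * ‖y‖ +
        (N * √C₄ * ‖z t - x‖ * ‖y‖ + N * ‖x‖ * ‖VK t s y - y‖) :=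
        (norm_add_le _ _).trans (add_le_add (hint.trans hval)
          ((norm_add_le _ _).trans (add_le_add g1 g2)))
    _ ≤ (c₁ + N * √C₄ + N) * (√(t - s) + (t - s)) * ‖x‖ * ‖y‖ +
        ((c₁ + N * √C₄ + N) * ‖z t - x‖ * ‖y‖ + (c₁ + N * √C₄ + N) * ‖x‖ * ‖VK t s y - y‖) := by
      gcongr
    _ = _ := by ring

/-- The optimal cost operators are weakly continuous in time. -/
lemma continuousOn_inner_P (h : LQSetting Y B W R K VK S L VL) (hP : IsOptimalFamily Y B W R P u)
    (x y : H) : ContinuousOn (fun s => inner 𝕜 (P s x) y) (Ici 0) := by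
  obtain ⟨C, hC0, hC⟩ := h.exists_inner_P_near hP
  intro s₀ hs₀
  have hs₀' : (0 : ℝ) ≤ s₀ := hs₀
  rw [ContinuousWithinAt, tendsto_iff_norm_sub_tendsto_zero]
  have h1 := tendsto_iff_norm_sub_tendsto_zero.1 (h.VK_pert.1.tendsto_diagonal hs₀' y)
  have h2 := tendsto_iff_norm_sub_tendsto_zero.1 (h.tendsto_trajectory_diagonal hP hs₀' x)
  have h3 : Tendsto (fun s => C * (√(max s s₀ - min s s₀) + (max s s₀ - min s s₀)) * ‖x‖ * ‖y‖)
      (𝓝[Ici 0] s₀) (𝓝 0) := by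
    have hc : Continuous fun s =>
        C * (√(max s s₀ - min s s₀) + (max s s₀ - min s s₀)) * ‖x‖ * ‖y‖ := by fun_prop
    have := hc.tendsto s₀
    simp only [max_self, min_self, sub_self, Real.sqrt_zero, add_zero, mul_zero, zero_mul] at this
    exact this.mono_left nhdsWithin_le_nhds
  have h4 := (h3.add ((h2.const_mul C).mul_const ‖y‖)).add (h1.const_mul (C * ‖x‖))
  simp only [mul_zero, zero_mul, add_zero] at h4
  refine squeeze_zero' (Eventually.of_forall fun s => norm_nonneg _) ?_ h4
  filter_upwards [self_mem_nhdsWithin] with s hs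
  have h5 := hC (min s s₀) (max s s₀) (le_min hs hs₀') min_le_max x y
  refine le_trans (le_of_eq ?_) h5
  rcases le_total s s₀ with h6 | h6
  · rw [min_eq_left h6, max_eq_right h6]
  · rw [min_eq_right h6, max_eq_left h6, norm_sub_rev]

lemma P_meas (h : LQSetting Y B W R K VK S L VL) (hP : IsOptimalFamily Y B W R P u) :
    IsBoundedMeasurableFamily P := by
  obtain ⟨N, hN0, hN⟩ := h.exists_norm_P_le hP
  refine ⟨fun x => ?_, N, hN0, hN⟩
  have hm : StronglyMeasurable fun s => P (max s 0) x := by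
    refine stronglyMeasurable_of_weakly_continuous (𝕜 := 𝕜) fun y => ?_
    have := (h.continuousOn_inner_P hP x y).comp_continuous
      (f := fun s : ℝ => max s 0) (by fun_prop) fun s => mem_Ici.2 (le_max_right _ _)
    have h2 := RCLike.continuous_conj.comp this
    simpa only [Function.comp_def, inner_conj_symm] using h2
  refine hm.aestronglyMeasurable.congr ?_
  filter_upwards [ae_restrict_mem measurableSet_Ici] with s hs
  rw [max_eq_left hs]

end LQSetting

end

/-! ### The optimal feedback law -/

section

variable {𝕜 H U : Type*} [RCLike 𝕜]
  [NormedAddCommGroup H] [InnerProductSpace 𝕜 H] [CompleteSpace H] [NormedSpace ℝ H]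
  [NormedAddCommGroup U] [InnerProductSpace 𝕜 U] [CompleteSpace U]

namespace LQSetting

variable {Y VK VL : ℝ → ℝ → H →L[𝕜] H} {B : ℝ → U →L[𝕜] H} {W S L : ℝ → H →L[𝕜] H}
  {R : ℝ → U →L[𝕜] U} {K : ℝ → H →L[𝕜] U} {s t : ℝ}
  {P : ℝ → H →L[𝕜] H} {u : ℝ → H → ℝ → U}

/-- The costate `P z` solves the backward adjoint equation of the stabilized system. -/
lemma inner_P_backward (h : LQSetting Y B W R K VK S L VL) (hP : IsOptimalFamily Y B W R P u)
    (hs : 0 ≤ s) (x : H) {r : ℝ} (hsr : s ≤ r) (hrt : r ≤ t) (y : H) :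
    inner 𝕜 (P r (mildSolution Y B s x (u s x) r)) y =
      inner 𝕜 (P t (mildSolution Y B s x (u s x) t)) (VK t r y) +
      ∫ ρ in r..t, inner 𝕜 (W ρ (mildSolution Y B s x (u s x) ρ) +
        ContinuousLinearMap.adjoint (K ρ) (R ρ (u s x ρ))) (VK ρ r y) := by
  obtain ⟨C, hC⟩ := h.exists_feedback
  obtain ⟨hfp, hfe, -, -⟩ := hC r (hs.trans hsr) y
  rw [h.inner_P_split hP (hs.trans hsr) hrt _ hfp, hfe t hrt,
    h.optimal_trajectory_restart hP hs x hsr hrt, add_comm]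
  congr 1
  rw [intervalIntegral.integral_of_le hrt, intervalIntegral.integral_of_le hrt]
  refine integral_congr_ae ?_
  have hae : ∀ᵐ ρ ∂(volume.restrict (Ioc r t)),
      u s x ρ = u r (mildSolution Y B s x (u s x) r) ρ :=
    ae_restrict_of_ae_restrict_of_subset (fun ρ hρ => hρ.1.le) (h.optimal_restart hP hs hsr x)
  filter_upwards [ae_restrict_mem measurableSet_Ioc, hae] with ρ hρ hu
  rw [crossCost, hfe ρ hρ.1.le, h.optimal_trajectory_restart hP hs x hsr hρ.1.le, ← hu,
    inner_add_left, ContinuousLinearMap.adjoint_inner_left]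

/-- The optimal control is given by the feedback `-R⁻¹ B* P`. -/
lemma optimal_feedback (h : LQSetting Y B W R K VK S L VL) (hP : IsOptimalFamily Y B W R P u)
    (hs : 0 ≤ s) (x : H) : ∀ᵐ r ∂(volume.restrict (Ici s)), u s x r =
      -((R r).inverse (ContinuousLinearMap.adjoint (B r)
        (P r (mildSolution Y B s x (u s x) r)))) := by
  have hp := hP.pair s hs x
  set z := mildSolution Y B s x (u s x) with hz
  have hq : SqInt s fun r => ContinuousLinearMap.adjoint (B r) (P r (z r)) :=
    h.adjointB_meas.sqInt hs ((h.P_meas hP).sqInt hs hp.2)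
  set G : ℝ → U := fun r => R r (u s x r) + ContinuousLinearMap.adjoint (B r) (P r (z r)) with hG
  have hGi : SqInt s G := (h.R_meas.sqInt hs hp.1).add hq
  have key : ∀ T, s ≤ T → ∀ᵐ r ∂(volume.restrict (Ioc s T)), G r = 0 := by
    intro T hT
    -- The test variation is the residual of the stationarity condition itself, cut off at `T`, so
    -- that the first-order condition reads `∫ ‖G‖² = 0`.
    set v : ℝ → U := (Ioc s T).indicator G with hv
    have hvi : SqInt s v := hGi.indicator measurableSet_Ioc
    obtain ⟨C, hC⟩ := h.stabilized_bounds
    obtain ⟨hy, -, -⟩ := hC s hs 0 v hvi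
    set y := mild VK (fun r => B r (v r)) s 0 with hyd
    have hKy := h.K_meas.sqInt hs hy
    set w : ℝ → U := fun r => v r + K r (y r) with hw
    have heq : ∀ r, s ≤ r → mildSolution Y B s 0 w r = y r := fun r hr =>
      (h.stabilized_eq_mildSolution hs hvi 0 hr).symm
    have hwp : IsPair Y B s 0 w := ⟨hvi.add hKy, hy.ae_eq
      ((ae_restrict_iff' measurableSet_Ici).2 (Eventually.of_forall fun r hr => (heq r hr).symm))⟩
    have hsplit := h.inner_P_split hP hs hT x hwp
    have hm : LocInt s fun r => W r (z r) + ContinuousLinearMap.adjoint (K r) (R r (u s x r)) :=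
      SqInt.locInt ((h.W_meas.sqInt hs hp.2).add
        (h.K_cont.adjoint.isBoundedMeasurableFamily.sqInt hs (h.R_meas.sqInt hs hp.1)))
    have hB : LocInt s fun r => B r (v r) := (h.B_meas.sqInt hs hvi).locInt
    obtain ⟨i1, i2, e⟩ := inner_mild_duality (q := fun r => P r (z r)) h.VK_pert.1
      h.VK_stable.locallyBounded hs hT hB (hm T) 0
      (fun r hr y => h.inner_P_backward hP hs x hr.1 hr.2 y)
    have hcc : ∫ r in s..T, crossCost W R z (u s x) (mildSolution Y B s 0 w) w r =
        (∫ r in s..T, inner 𝕜 (W r (z r) + ContinuousLinearMap.adjoint (K r) (R r (u s x r)))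
          (y r)) + ∫ r in s..T, inner 𝕜 (R r (u s x r)) (v r) := by
      rw [← intervalIntegral.integral_add]
      · refine intervalIntegral.integral_congr fun r hr => ?_
        rw [uIcc_of_le hT] at hr
        simp only [crossCost, hw]
        rw [heq r hr.1, inner_add_right, inner_add_left, ContinuousLinearMap.adjoint_inner_left]
        ring
      · exact (intervalIntegrable_iff_integrableOn_Ioc_of_le hT).2 i2
      · exact (intervalIntegrable_iff_integrableOn_Ioc_of_le hT).2
          (((h.R_meas.sqInt hs hp.1).integrableOn_inner hvi).mono_set fun r hr => hr.1.le)
    -- The running cost along `y`, including the part from `K y`, cancels against the duality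
    -- formula; `(R u, v) + (P z, B v)` remains.
    rw [inner_zero_right, hcc, heq T hT, e, inner_zero_right] at hsplit
    have hsum : ∫ r in s..T, (inner 𝕜 (R r (u s x r)) (v r) + inner 𝕜 (P r (z r)) (B r (v r))) =
        0 := by
      rw [intervalIntegral.integral_add]
      · linear_combination -hsplit
      · exact (intervalIntegrable_iff_integrableOn_Ioc_of_le hT).2
          (((h.R_meas.sqInt hs hp.1).integrableOn_inner hvi).mono_set fun r hr => hr.1.le)
      · exact (intervalIntegrable_iff_integrableOn_Ioc_of_le hT).2 i1
    rw [intervalIntegral.integral_of_le hT] at hsum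
    have hsq : ∫ r in Ioc s T, ((‖G r‖ ^ 2 : ℝ) : 𝕜) = 0 := by
      rw [← hsum]
      refine setIntegral_congr_fun measurableSet_Ioc fun r hr => ?_
      have hvr : v r = G r := indicator_of_mem hr G
      simp only [hvr]
      rw [← ContinuousLinearMap.adjoint_inner_left, ← inner_add_left]
      simp only [hG]
      rw [inner_self_eq_norm_sq_to_K]
      push_cast
      rfl
    rw [integral_ofReal, RCLike.ofReal_eq_zero, setIntegral_eq_zero_iff_of_nonneg_ae
      (Eventually.of_forall fun r => sq_nonneg _)
      (hGi.integrable_sq.mono_set fun r hr => hr.1.le)] at hsq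
    filter_upwards [hsq] with r hr
    simpa using hr
  have hall : ∀ᵐ r ∂(volume.restrict (Ici s)), G r = 0 := by
    rw [← Measure.restrict_congr_set Ioi_ae_eq_Ici]
    have hU : Ioi s = ⋃ n : ℕ, Ioc s (s + n) := by
      ext r
      simp only [mem_Ioi, mem_iUnion, mem_Ioc]
      refine ⟨fun hr => ?_, fun ⟨n, hn⟩ => hn.1⟩
      obtain ⟨n, hn⟩ := exists_nat_ge (r - s)
      exact ⟨n, hr, by linarith⟩
    rw [hU, ae_restrict_iUnion_iff]
    exact fun n => key _ (by simp)
  filter_upwards [hall, ae_restrict_mem measurableSet_Ici] with r hr hrs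
  have hR := h.R_unit (hs.trans hrs)
  rw [← inverse_apply_of_isUnit hR (u s x r), eq_neg_of_add_eq_zero_left hr, map_neg]

end LQSetting

end

/-! ### The closed loop and the Riccati equation -/

section

variable {𝕜 H U : Type*} [RCLike 𝕜]
  [NormedAddCommGroup H] [InnerProductSpace 𝕜 H] [CompleteSpace H] [NormedSpace ℝ H]
  [NormedAddCommGroup U] [InnerProductSpace 𝕜 U] [CompleteSpace U]

namespace LQSetting

variable {Y VK VL : ℝ → ℝ → H →L[𝕜] H} {B : ℝ → U →L[𝕜] H} {W S L : ℝ → H →L[𝕜] H}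
  {R : ℝ → U →L[𝕜] U} {K : ℝ → H →L[𝕜] U} {s t : ℝ}
  {P : ℝ → H →L[𝕜] H} {u : ℝ → H → ℝ → U}

lemma feedback_meas (h : LQSetting Y B W R K VK S L VL) :
    IsBoundedMeasurableFamily (feedbackTerm B R) :=
  h.B_meas.comp (h.invR_meas.comp h.adjointB_meas)

/-- The optimal trajectories form a family of bounded operators. -/
lemma exists_closedLoop (h : LQSetting Y B W R K VK S L VL) (hP : IsOptimalFamily Y B W R P u) :
    ∃ V : ℝ → ℝ → H →L[𝕜] H, ∀ s t, 0 ≤ s → s ≤ t → ∀ x,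
      V t s x = mildSolution Y B s x (u s x) t := by
  obtain ⟨C, hC⟩ := h.optimal_bounds hP
  have : ∀ s t, 0 ≤ s → s ≤ t → ∃ T : H →L[𝕜] H, ∀ x, T x = mildSolution Y B s x (u s x) t := by
    intro s t hs hst
    refine ⟨LinearMap.mkContinuous
      { toFun := fun x => mildSolution Y B s x (u s x) t
        map_add' := fun x y => ?_
        map_smul' := fun c x => ?_ } C fun x => (hC s hs x).2.1 t hst, fun x => rfl⟩
    · rw [mildSolution_congr (hP.add s hs x y) _ hst,
        h.mildSolution_add hs hst (hP.pair s hs x).1 (hP.pair s hs y).1]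
    · rw [mildSolution_congr (hP.smul s hs c x) _ hst, mildSolution_smul, RingHom.id_apply]
  choose T hT using this
  refine ⟨fun t s => if hs : 0 ≤ s ∧ s ≤ t then T s t hs.1 hs.2 else 0, fun s t hs hst x => ?_⟩
  simp only [hs, hst, and_self, dif_pos, hT]

/-- The composition law is dynamic programming. Continuity in the initial time reduces to the
diagonal through `V(t,a) x - V(t,b) x = V(t,b) (V(b,a) x - x)` and the uniform bound on `V(t,b)`. -/
lemma closedLoop_evolution (h : LQSetting Y B W R K VK S L VL) (hP : IsOptimalFamily Y B W R P u)
    {V : ℝ → ℝ → H →L[𝕜] H}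
    (hV : ∀ s t, 0 ≤ s → s ≤ t → ∀ x, V t s x = mildSolution Y B s x (u s x) t) :
    IsEvolutionOperator V where
  self t ht := by
    ext x
    rw [hV t t ht le_rfl]
    exact mild_self h.evol ht x
  comp t r s hs hsr hrt := by
    ext x
    rw [ContinuousLinearMap.comp_apply, hV s r hs hsr, hV r t (hs.trans hsr) hrt,
      hV s t hs (hsr.trans hrt), h.optimal_trajectory_restart hP hs x hsr hrt]
  continuousOn_left s hs x :=
    (h.continuousOn_mildSolution hs (hP.pair s hs x).1 x).congr fun t ht => hV s t hs ht x
  continuousOn_right t ht x := by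
    obtain ⟨C, hC⟩ := h.optimal_bounds hP
    intro s₀ hs₀
    rw [ContinuousWithinAt, tendsto_iff_norm_sub_tendsto_zero]
    have h1 := ((tendsto_iff_norm_sub_tendsto_zero.1
      (h.tendsto_trajectory_diagonal hP hs₀.1 x)).mono_left
        (nhdsWithin_mono s₀ (Icc_subset_Ici_self : Icc 0 t ⊆ Ici 0))).const_mul (C : ℝ)
    rw [mul_zero] at h1
    refine squeeze_zero' (Eventually.of_forall fun s => norm_nonneg _) ?_ h1
    filter_upwards [self_mem_nhdsWithin] with s hs
    have key : ∀ a b, 0 ≤ a → a ≤ b → b ≤ t → ‖V t a x - V t b x‖ ≤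
        C * ‖mildSolution Y B a x (u a x) b - x‖ := by
      intro a b ha hab hbt
      have hb := ha.trans hab
      have e : V t a x = V t b (V b a x) := by
        rw [hV a b ha hab, hV b t hb hbt, h.optimal_trajectory_restart hP ha x hab hbt,
          hV a t ha (hab.trans hbt)]
      rw [e, ← map_sub, hV a b ha hab, hV b t hb hbt]
      exact (hC b hb _).2.1 t hbt
    rcases le_total s s₀ with h2 | h2
    · rw [min_eq_left h2, max_eq_right h2]
      exact key s s₀ hs.1 h2 hs₀.2
    · rw [min_eq_right h2, max_eq_left h2, norm_sub_rev]
      exact key s₀ s hs₀.1 h2 hs.2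

lemma closedLoop_perturbed (h : LQSetting Y B W R K VK S L VL) (hP : IsOptimalFamily Y B W R P u)
    {V : ℝ → ℝ → H →L[𝕜] H}
    (hV : ∀ s t, 0 ≤ s → s ≤ t → ∀ x, V t s x = mildSolution Y B s x (u s x) t) :
    IsPerturbedEvolution Y (fun r => -(feedbackTerm B R r ∘L P r)) V := by
  refine ⟨h.closedLoop_evolution hP hV, fun s t hs hst x => ?_⟩
  rw [hV s t hs hst, mildSolution, intervalIntegral.integral_of_le hst,
    intervalIntegral.integral_of_le hst]
  congr 1
  refine integral_congr_ae ?_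
  have hae := ae_restrict_of_ae_restrict_of_subset (s := Ioc s t) (fun r hr => hr.1.le)
    (h.optimal_feedback hP hs x)
  filter_upwards [ae_restrict_mem measurableSet_Ioc, hae] with r hr hur
  rw [hV s r hs hr.1.le, hur]
  simp [feedbackTerm]

/-- The family of optimal cost operators solves the integral Riccati equation. -/
theorem isRiccatiSolution (h : LQSetting Y B W R K VK S L VL)
    (hP : IsOptimalFamily Y B W R P u) : IsRiccatiSolution Y B W R P := by
  have hPm := h.P_meas hP
  obtain ⟨N, -, hN⟩ := h.exists_norm_P_le hP
  obtain ⟨V, hV⟩ := h.exists_closedLoop hP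
  refine ⟨fun s hs => h.P_isPositive hP hs, ⟨N, hN⟩, hPm.1, V, h.closedLoop_perturbed hP hV,
    fun s t hs hst x => ?_⟩
  have hVe := h.closedLoop_evolution hP hV
  have hg : IntegrableOn (fun r => (W r + P r ∘L feedbackTerm B R r ∘L P r) (V r s x))
      (Ioc s t) :=
    (h.W_meas.add (hPm.comp (h.feedback_meas.comp hPm))).locInt hs
      (locInt_of_continuousOn (hVe.continuousOn_left s hs x)) t
  refine ext_inner_right 𝕜 fun y => ?_
  rw [inner_add_left, hVe.inner_integral_adjoint hs hst hg, ContinuousLinearMap.adjoint_inner_left,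
    h.inner_P_split hP hs hst x (hP.pair s hs y), hV s t hs hst, hV s t hs hst, add_comm]
  congr 1
  rw [intervalIntegral.integral_of_le hst, intervalIntegral.integral_of_le hst]
  refine integral_congr_ae ?_
  have hae := fun x => ae_restrict_of_ae_restrict_of_subset (s := Ioc s t) (fun r hr => hr.1.le)
    (h.optimal_feedback hP hs x)
  filter_upwards [ae_restrict_mem measurableSet_Ioc, hae x, hae y] with r hr hx hy
  have hr0 := hs.trans hr.1.le
  have hPs := (h.P_isPositive hP hr0).inner_left_eq_inner_right
  rw [crossCost, hV s r hs hr.1.le, hV s r hs hr.1.le, _root_.add_apply, inner_add_left]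
  congr 1
  -- Moving `R` onto the second control cancels its `R⁻¹`; the one left in the first control
  -- produces `P B R⁻¹ B* P`.
  rw [h.inner_R hr0, hy, map_neg, apply_inverse_of_isUnit (h.R_unit hr0), hx]
  simp only [inner_neg_neg, ContinuousLinearMap.comp_apply, feedbackTerm]
  rw [hPs, ContinuousLinearMap.adjoint_inner_right]

end LQSetting

end

/-! ### Any Riccati solution represents the optimal cost -/

section

variable {𝕜 H U : Type*} [RCLike 𝕜]
  [NormedAddCommGroup H] [InnerProductSpace 𝕜 H] [CompleteSpace H] [NormedSpace ℝ H]
  [NormedAddCommGroup U] [InnerProductSpace 𝕜 U] [CompleteSpace U]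

/-- Meant for integrands without a definite sign, such as the one left before completing the square:
the negative part only lowers the left side. -/
lemma ofReal_integral_le_lintegral {f : ℝ → ℝ} {μ : Measure ℝ} (hf : Integrable f μ) :
    ENNReal.ofReal (∫ r, f r ∂μ) ≤ ∫⁻ r, ENNReal.ofReal (f r) ∂μ := by
  refine ENNReal.ofReal_le_of_le_toReal ?_
  rw [integral_eq_lintegral_pos_part_sub_lintegral_neg_part hf]
  exact sub_le_self _ ENNReal.toReal_nonneg

namespace LQSetting

variable {Y VK VL : ℝ → ℝ → H →L[𝕜] H} {B : ℝ → U →L[𝕜] H} {W S L : ℝ → H →L[𝕜] H}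
  {R : ℝ → U →L[𝕜] U} {K : ℝ → H →L[𝕜] U} {s t : ℝ}
  {Q : ℝ → H →L[𝕜] H} {V : ℝ → ℝ → H →L[𝕜] H}

/-- A solution of the integral Riccati equation in weak form, with its evolution operator. -/
structure IsRiccatiPair (Y : ℝ → ℝ → H →L[𝕜] H) (B : ℝ → U →L[𝕜] H) (W : ℝ → H →L[𝕜] H)
    (R : ℝ → U →L[𝕜] U) (Q : ℝ → H →L[𝕜] H) (V : ℝ → ℝ → H →L[𝕜] H) : Prop where
  pos : ∀ s, 0 ≤ s → (Q s).IsPositive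
  meas : IsBoundedMeasurableFamily Q
  pert : IsPerturbedEvolution Y (fun r => -(feedbackTerm B R r ∘L Q r)) V
  weak : ∀ s t, 0 ≤ s → s ≤ t → ∀ x y : H, inner 𝕜 (Q s x) y =
    inner 𝕜 (Q t (V t s x)) (V t s y) +
      ∫ r in s..t, inner 𝕜 ((W r + Q r ∘L feedbackTerm B R r ∘L Q r) (V r s x)) (V r s y)

/-- Pairing with `y` removes the adjoints and the vector-valued integral. -/
lemma exists_isRiccatiPair (h : LQSetting Y B W R K VK S L VL) (hQ : IsRiccatiSolution Y B W R Q) :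
    ∃ V, IsRiccatiPair Y B W R Q V := by
  obtain ⟨N, hN⟩ := hQ.bounded
  obtain ⟨V, hV, hE⟩ := hQ.equation
  have hQm : IsBoundedMeasurableFamily Q :=
    ⟨hQ.measurable, N, (norm_nonneg _).trans (hN 0 le_rfl), hN⟩
  refine ⟨V, hQ.isPositive, hQm, hV, fun s t hs hst x y => ?_⟩
  have hg : IntegrableOn (fun r => (W r + Q r ∘L feedbackTerm B R r ∘L Q r) (V r s x))
      (Ioc s t) :=
    (h.W_meas.add (hQm.comp (h.feedback_meas.comp hQm))).locInt hs
      (locInt_of_continuousOn (hV.1.continuousOn_left s hs x)) t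
  rw [hE s t hs hst x, inner_add_left, hV.1.inner_integral_adjoint hs hst hg,
    ContinuousLinearMap.adjoint_inner_left]

/-- The gain `R⁻¹ B* Q`. -/
def gain (B : ℝ → U →L[𝕜] H) (R : ℝ → U →L[𝕜] U) (Q : ℝ → H →L[𝕜] H) (r : ℝ) : H →L[𝕜] U :=
  (R r).inverse ∘L ContinuousLinearMap.adjoint (B r) ∘L Q r

lemma gain_meas (h : LQSetting Y B W R K VK S L VL) (hQ : IsBoundedMeasurableFamily Q) :
    IsBoundedMeasurableFamily (gain B R Q) :=
  h.invR_meas.comp (h.adjointB_meas.comp hQ)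

lemma R_gain (h : LQSetting Y B W R K VK S L VL) {r : ℝ} (hr : 0 ≤ r) (x : H) :
    R r (gain B R Q r x) = ContinuousLinearMap.adjoint (B r) (Q r x) :=
  apply_inverse_of_isUnit (h.R_unit hr) _

/-- The Riccati integrand is the running cost of the feedback control, which makes it comparable
with the cost functional. -/
lemma inner_quadratic (h : LQSetting Y B W R K VK S L VL) {r : ℝ} (hr : 0 ≤ r)
    (hQ : (Q r).IsPositive) (x y : H) :
    inner 𝕜 ((W r + Q r ∘L feedbackTerm B R r ∘L Q r) x) y =
      inner 𝕜 (W r x) y + inner 𝕜 (gain B R Q r x) (R r (gain B R Q r y)) := by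
  rw [_root_.add_apply, inner_add_left, h.R_gain hr, ContinuousLinearMap.adjoint_inner_right]
  congr 1
  exact hQ.inner_left_eq_inner_right _ _

lemma inner_quadratic_symm (h : LQSetting Y B W R K VK S L VL) {r : ℝ} (hr : 0 ≤ r)
    (hQ : (Q r).IsPositive) (x y : H) :
    inner 𝕜 ((W r + Q r ∘L feedbackTerm B R r ∘L Q r) x) y =
      inner 𝕜 x ((W r + Q r ∘L feedbackTerm B R r ∘L Q r) y) := by
  rw [← inner_conj_symm x, h.inner_quadratic hr hQ, h.inner_quadratic hr hQ, map_add,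
    inner_conj_symm, inner_conj_symm, h.inner_R hr, (h.W_pos r hr).inner_left_eq_inner_right]

lemma IsRiccatiPair.trajectory (hQ : IsRiccatiPair Y B W R Q V)
    (hs : 0 ≤ s) (hst : s ≤ t) (x : H) :
    mildSolution Y B s x (fun r => -(gain B R Q r (V r s x))) t = V t s x := by
  rw [hQ.pert.2 s t hs hst, mildSolution]
  simp [feedbackTerm, gain]

lemma IsRiccatiPair.admissible (h : LQSetting Y B W R K VK S L VL)
    (hQ : IsRiccatiPair Y B W R Q V) (hs : 0 ≤ s) (x : H) :
    IsAdmissible s (fun r => -(gain B R Q r (V r s x))) :=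
  ((h.gain_meas hQ.meas).aestronglyMeasurable (Ici_subset_Ici.2 hs)
    ((hQ.pert.1.continuousOn_left s hs x).aestronglyMeasurable measurableSet_Ici)).neg

/-- The feedback control of a Riccati solution costs at most the value of its quadratic form. -/
lemma IsRiccatiPair.cost_le (h : LQSetting Y B W R K VK S L VL) (hQ : IsRiccatiPair Y B W R Q V)
    (hs : 0 ≤ s) (x : H) : cost Y B W R s x (fun r => -(gain B R Q r (V r s x))) ≤
      ENNReal.ofReal (RCLike.re (inner 𝕜 (Q s x) x)) := by
  have hU : Ioi s = ⋃ n : ℕ, Ioc s (s + n) := by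
    ext r
    simp only [mem_Ioi, mem_iUnion, mem_Ioc]
    refine ⟨fun hr => ?_, fun ⟨n, hn⟩ => hn.1⟩
    obtain ⟨n, hn⟩ := exists_nat_ge (r - s)
    exact ⟨n, hr, by linarith⟩
  rw [cost, ← Measure.restrict_congr_set Ioi_ae_eq_Ici, hU, setLIntegral_iUnion_of_directed]
  swap
  · refine (directed_of_isDirected_le fun m n hmn => Ioc_subset_Ioc_right ?_)
    have : (m : ℝ) ≤ n := Nat.cast_le.2 hmn
    linarith
  refine iSup_le fun n => ?_
  have hn : s ≤ s + n := by simp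
  set M : ℝ → H →L[𝕜] H := fun r => W r + Q r ∘L feedbackTerm B R r ∘L Q r with hM
  have hi : IntegrableOn (fun r => inner 𝕜 (M r (V r s x)) (V r s x)) (Ioc s (s + n)) := by
    have hc := hQ.pert.1.continuousOn_left s hs x
    refine IntegrableOn.inner_continuousOn (𝕜 := 𝕜) ?_ (hc.mono Icc_subset_Ici_self)
    exact (h.W_meas.add (hQ.meas.comp (h.feedback_meas.comp hQ.meas))).locInt hs
      (locInt_of_continuousOn hc) _
  have hw := hQ.weak s (s + n) hs hn x x
  have hre : RCLike.re (inner 𝕜 (Q s x) x) =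
      RCLike.re (inner 𝕜 (Q (s + n) (V (s + n) s x)) (V (s + n) s x)) +
        ∫ r in Ioc s (s + n), RCLike.re (inner 𝕜 (M r (V r s x)) (V r s x)) := by
    have e := integral_re hi
    rw [hw, map_add, e, intervalIntegral.integral_of_le hn]
  have hpt : ∀ r ∈ Ioc s (s + n), RCLike.re (inner 𝕜 (M r (V r s x)) (V r s x)) =
      RCLike.re (inner 𝕜 (V r s x) (W r (V r s x))) +
      RCLike.re (inner 𝕜 (gain B R Q r (V r s x)) (R r (gain B R Q r (V r s x)))) := by
    intro r hr
    have hr0 := hs.trans hr.1.le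
    rw [hM, h.inner_quadratic hr0 (hQ.pos r hr0), map_add,
      (h.W_pos r hr0).inner_left_eq_inner_right]
  calc _ = ∫⁻ r in Ioc s (s + n),
        ENNReal.ofReal (RCLike.re (inner 𝕜 (M r (V r s x)) (V r s x))) := by
        refine setLIntegral_congr_fun measurableSet_Ioc fun r hr => ?_
        rw [hQ.trajectory hs hr.1.le, hpt r hr]
        simp
    _ = ENNReal.ofReal (∫ r in Ioc s (s + n),
        RCLike.re (inner 𝕜 (M r (V r s x)) (V r s x))) := by
        refine (ofReal_integral_eq_lintegral_ofReal hi.re ?_).symm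
        refine (ae_restrict_iff' measurableSet_Ioc).2 (Eventually.of_forall fun r hr => ?_)
        simp only [Pi.zero_apply]
        have hr0 := hs.trans hr.1.le
        rw [hpt r hr]
        exact add_nonneg ((h.W_pos r hr0).re_inner_nonneg_right _) (h.re_R_nonneg hr0 _)
    _ ≤ _ := by
        refine ENNReal.ofReal_le_ofReal ?_
        rw [hre]
        exact le_add_of_nonneg_left ((hQ.pos _ (hs.trans hn)).re_inner_nonneg_left _)

/-- The feedback of `Q` costs at most a multiple of `‖x‖²`, so `detect` bounds its trajectories.
Mild solutions may then be rewritten over `V`. -/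
lemma IsRiccatiPair.locallyBounded (h : LQSetting Y B W R K VK S L VL)
    (hQ : IsRiccatiPair Y B W R Q V) : LocallyBounded V := by
  obtain ⟨C, hC⟩ := h.detect
  obtain ⟨N, hN⟩ := hQ.meas.exists_bound
  have key : ∀ s t, 0 ≤ s → s ≤ t → ∀ x, ‖V t s x‖ ≤ √(C * (1 + N) : NNReal) * ‖x‖ := by
    intro s t hs hst x
    have hle := hQ.cost_le h hs x
    have hc : ENNReal.ofReal (RCLike.re (inner 𝕜 (Q s x) x)) ≤ N * ‖x‖ₑ ^ 2 := by
      rw [← ofReal_norm, ← ENNReal.ofReal_coe_nnreal, ← ENNReal.ofReal_pow (norm_nonneg _),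
        ← ENNReal.ofReal_mul N.coe_nonneg]
      refine ENNReal.ofReal_le_ofReal ?_
      calc _ ≤ ‖Q s x‖ * ‖x‖ := re_inner_le_norm _ _
        _ ≤ (N * ‖x‖) * ‖x‖ := by gcongr; exact hN s hs x
        _ = _ := by ring
    obtain ⟨-, -, -, -, hb, -⟩ := hC s hs x _ (hQ.admissible h hs x)
      (hle.trans_lt ENNReal.ofReal_lt_top)
    refine norm_le_of_enorm_sq_le ?_
    rw [← hQ.trajectory hs hst]
    refine (hb t hst).trans ?_
    push_cast
    rw [mul_assoc, add_mul, one_mul]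
    exact mul_le_mul' le_rfl (add_le_add le_rfl (hle.trans hc))
  exact fun T => ⟨_, Real.sqrt_nonneg _, fun s t hs hst _ =>
    ContinuousLinearMap.opNorm_le_bound _ (Real.sqrt_nonneg _) (key s t hs hst)⟩

/-- Along a mild solution, `Q z` solves a backward adjoint equation. -/
lemma IsRiccatiPair.backward (h : LQSetting Y B W R K VK S L VL) (hQ : IsRiccatiPair Y B W R Q V)
    (hs : 0 ≤ s) {b : ℝ → H} (hb : LocInt s b) (x : H) {r : ℝ} (hsr : s ≤ r) (hrt : r ≤ t)
    (y : H) : inner 𝕜 (Q r (mild V b s x r)) y = inner 𝕜 (Q t (mild V b s x t)) (V t r y) +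
      ∫ ρ in r..t, inner 𝕜 ((W ρ + Q ρ ∘L feedbackTerm B R ρ ∘L Q ρ) (mild V b s x ρ) -
        Q ρ (b ρ)) (V ρ r y) := by
  have hr0 := hs.trans hsr
  set M : ℝ → H →L[𝕜] H := fun r => W r + Q r ∘L feedbackTerm B R r ∘L Q r with hM
  have hMm : IsBoundedMeasurableFamily M :=
    h.W_meas.add (hQ.meas.comp (h.feedback_meas.comp hQ.meas))
  have hVc := hQ.pert.1.continuousOn_left r hr0 y
  -- For the homogeneous trajectory from `y` the weak Riccati equation is itself the backward
  -- equation; conjugation afterwards exchanges the two slots.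
  obtain ⟨i1, i2, e⟩ := inner_mild_duality (𝕜 := 𝕜) (q := fun ρ => Q ρ (V ρ r y))
    (m := fun ρ => M ρ (V ρ r y)) hQ.pert.1 (hQ.locallyBounded h) hr0 hrt
    (hb.mono hsr) (hMm.locInt hr0 (locInt_of_continuousOn hVc) t) (mild V b s x r) (by
      intro ρ hρ w
      rw [hQ.weak ρ t (hr0.trans hρ.1) hρ.2, ← ContinuousLinearMap.comp_apply (V t ρ),
        hQ.pert.1.comp t ρ r hr0 hρ.1 hρ.2]
      congr 1
      refine intervalIntegral.integral_congr fun σ hσ => ?_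
      rw [uIcc_of_le hρ.2] at hσ
      simp only [hM]
      rw [← ContinuousLinearMap.comp_apply (V σ ρ) (V ρ r),
        hQ.pert.1.comp σ ρ r hr0 hρ.1 hσ.1])
  have hmr : ∀ ρ, r ≤ ρ → mild V b r (mild V b s x r) ρ = mild V b s x ρ := fun ρ hρ =>
    mild_restart hQ.pert.1 hs hb x hsr hρ
  simp only [hmr t hrt] at e
  have e2 : ∫ ρ in r..t, inner 𝕜 (M ρ (V ρ r y)) (mild V b r (mild V b s x r) ρ) =
      ∫ ρ in r..t, inner 𝕜 (M ρ (V ρ r y)) (mild V b s x ρ) := by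
    refine intervalIntegral.integral_congr fun ρ hρ => ?_
    rw [uIcc_of_le hrt] at hρ
    simp only [hmr ρ hρ.1]
  have i2' : IntegrableOn (fun ρ => inner 𝕜 (M ρ (V ρ r y)) (mild V b s x ρ)) (Ioc r t) :=
    i2.congr_fun (fun ρ hρ => by simp only [hmr ρ hρ.1.le]) measurableSet_Ioc
  rw [e2] at e
  have hself : V r r y = y := by rw [hQ.pert.1.self r hr0]; rfl
  rw [hself] at e
  have hsub := intervalIntegral.integral_sub
    ((intervalIntegrable_iff_integrableOn_Ioc_of_le hrt).2 i2')
    ((intervalIntegrable_iff_integrableOn_Ioc_of_le hrt).2 i1)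
  have hmain : inner 𝕜 (Q r y) (mild V b s x r) = inner 𝕜 (Q t (V t r y)) (mild V b s x t) +
      ∫ ρ in r..t, (inner 𝕜 (M ρ (V ρ r y)) (mild V b s x ρ) -
        inner 𝕜 (Q ρ (V ρ r y)) (b ρ)) := by
    rw [hsub]; linear_combination -e
  have hconj := congrArg (starRingEnd 𝕜) hmain
  rw [map_add, inner_conj_symm, inner_conj_symm, intervalIntegral.integral_of_le hrt,
    ← integral_conj, ← (hQ.pos r hr0).inner_left_eq_inner_right,
    ← (hQ.pos t (hr0.trans hrt)).inner_left_eq_inner_right] at hconj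
  rw [hconj, intervalIntegral.integral_of_le hrt]
  congr 1
  refine setIntegral_congr_fun measurableSet_Ioc fun ρ hρ => ?_
  have hρ0 := hr0.trans hρ.1.le
  rw [map_sub, inner_conj_symm, inner_conj_symm, inner_sub_left,
    (hQ.pos ρ hρ0).inner_left_eq_inner_right, hM,
    h.inner_quadratic_symm hρ0 (hQ.pos ρ hρ0)]

/-- Completing the square. -/
lemma re_completion_le (h : LQSetting Y B W R K VK S L VL) {r : ℝ} (hr : 0 ≤ r)
    (hQ : (Q r).IsPositive) (z : H) (v : U) :
    RCLike.re (inner 𝕜 ((W r + Q r ∘L feedbackTerm B R r ∘L Q r) z -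
        Q r (B r (v + gain B R Q r z))) z -
        inner 𝕜 (Q r z) (B r (v + gain B R Q r z))) ≤
      RCLike.re (inner 𝕜 z (W r z)) + RCLike.re (inner 𝕜 v (R r v)) := by
  set k := gain B R Q r z with hk
  have e1 : inner 𝕜 (Q r z) (B r (v + k)) = inner 𝕜 (R r k) (v + k) := by
    rw [hk, h.R_gain hr, ContinuousLinearMap.adjoint_inner_left]
  have e2 : inner 𝕜 (Q r (B r (v + k))) z = inner 𝕜 (v + k) (R r k) := by
    rw [hQ.inner_left_eq_inner_right, hk, h.R_gain hr, ContinuousLinearMap.adjoint_inner_right]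
  have e3 : RCLike.re (inner 𝕜 (R r k) (v + k)) = RCLike.re (inner 𝕜 (v + k) (R r k)) :=
    inner_re_symm _ _
  -- The right side exceeds the left by exactly this square.
  have e4 := h.re_R_nonneg hr (v + k)
  have e5 : RCLike.re (inner 𝕜 k (R r v)) = RCLike.re (inner 𝕜 v (R r k)) := by
    rw [← h.inner_R hr]; exact inner_re_symm _ _
  rw [inner_sub_left, h.inner_quadratic hr hQ, ← hk, e1, e2,
    (h.W_pos r hr).inner_left_eq_inner_right]
  simp only [map_sub, map_add, e3]
  simp only [map_add, inner_add_left, inner_add_right] at e4 ⊢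
  linarith

/-- The quadratic form of a Riccati solution bounds the cost of every control from below. -/
lemma IsRiccatiPair.le_cost (h : LQSetting Y B W R K VK S L VL) (hQ : IsRiccatiPair Y B W R Q V)
    (hs : 0 ≤ s) (x : H) {u : ℝ → U} (hu : IsAdmissible s u) :
    ENNReal.ofReal (RCLike.re (inner 𝕜 (Q s x) x)) ≤ cost Y B W R s x u := by
  rcases eq_or_ne (cost Y B W R s x u) ⊤ with htop | htop
  · rw [htop]; exact le_top
  obtain ⟨C, hC⟩ := h.detect
  obtain ⟨hu2, hz2, -, -, -, hz0⟩ := hC s hs x u hu (lt_top_iff_ne_top.2 htop)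
  obtain ⟨N, hN⟩ := hQ.meas.exists_bound
  set z := mildSolution Y B s x u with hz
  have hlb := hQ.locallyBounded h
  -- The deviation of `u` from the feedback of `Q`; over `V` the trajectory is driven by `B w`.
  set w : ℝ → U := fun r => u r + gain B R Q r (z r) with hw
  have hw2 : SqInt s w := hu2.add ((h.gain_meas hQ.meas).sqInt hs hz2)
  have hb : LocInt s fun r => B r (w r) := (h.B_meas.sqInt hs hw2).locInt
  have hzV : ∀ r, s ≤ r → z r = mild V (fun r => B r (w r)) s x r := by
    intro r hr
    have := (mild_rebase h.evol (h.feedback_meas.comp hQ.meas).neg hQ.pert hlb hs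
      (h.B_meas.sqInt hs hu2).locInt x).2 r hr
    rw [← mildSolution_eq, ← hz] at this
    rw [this]
    congr 1
    ext ρ
    simp [hw, feedbackTerm, gain]
  set M : ℝ → H →L[𝕜] H := fun r => W r + Q r ∘L feedbackTerm B R r ∘L Q r with hM
  have hMm : IsBoundedMeasurableFamily M :=
    h.W_meas.add (hQ.meas.comp (h.feedback_meas.comp hQ.meas))
  have step : ∀ t, s ≤ t → ENNReal.ofReal (RCLike.re (inner 𝕜 (Q s x) x)) ≤
      ENNReal.ofReal (N * ‖z t‖ ^ 2) + cost Y B W R s x u := by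
    intro t hst
    have hm : LocInt s fun r => M r (z r) - Q r (B r (w r)) :=
      SqInt.locInt ((hMm.sqInt hs hz2).sub (hQ.meas.sqInt hs (h.B_meas.sqInt hs hw2)))
    -- Pairing `z` with its own costate `Q z` gives the energy identity that differentiating `(Q z,
    -- z)` would give formally.
    obtain ⟨i1, i2, e⟩ := inner_mild_duality (𝕜 := 𝕜) (q := fun r => Q r (z r))
      hQ.pert.1 hlb hs hst hb (hm t) x (by
        intro r hr y
        rw [hzV r hr.1, hzV t hst, hQ.backward h hs hb x hr.1 hr.2 y]
        congr 1
        refine intervalIntegral.integral_congr fun ρ hρ => ?_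
        rw [uIcc_of_le hr.2] at hρ
        simp only [hzV ρ (hr.1.trans hρ.1), hM])
    have hzs : z s = x := mild_self h.evol hs x
    have i2' : IntegrableOn (fun r => inner 𝕜 (M r (z r) - Q r (B r (w r))) (z r)) (Ioc s t) :=
      i2.congr_fun (fun ρ hρ => by simp only [hzV ρ hρ.1.le]) measurableSet_Ioc
    have e2 : ∫ r in s..t, inner 𝕜 (M r (z r) - Q r (B r (w r)))
        (mild V (fun r => B r (w r)) s x r) =
        ∫ r in Ioc s t, inner 𝕜 (M r (z r) - Q r (B r (w r))) (z r) := by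
      rw [intervalIntegral.integral_of_le hst]
      exact setIntegral_congr_fun measurableSet_Ioc fun r hr => by simp only [← hzV r hr.1.le]
    simp only [e2, ← hzV t hst, hzs] at e
    rw [intervalIntegral.integral_of_le hst] at e
    have hsub := integral_sub i2' i1
    have hval : inner 𝕜 (Q s x) x = inner 𝕜 (Q t (z t)) (z t) + ∫ r in Ioc s t,
        (inner 𝕜 (M r (z r) - Q r (B r (w r))) (z r) - inner 𝕜 (Q r (z r)) (B r (w r))) := by
      rw [hsub]; linear_combination -e
    have hre := integral_re (i2'.sub i1)
    simp only [Pi.sub_apply] at hre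
    rw [hval, map_add, ← hre]
    refine ENNReal.ofReal_add_le.trans (add_le_add (ENNReal.ofReal_le_ofReal ?_) ?_)
    · calc _ ≤ ‖Q t (z t)‖ * ‖z t‖ := re_inner_le_norm _ _
        _ ≤ (N * ‖z t‖) * ‖z t‖ := by gcongr; exact hN t (hs.trans hst) _
        _ = _ := by ring
    · refine (ofReal_integral_le_lintegral (i2'.sub i1).re).trans ?_
      rw [cost]
      refine le_trans ?_ (lintegral_mono_set (Ioc_subset_Icc_self.trans Icc_subset_Ici_self :
        Ioc s t ⊆ Ici s))
      refine setLIntegral_mono' measurableSet_Ioc fun r hr => ENNReal.ofReal_le_ofReal ?_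
      have hr0 := hs.trans hr.1.le
      exact h.re_completion_le hr0 (hQ.pos r hr0) (z r) (u r)
  -- Uniform boundedness of `Q` and decay of finite-cost trajectories remove the terminal term.
  have hlim : Tendsto (fun t => ENNReal.ofReal (N * ‖z t‖ ^ 2) + cost Y B W R s x u) atTop
      (𝓝 (ENNReal.ofReal (N * ‖(0 : H)‖ ^ 2) + cost Y B W R s x u)) :=
    (ENNReal.tendsto_ofReal ((hz0.norm.pow 2).const_mul _)).add_const _
  simp only [norm_zero, ne_eq, OfNat.ofNat_ne_zero, not_false_eq_true, zero_pow, mul_zero,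
    ENNReal.ofReal_zero, zero_add] at hlim
  exact ge_of_tendsto hlim ((eventually_ge_atTop s).mono step)

/-- The quadratic form of a Riccati solution is the optimal cost. -/
theorem isLeast_cost (h : LQSetting Y B W R K VK S L VL) (hQ : IsRiccatiSolution Y B W R Q)
    (hs : 0 ≤ s) (x : H) :
    IsLeast {J : ENNReal | ∃ u : ℝ → U, IsAdmissible s u ∧ cost Y B W R s x u = J}
      (ENNReal.ofReal (RCLike.re (inner 𝕜 (Q s x) x))) := by
  obtain ⟨V, hV⟩ := h.exists_isRiccatiPair hQ
  have ha := hV.admissible h hs x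
  refine ⟨⟨_, ha, le_antisymm (hV.cost_le h hs x) (hV.le_cost h hs x ha)⟩,
    ?_⟩
  rintro J ⟨u, hu, rfl⟩
  exact hV.le_cost h hs x hu

/-- Both quadratic forms equal the minimal cost, and a symmetric operator is determined by its
quadratic form, over the reals as well. -/
theorem riccati_unique (h : LQSetting Y B W R K VK S L VL) {P : ℝ → H →L[𝕜] H}
    (hQ : IsRiccatiSolution Y B W R Q) (hP : IsRiccatiSolution Y B W R P) (hs : 0 ≤ s) :
    Q s = P s := by
  have hq := hQ.isPositive s hs
  have hp := hP.isPositive s hs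
  have key : ∀ x, RCLike.re (inner 𝕜 (Q s x) x) = RCLike.re (inner 𝕜 (P s x) x) := fun x =>
    (ENNReal.ofReal_eq_ofReal_iff (hq.re_inner_nonneg_left x) (hp.re_inner_nonneg_left x)).1
      ((h.isLeast_cost hQ hs x).unique (h.isLeast_cost hP hs x))
  have hsym := hq.isSymmetric.sub hp.isSymmetric
  have h0 : (Q s : H →ₗ[𝕜] H) - P s = 0 := by
    refine hsym.inner_map_self_eq_zero.1 fun x => ?_
    rw [← hsym.coe_re_inner_apply_self, LinearMap.sub_apply, inner_sub_left, map_sub]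
    simp [key x]
  exact ContinuousLinearMap.coe_injective (sub_eq_zero.1 h0)

end LQSetting

end

end InfiniteLQ

end

theorem mainTheorem5 {𝕜 H U : Type*} [RCLike 𝕜]
    [NormedAddCommGroup H] [InnerProductSpace 𝕜 H] [CompleteSpace H] [NormedSpace ℝ H]
    [NormedAddCommGroup U] [InnerProductSpace 𝕜 U] [CompleteSpace U]
    (Y : ℝ → ℝ → H →L[𝕜] H) (hY : InfiniteLQ.IsEvolutionOperator Y)
    (B : ℝ → U →L[𝕜] H) (hB : InfiniteLQ.IsBoundedContinuousFamily B)
    (W : ℝ → H →L[𝕜] H) (hW : InfiniteLQ.IsBoundedContinuousFamily W)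
    (hWpos : ∀ t, 0 ≤ t → (W t).IsPositive)
    (R : ℝ → U →L[𝕜] U) (hR : InfiniteLQ.IsBoundedContinuousFamily R)
    (hRsa : ∀ t, 0 ≤ t → IsSelfAdjoint (R t))
    (hRcoer : ∃ δ : ℝ, 0 < δ ∧ ∀ t, 0 ≤ t → ∀ w : U,
      δ * ‖w‖ ^ 2 ≤ RCLike.re (inner 𝕜 w (R t w)))
    (hstab : InfiniteLQ.UniformlyStabilizable Y B)
    (hdet : ∃ S : ℝ → H →L[𝕜] H,
      (∀ t, 0 ≤ t → InfiniteLQ.IsPositiveSqrt (S t) (W t)) ∧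
        InfiniteLQ.UniformlyDetectable Y S) :
    ∃ P : ℝ → H →L[𝕜] H,
      InfiniteLQ.IsRiccatiSolution Y B W R P ∧
      (∀ Q : ℝ → H →L[𝕜] H, InfiniteLQ.IsRiccatiSolution Y B W R Q →
        ∀ s, 0 ≤ s → Q s = P s) ∧
      (∀ s, 0 ≤ s → ∀ z₀ : H,
        IsLeast {J : ENNReal | ∃ u : ℝ → U, InfiniteLQ.IsAdmissible s u ∧
            InfiniteLQ.cost Y B W R s z₀ u = J}
          (ENNReal.ofReal (RCLike.re (inner 𝕜 (P s z₀) z₀)))) ∧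
      (∀ s, 0 ≤ s → ∀ (z₀ : H) (u : ℝ → U), InfiniteLQ.IsAdmissible s u →
        InfiniteLQ.cost Y B W R s z₀ u < ⊤ →
          Tendsto (InfiniteLQ.mildSolution Y B s z₀ u) atTop (𝓝 0)) := by
  obtain ⟨K, hK, VK, hVK, hVKs⟩ := hstab
  obtain ⟨S, hS, L, hL, VL, hVL, hVLs⟩ := hdet
  have h : InfiniteLQ.LQSetting Y B W R K VK S L VL :=
    ⟨hY, hB, hW, hWpos, hR, hRsa, hRcoer, hK, hVK, hVKs, hS, hL, hVL, hVLs⟩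
  obtain ⟨P, u, hP⟩ := h.exists_optimalFamily
  have hPR := h.isRiccatiSolution hP
  obtain ⟨C, hC⟩ := h.detect
  exact ⟨P, hPR, fun Q hQ s hs => h.riccati_unique hQ hPR hs,
    fun s hs z₀ => h.isLeast_cost hPR hs z₀,
    fun s hs z₀ u hu hJ => (hC s hs z₀ u hu hJ).2.2.2.2.2⟩
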